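/- **Theorem 2.** Let $N$ teeth stand at the points of the unit circle with angles $2\pi j/N$, $j=1,\dots,N$, with independent heights $\xi_1,\dots,\xi_N$ uniform on $[0,1]$. A hoop (the section by a plane of the vertical cylinder over the unit circle) is *supported* by three teeth if it touches their tops, lies nowhere below the top of any tooth, and the centre of the circle lies inside the triangle spanned by the three teeth. Number the supporting teeth in positive cyclic order, with angles $\varphi=(\varphi_1,\varphi_2,\varphi_3)$ modulo $2\pi$, and let $\vartheta_1,\vartheta_2,\vartheta_3$ be the arcs, $\varphi_{i+1}-\varphi_i=\vartheta_{i-1} \bmod 2\pi$ ($i$ modulo 3). Then $\varphi$ is determined up to a cyclic permutation, and $\vartheta$ is a point of $$\mathcal T=\{\vartheta: 0<\vartheta_i<\pi,\ \vartheta_1+\vartheta_2+\vartheta_3=2\pi\},\qquad \widehat{\mathcal T}=\mathcal T/\mathbb Z_3,$$ up to a cyclic permutation. Equip $\mathcal T$ with the area $d\vartheta_1\,d\vartheta_2$, and let $\mu$ be the corresponding area on $\widehat{\mathcal T}$ (a third of the image of the area of $\mathcal T$). Put $$p(\vartheta)=2\pi\,\sin\frac{\vartheta_1}{2}\sin\frac{\vartheta_2}{2}\sin\frac{\vartheta_3}{2}\Big(\frac1{\pi^2}+\sum_{i=1}^3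 f(\vartheta_i)\Big),\qquad f(\xi)=\int_0^{\xi/2}\frac{(\xi-2\varphi)\sin\varphi}{((\pi-\varphi)\cos\varphi+\sin\varphi)^3}\,d\varphi .$$ 1. For every $N$, almost surely at most one unordered triple of teeth supports the hoop; for odd $N\ge 3$ almost surely exactly one does. 2. The limit density of the support triple on the space of triples $\varphi$ (modulo $\mathbb Z_3$) is $p(\vartheta)/(2\pi)$: if $\varphi$ has arcs $\vartheta\in\mathcal T$, if $N_k\to\infty$, and if the angles of the teeth $n^{(k)}_1,n^{(k)}_2,n^{(k)}_3$ of the comb with $N_k$ teeth tend to $\varphi_1,\varphi_2,\varphi_3$ modulo $2\pi$, then $$\lim_{k\to\infty}\Big(\frac{N_k}{2\pi}\Big)^3\,\mathsf P\{\text{the teeth } n^{(k)}_1,n^{(k)}_2,n^{(k)}_3 \text{ support the hoop}\}=\frac{p(\vartheta)}{2\pi}.$$ 3. Modulo rotations, the limit distribution of the support triple on $\widehat{\mathcal T}$ has density $p$ with respect to $\mu$: the function $p$ is a well defined probability density on $(\widehat{\mathcal T},\mu)$, and for every Borel set $B\subset\widehat{\mathcal T}$ with $\mu(\partial B)=0$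 the probability that the hoop is supported by three teeth whose class of arcs belongs to $B$ tends to $\int_B p\,d\mu$ as $N\to\infty$. -/

import Mathlib

open MeasureTheory Filter Topology

noncomputable section

namespace CircularComb

/-- The angle `2πj/N` of the tooth number `j = 1, …, N`; the element `j : Fin N` stands for the
tooth number `j + 1`. -/
def toothAngle (N : ℕ) (j : Fin N) : Real.Angle :=
  ((2 * Real.pi * ((j : ℝ) + 1) / (N : ℝ) : ℝ) : Real.Angle)

/-- The point of the unit circle (in the horizontal plane) at angle `α`. -/
def circlePoint (α : Real.Angle) : ℝ × ℝ := (α.cos, α.sin)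

/-- The law of the lengths `ξ` of the `N` teeth: independent, uniform on `[0, 1]`. -/
def combMeasure (N : ℕ) : Measure (Fin N → ℝ) :=
  Measure.pi fun _ => (volume : Measure ℝ).restrict (Set.Icc 0 1)

/-- The height at angle `α` of the hoop cut out by the plane `z = h 0 + h 1 * x + h 2 * y`. -/
def hoopHeight (h : Fin 3 → ℝ) (α : Real.Angle) : ℝ :=
  h 0 + h 1 * (circlePoint α).1 + h 2 * (circlePoint α).2

/-- The hoop lies on the comb with tooth lengths `ξ` and is supported by the teeth
`n 0, n 1, n 2`: in some position it is nowhere below the top of a tooth, it touches the tops of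
these three teeth, and its centre of mass projects inside the triangle that they span
(so they are three different teeth). -/
def IsSupportedBy {N : ℕ} (ξ : Fin N → ℝ) (n : Fin 3 → Fin N) : Prop :=
  (∃ h : Fin 3 → ℝ,
    (∀ j, ξ j ≤ hoopHeight h (toothAngle N j)) ∧
    ∀ i, ξ (n i) = hoopHeight h (toothAngle N (n i))) ∧
  (0 : ℝ × ℝ) ∈
    interior (convexHull ℝ (Set.range fun i => circlePoint (toothAngle N (n i))))

/-- The space `𝒯` of triples of arcs `ϑ₁, ϑ₂, ϑ₃ ∈ (0, π)` of total length `2π`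
(indexed by `0, 1, 2`). -/
abbrev ArcTriple : Type :=
  {ϑ : Fin 3 → ℝ // (∀ i, 0 < ϑ i ∧ ϑ i < Real.pi) ∧ ϑ 0 + ϑ 1 + ϑ 2 = 2 * Real.pi}

/-- The points `φ 0, φ 1, φ 2` of the circle, in this (positive) cyclic order, cut it into the
arcs `ϑ`, where the arc `ϑ i` is the one opposite to `φ i`. The indices are cyclic. -/
def HasArcs (φ : Fin 3 → Real.Angle) (ϑ : ArcTriple) : Prop :=
  ∀ i, φ (i + 1) - φ i = ((ϑ.1 (i - 1) : ℝ) : Real.Angle)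

/-- Two triples of arcs are equivalent if they differ by a cyclic permutation. -/
instance arcSetoid : Setoid ArcTriple where
  r ϑ ϑ' := ∃ k : Fin 3, ∀ i, ϑ'.1 i = ϑ.1 (i + k)
  iseqv :=
    { refl := fun _ => ⟨0, fun _ => by simp⟩
      symm := by
        rintro _ _ ⟨k, hk⟩
        exact ⟨-k, fun i => by rw [hk]; simp⟩
      trans := by
        rintro _ _ _ ⟨k, hk⟩ ⟨l, hl⟩
        exact ⟨l + k, fun i => by rw [hl, hk, add_assoc]⟩ }

/-- The quotient of the space of triples of arcs by cyclic permutations, with its quotient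
topology and σ-algebra. -/
abbrev ArcClass : Type := Quotient arcSetoid

/-- The area `dϑ₁ dϑ₂` on the space of triples of arcs; since `ϑ₁ + ϑ₂ + ϑ₃ = 2π`, it is
`(1/3) |dϑ₃ ∧ dϑ₂ + dϑ₁ ∧ dϑ₃ + dϑ₂ ∧ dϑ₁|`. -/
def arcArea : Measure ArcTriple :=
  Measure.comap (fun ϑ : ArcTriple => (ϑ.1 0, ϑ.1 1)) (volume : Measure (ℝ × ℝ))

/-- The same area on the quotient. The projection is three to one (up to a null set), so that the
area of a set of classes is a third of the area of its preimage. -/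
def classArea : Measure ArcClass :=
  (3⁻¹ : NNReal) • Measure.map (fun ϑ : ArcTriple => (⟦ϑ⟧ : ArcClass)) arcArea

/-- The function `f`. -/
def f (x : ℝ) : ℝ :=
  ∫ φ in (0 : ℝ)..x / 2, (x - 2 * φ) * Real.sin φ /
    ((Real.pi - φ) * Real.cos φ + Real.sin φ) ^ 3

/-- The density as a function of the triple of arcs. -/
def arcDensity (ϑ : ArcTriple) : ℝ :=
  2 * Real.pi * (∏ i, Real.sin (ϑ.1 i / 2)) * (1 / Real.pi ^ 2 + ∑ i, f (ϑ.1 i))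

theorem arcDensity_eq {ϑ ϑ' : ArcTriple} (h : ϑ ≈ ϑ') : arcDensity ϑ = arcDensity ϑ' := by
  obtain ⟨k, hk⟩ := h
  have h1 : ∏ i, Real.sin (ϑ'.1 i / 2) = ∏ i, Real.sin (ϑ.1 i / 2) := by
    simp only [hk]
    exact Equiv.prod_comp (Equiv.addRight k) fun i => Real.sin (ϑ.1 i / 2)
  have h2 : ∑ i, f (ϑ'.1 i) = ∑ i, f (ϑ.1 i) := by
    simp only [hk]
    exact Equiv.sum_comp (Equiv.addRight k) fun i => f (ϑ.1 i)
  unfold arcDensity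
  rw [h1, h2]

/-- The density `p` on the space of classes. -/
def density : ArcClass → ℝ :=
  Quotient.lift arcDensity fun _ _ h => arcDensity_eq h

end CircularComb

end

/-!
A hoop `z = h 0 + h 1 x + h 2 y` that is supported by three teeth is the lowest one at the centre
among all the hoops that lie above the comb: a plane that is nonnegative at the vertices of a
triangle around the centre, but not positive at the centre, vanishes
(`eq_zero_of_hoopHeight_nonneg`). Hence the position of a supported hoop is unique, and two
different supporting triples would give four coplanar tops, which has probability zero
(`ae_range_eq`). Conversely, the teeth that touch the lowest hoop surround the centre; by
Carathéodory's theorem three of them do so, unless two of them are opposite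
(`exists_isSupportedBy`).

For the limit density, condition on the heights of the three teeth. With the gaps between the unit
height and these heights rescaled by `N`, the probability that all the other teeth are
below the plane is a product over the teeth of `1 - x⁺ / N`, where `x` is the plane through the
rescaled gaps. It tends to `exp (-Φ)`, where `Φ` is the mean of `x⁺` over the circle
(`meanPosPart`), and it is dominated by `exp (3 - x 0)`, because the mean of the heights of a plane
over the teeth is its height at the centre (`prod_one_sub_le`). In the coordinates
`x = r (t + cos (α - β))` on the space of planes, the limit `∫ exp (-Φ)` becomes elementary. The
part `t ≥ 1` gives `1 / π²`. For `t = cos ψ < 1` the plane is negative on an arc of length `2 ψ`,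
which has to fit into one of the arcs `ϑ i`; the directions `β` for which it does have the measure
`∑ (ϑ i - 2 ψ)⁺`, and this gives `∑ f (ϑ i)` (`lintegral_admissible`, `tendsto_density`).

The total mass of the density is reduced by the cyclic symmetry of the area to a one-dimensional
integral of `f`, which has an explicit antiderivative after two integrations by parts
(`integral_f_mul_weight`, `lintegral_arcDensity`).

Finally, a supporting triple is represented by an increasing triple of teeth. Its law,
spread over the cells of a cubic lattice, has a density on the space of triples `u 0 < u 1 < u 2` of
angles which converges pointwise. Fatou's lemma yields a lower bound for the limit of the
probability that the class of arcs is in `B` (`lintegral_density_le_liminf`). Applied also to the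
complement of `B`, it gives the convergence, since the limit has total mass one
(`tendsto_supportEvent`).
-/

namespace CircularComb

/-! ### Planes through three points over the unit circle -/

theorem hoopHeight_eq (h : Fin 3 → ℝ) (α : Real.Angle) :
    hoopHeight h α = h 0 + h 1 * α.cos + h 2 * α.sin := rfl

theorem hoopHeight_add (g h : Fin 3 → ℝ) (α : Real.Angle) :
    hoopHeight (g + h) α = hoopHeight g α + hoopHeight h α := by
  simp only [hoopHeight_eq, Pi.add_apply]; ring

theorem hoopHeight_sub (g h : Fin 3 → ℝ) (α : Real.Angle) :
    hoopHeight (g - h) α = hoopHeight g α - hoopHeight h α := by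
  simp only [hoopHeight_eq, Pi.sub_apply]; ring

theorem hoopHeight_smul (r : ℝ) (h : Fin 3 → ℝ) (α : Real.Angle) :
    hoopHeight (r • h) α = r * hoopHeight h α := by
  simp only [hoopHeight_eq, Pi.smul_apply, smul_eq_mul]; ring

/-- The matrix that maps the coefficients of a plane to its heights at the angles `φ 0`, `φ 1`,
`φ 2` of the unit circle. -/
noncomputable def evalMatrix (φ : Fin 3 → Real.Angle) : Matrix (Fin 3) (Fin 3) ℝ :=
  Matrix.of fun i => ![1, (φ i).cos, (φ i).sin]

theorem evalMatrix_mulVec (φ : Fin 3 → Real.Angle) (h : Fin 3 → ℝ) (i : Fin 3) :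
    (evalMatrix φ).mulVec h i = hoopHeight h (φ i) := by
  simp [evalMatrix, Matrix.mulVec, dotProduct, Fin.sum_univ_three, hoopHeight_eq]
  ring

theorem det_evalMatrix (φ : Fin 3 → Real.Angle) :
    (evalMatrix φ).det =
      (φ 2 - φ 1).sin + (φ 0 - φ 2).sin + (φ 1 - φ 0).sin := by
  simp only [evalMatrix, Matrix.det_fin_three, Matrix.of_apply, sub_eq_add_neg,
    Real.Angle.sin_add, Real.Angle.sin_neg, Real.Angle.cos_neg, Matrix.cons_val]
  ring

/-- The coefficients of the plane that has the heights `y` at the angles `φ`. -/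
noncomputable def planeThrough (φ : Fin 3 → Real.Angle) (y : Fin 3 → ℝ) : Fin 3 → ℝ :=
  (evalMatrix φ)⁻¹.mulVec y

theorem hoopHeight_planeThrough {φ : Fin 3 → Real.Angle} (hφ : (evalMatrix φ).det ≠ 0)
    (y : Fin 3 → ℝ) (i : Fin 3) : hoopHeight (planeThrough φ y) (φ i) = y i := by
  rw [← evalMatrix_mulVec, planeThrough, Matrix.mulVec_mulVec,
    Matrix.mul_nonsing_inv _ (Ne.isUnit hφ), Matrix.one_mulVec]

theorem eq_planeThrough {φ : Fin 3 → Real.Angle} (hφ : (evalMatrix φ).det ≠ 0)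
    {y h : Fin 3 → ℝ} (hy : ∀ i, y i = hoopHeight h (φ i)) : h = planeThrough φ y := by
  have : y = (evalMatrix φ).mulVec h := funext fun i => by rw [hy, evalMatrix_mulVec]
  rw [this, planeThrough, Matrix.mulVec_mulVec, Matrix.nonsing_inv_mul _ (Ne.isUnit hφ),
    Matrix.one_mulVec]

/-- The zeroth coefficient of the plane with heights `y`, its height at the centre, is a
combination of the heights, with the barycentric coordinates of the centre as coefficients. -/
theorem planeThrough_zero {φ : Fin 3 → Real.Angle} (y : Fin 3 → ℝ) :
    planeThrough φ y 0 = ((φ 2 - φ 1).sin * y 0 + (φ 0 - φ 2).sin * y 1 + (φ 1 - φ 0).sin * y 2) /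
      (evalMatrix φ).det := by
  rw [planeThrough, Matrix.inv_def, Matrix.adjugate_fin_three]
  simp only [evalMatrix, Matrix.of_apply, Matrix.cons_val, Matrix.smul_of, Matrix.smul_cons,
    smul_eq_mul, Matrix.mulVec, dotProduct, Fin.sum_univ_three, sub_eq_add_neg,
    Real.Angle.sin_add, Real.Angle.sin_neg, Real.Angle.cos_neg, Ring.inverse_eq_inv']
  rw [div_eq_mul_inv]
  ring

/-- A plane that is nonnegative over the vertices of a triangle around the centre, but not positive
over the centre, is the zero plane. -/
theorem eq_zero_of_hoopHeight_nonneg {φ : Fin 3 → Real.Angle}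
    (hφ : (0 : ℝ × ℝ) ∈ interior (convexHull ℝ (Set.range fun i => circlePoint (φ i))))
    {d : Fin 3 → ℝ} (hd : d 0 ≤ 0) (h : ∀ i, 0 ≤ hoopHeight d (φ i)) : d = 0 := by
  have hsub : convexHull ℝ (Set.range fun i => circlePoint (φ i)) ⊆
      {p : ℝ × ℝ | 0 ≤ d 0 + (d 1 * p.1 + d 2 * p.2)} := by
    refine convexHull_min ?_ ?_
    · rintro _ ⟨i, rfl⟩
      have := h i
      simp only [hoopHeight] at this
      simpa [add_assoc] using this
    · intro p hp q hq a b ha hb hab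
      simp only [Set.mem_ofPred_eq, Prod.fst_add, Prod.snd_add, Prod.smul_fst, Prod.smul_snd,
        smul_eq_mul] at *
      have : d 0 + (d 1 * (a * p.1 + b * q.1) + d 2 * (a * p.2 + b * q.2)) =
          a * (d 0 + (d 1 * p.1 + d 2 * p.2)) + b * (d 0 + (d 1 * q.1 + d 2 * q.2)) := by
        have : d 0 = (a + b) * d 0 := by rw [hab, one_mul]
        nth_rewrite 1 [this]; ring
      rw [this]; positivity
  have hnhds : ∀ᶠ p in 𝓝 (0 : ℝ × ℝ), 0 ≤ d 0 + (d 1 * p.1 + d 2 * p.2) :=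
    Filter.mem_of_superset (mem_interior_iff_mem_nhds.1 hφ) hsub
  -- the plane is nonnegative at a small multiple of minus its gradient
  have hlim : Tendsto (fun t : ℝ => (t * (-d 1), t * (-d 2))) (𝓝[>] 0) (𝓝 (0 : ℝ × ℝ)) := by
    have : Continuous (fun t : ℝ => (t * (-d 1), t * (-d 2))) := by fun_prop
    refine (this.tendsto' 0 0 ?_).mono_left nhdsWithin_le_nhds
    simp
  obtain ⟨t, ht, ht0⟩ := ((hlim.eventually hnhds).and self_mem_nhdsWithin).exists
  have ht0 : 0 < t := ht0
  have h0 : d 0 = 0 := by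
    refine le_antisymm hd ?_
    simpa using hnhds.self_of_nhds
  have hs : d 1 ^ 2 + d 2 ^ 2 ≤ 0 := by
    by_contra! hc
    have := mul_pos ht0 hc
    simp only at ht
    nlinarith
  have h1 : d 1 = 0 := by nlinarith [sq_nonneg (d 1), sq_nonneg (d 2)]
  have h2 : d 2 = 0 := by nlinarith [sq_nonneg (d 1), sq_nonneg (d 2)]
  ext i
  fin_cases i <;> simp [h0, h1, h2]

theorem det_evalMatrix_ne_zero {φ : Fin 3 → Real.Angle}
    (hφ : (0 : ℝ × ℝ) ∈ interior (convexHull ℝ (Set.range fun i => circlePoint (φ i)))) :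
    (evalMatrix φ).det ≠ 0 := by
  intro h0
  obtain ⟨v, hv, hv0⟩ := Matrix.exists_mulVec_eq_zero_iff.2 h0
  have hh : ∀ i, hoopHeight v (φ i) = 0 := fun i => by rw [← evalMatrix_mulVec, hv0]; rfl
  apply hv
  rcases le_total (v 0) 0 with h | h
  · exact eq_zero_of_hoopHeight_nonneg hφ h fun i => (hh i).ge
  · have := eq_zero_of_hoopHeight_nonneg hφ (d := (-1 : ℝ) • v) (by simpa using h) fun i => by
      rw [hoopHeight_smul, hh, mul_zero]
    simpa using this

theorem injective_of_mem_interior {N : ℕ} {n : Fin 3 → Fin N}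
    (hn : (0 : ℝ × ℝ) ∈ interior (convexHull ℝ (Set.range fun i =>
      circlePoint (toothAngle N (n i))))) : Function.Injective n := by
  intro i j hij
  by_contra hne
  refine det_evalMatrix_ne_zero hn (Matrix.det_zero_of_row_eq hne ?_)
  ext k
  simp [evalMatrix, hij]

/-- The hoop in the position given by a plane through the tops of three teeth is the only
candidate for a supported hoop. -/
theorem isSupportedBy_iff {N : ℕ} {ξ : Fin N → ℝ} {n : Fin 3 → Fin N} :
    IsSupportedBy ξ n ↔
      (0 : ℝ × ℝ) ∈ interior (convexHull ℝ (Set.range fun i => circlePoint (toothAngle N (n i)))) ∧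
      ∀ j, ξ j ≤ hoopHeight (planeThrough (fun i => toothAngle N (n i)) fun i => ξ (n i))
        (toothAngle N j) := by
  constructor
  · rintro ⟨⟨h, hle, heq⟩, hn⟩
    refine ⟨hn, ?_⟩
    rw [← eq_planeThrough (det_evalMatrix_ne_zero hn) heq]
    exact hle
  · rintro ⟨hn, hle⟩
    exact ⟨⟨_, hle, fun i => (hoopHeight_planeThrough (det_evalMatrix_ne_zero hn)
      (fun i => ξ (n i)) i).symm⟩, hn⟩

theorem continuous_hoopHeight_planeThrough (φ : Fin 3 → Real.Angle) (α : Real.Angle) :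
    Continuous fun y => hoopHeight (planeThrough φ y) α := by
  simp only [hoopHeight_eq, planeThrough]
  fun_prop

theorem measurableSet_isSupportedBy {N : ℕ} (n : Fin 3 → Fin N) :
    MeasurableSet {ξ | IsSupportedBy ξ n} := by
  simp only [isSupportedBy_iff]
  by_cases hn : (0 : ℝ × ℝ) ∈
      interior (convexHull ℝ (Set.range fun i => circlePoint (toothAngle N (n i))))
  · simp only [hn, true_and, Set.ofPred_forall]
    refine MeasurableSet.iInter fun j => (isClosed_le (continuous_apply j) ?_).measurableSet
    exact (continuous_hoopHeight_planeThrough _ _).comp (by fun_prop)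
  · simp [hn]

/-! ### Triples of angles with given arcs -/

theorem HasArcs.sin_pos {φ : Fin 3 → Real.Angle} {ϑ : ArcTriple} (h : HasArcs φ ϑ) (i : Fin 3) :
    0 < (φ (i + 1) - φ i).sin := by
  rw [h i, Real.Angle.sin_coe]
  exact Real.sin_pos_of_pos_of_lt_pi (ϑ.2.1 _).1 (ϑ.2.1 _).2

theorem HasArcs.sub_eq {φ : Fin 3 → Real.Angle} {ϑ : ArcTriple} (h : HasArcs φ ϑ) :
    φ 2 - φ 1 = (ϑ.1 0 : ℝ) ∧ φ 0 - φ 2 = (ϑ.1 1 : ℝ) ∧ φ 1 - φ 0 = (ϑ.1 2 : ℝ) :=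
  ⟨h 1, h 2, h 0⟩

/-- Twice the area of the triangle inscribed in the unit circle. -/
theorem HasArcs.det_eq {φ : Fin 3 → Real.Angle} {ϑ : ArcTriple} (h : HasArcs φ ϑ) :
    (evalMatrix φ).det = 4 * ∏ i, Real.sin (ϑ.1 i / 2) := by
  obtain ⟨h0, h1, h2⟩ := h.sub_eq
  have hs : ϑ.1 2 = 2 * (Real.pi - (ϑ.1 0 / 2 + ϑ.1 1 / 2)) := by linarith [ϑ.2.2]
  rw [det_evalMatrix, h0, h1, h2, Fin.prod_univ_three]
  simp only [Real.Angle.sin_coe]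
  have e0 : ϑ.1 0 = 2 * (ϑ.1 0 / 2) := by ring
  have e1 : ϑ.1 1 = 2 * (ϑ.1 1 / 2) := by ring
  rw [hs]
  nth_rewrite 1 [e0, e1]
  simp only [mul_div_cancel_left₀ _ (two_ne_zero' ℝ)]
  generalize ϑ.1 0 / 2 = a
  generalize ϑ.1 1 / 2 = b
  rw [Real.sin_two_mul, Real.sin_two_mul, Real.sin_two_mul, Real.sin_pi_sub, Real.cos_pi_sub,
    Real.sin_add, Real.cos_add]
  have ha := Real.sin_sq_add_cos_sq a
  have hb := Real.sin_sq_add_cos_sq b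
  generalize Real.sin a = s at *
  generalize Real.cos a = c at *
  generalize Real.sin b = t at *
  generalize Real.cos b = d at *
  have hc : c ^ 2 = 1 - s ^ 2 := by linarith
  have hd : d ^ 2 = 1 - t ^ 2 := by linarith
  ring_nf
  rw [hc, hd]
  ring

theorem prod_sin_pos (ϑ : ArcTriple) : 0 < ∏ i, Real.sin (ϑ.1 i / 2) :=
  Finset.prod_pos fun i _ => Real.sin_pos_of_pos_of_lt_pi (by linarith [(ϑ.2.1 i).1])
    (by linarith [(ϑ.2.1 i).2, Real.pi_pos])

theorem HasArcs.det_pos {φ : Fin 3 → Real.Angle} {ϑ : ArcTriple} (h : HasArcs φ ϑ) :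
    0 < (evalMatrix φ).det := by
  rw [h.det_eq]
  have := prod_sin_pos ϑ
  positivity

/-- The centre is inside the triangle with vertices `φ i` if all the sines of the (oriented)
arcs are positive. -/
theorem mem_interior_of_sin_pos {φ : Fin 3 → Real.Angle} (h : ∀ i, 0 < (φ (i + 1) - φ i).sin) :
    (0 : ℝ × ℝ) ∈ interior (convexHull ℝ (Set.range fun i => circlePoint (φ i))) := by
  have h0 : 0 < (φ 2 - φ 1).sin := h 1
  have h1 : 0 < (φ 0 - φ 2).sin := h 2
  have h2 : 0 < (φ 1 - φ 0).sin := h 0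
  have hD : 0 < (evalMatrix φ).det := by rw [det_evalMatrix]; positivity
  -- the barycentric coordinates of a point of the plane
  set w : ℝ × ℝ → Fin 3 → ℝ := fun p => Matrix.vecMul ![1, p.1, p.2] (evalMatrix φ)⁻¹ with hw
  have hwM : ∀ p, Matrix.vecMul (w p) (evalMatrix φ) = ![1, p.1, p.2] := fun p => by
    rw [hw, Matrix.vecMul_vecMul, Matrix.nonsing_inv_mul _ (Ne.isUnit hD.ne'), Matrix.vecMul_one]
  have hcont : ∀ i, Continuous fun p => w p i := by
    intro i
    simp only [hw, Matrix.vecMul, dotProduct, Fin.sum_univ_three, Matrix.cons_val]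
    fun_prop
  have hpos : ∀ i, 0 < w 0 i := by
    intro i
    have : w 0 i = planeThrough φ (Pi.single i 1) 0 := by
      simp [hw, planeThrough, Matrix.vecMul, dotProduct, Fin.sum_univ_three]
    rw [this, planeThrough_zero]
    refine div_pos ?_ hD
    fin_cases i <;> simpa
  rw [mem_interior]
  refine ⟨{p | ∀ i, 0 < w p i}, ?_, ?_, hpos⟩
  · intro p hp
    have hsum := congrFun (hwM p)
    have e0 := hsum 0
    have e1 := hsum 1
    have e2 := hsum 2
    simp only [evalMatrix, Matrix.vecMul, dotProduct, Fin.sum_univ_three, Matrix.of_apply,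
      Matrix.cons_val, mul_one] at e0 e1 e2
    have : p = ∑ i, w p i • circlePoint (φ i) := by
      ext
      · simp [Fin.sum_univ_three, circlePoint, e1]
      · simp [Fin.sum_univ_three, circlePoint, e2]
    rw [this]
    exact (convex_convexHull ℝ _).sum_mem (fun i _ => (hp i).le)
      (by rw [Fin.sum_univ_three]; exact e0)
      fun i _ => subset_convexHull ℝ _ ⟨i, rfl⟩
  · simp only [Set.ofPred_forall]
    exact isOpen_iInter_of_finite fun i => isOpen_lt continuous_const (hcont i)

/-! ### Uniqueness of the supporting triple -/

theorem combMeasure_eq (N : ℕ) : combMeasure N =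
    (volume : Measure (Fin N → ℝ)).restrict (Set.univ.pi fun _ => Set.Icc 0 1) := by
  rw [combMeasure, volume_pi, Measure.restrict_pi_pi]

instance (N : ℕ) : IsProbabilityMeasure (combMeasure N) := by
  have : IsProbabilityMeasure ((volume : Measure ℝ).restrict (Set.Icc 0 1)) :=
    ⟨by simp⟩
  unfold combMeasure
  infer_instance

theorem hoopHeight_eq_of_isSupportedBy {N : ℕ} {ξ : Fin N → ℝ} {n m : Fin 3 → Fin N}
    {g h : Fin 3 → ℝ} (hg : ∀ j, ξ j ≤ hoopHeight g (toothAngle N j))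
    (hgn : ∀ i, ξ (n i) = hoopHeight g (toothAngle N (n i)))
    (hn : (0 : ℝ × ℝ) ∈ interior (convexHull ℝ (Set.range fun i =>
      circlePoint (toothAngle N (n i)))))
    (hh : ∀ j, ξ j ≤ hoopHeight h (toothAngle N j))
    (hhm : ∀ i, ξ (m i) = hoopHeight h (toothAngle N (m i)))
    (hm : (0 : ℝ × ℝ) ∈ interior (convexHull ℝ (Set.range fun i =>
      circlePoint (toothAngle N (m i))))) : g = h := by
  -- the plane with the lower centre lies above the other one at three points around the centre
  rcases le_total (h 0) (g 0) with hle | hle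
  · have := eq_zero_of_hoopHeight_nonneg hn (d := h - g) (by simpa using hle) fun i => by
      rw [hoopHeight_sub, sub_nonneg, ← hgn]; exact hh _
    exact (sub_eq_zero.1 this).symm
  · have := eq_zero_of_hoopHeight_nonneg hm (d := g - h) (by simpa using hle) fun i => by
      rw [hoopHeight_sub, sub_nonneg, ← hhm]; exact hg _
    exact sub_eq_zero.1 this

/-- Four points on the cylinder over the unit circle are coplanar only if their heights satisfy
a linear relation. -/
theorem exists_linear_relation (α : Fin 4 → Real.Angle) :
    ∃ c : Fin 4 → ℝ, c ≠ 0 ∧ ∀ h : Fin 3 → ℝ, ∑ i, c i * hoopHeight h (α i) = 0 := by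
  obtain ⟨c, hc0, hc⟩ : ∃ c : Fin 4 → ℝ, c ≠ 0 ∧
      (Matrix.of fun i : Fin 4 => ![1, (α i).cos, (α i).sin]).vecMulLinear c = 0 := by
    have := LinearMap.ker_ne_bot_of_finrank_lt
      (f := (Matrix.of fun i : Fin 4 => ![1, (α i).cos, (α i).sin]).vecMulLinear) (by simp)
    obtain ⟨c, hc, h0⟩ := (Submodule.ne_bot_iff _).1 this
    exact ⟨c, h0, hc⟩
  refine ⟨c, hc0, fun h => ?_⟩
  have hc' := congrFun hc
  have e0 := hc' 0
  have e1 := hc' 1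
  have e2 := hc' 2
  simp only [Matrix.vecMulLinear_apply, Matrix.vecMul, dotProduct, Matrix.of_apply,
    Matrix.cons_val, mul_one, Pi.zero_apply] at e0 e1 e2
  calc ∑ i, c i * hoopHeight h (α i)
      = h 0 * ∑ i, c i + h 1 * ∑ i, c i * (α i).cos + h 2 * ∑ i, c i * (α i).sin := by
        simp only [Finset.mul_sum, ← Finset.sum_add_distrib, hoopHeight_eq]
        exact Finset.sum_congr rfl fun i _ => by ring
    _ = 0 := by rw [e0, e1, e2]; ring

theorem ae_not_coplanar (N : ℕ) {j : Fin 4 → Fin N} (hj : Function.Injective j) :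
    ∀ᵐ ξ ∂combMeasure N, ¬ ∃ h : Fin 3 → ℝ, ∀ i, ξ (j i) = hoopHeight h (toothAngle N (j i)) := by
  obtain ⟨c, hc0, hc⟩ := exists_linear_relation fun i => toothAngle N (j i)
  let ℓ : (Fin N → ℝ) →ₗ[ℝ] ℝ := ∑ i, c i • LinearMap.proj (j i)
  have hℓ : ∀ ξ, ℓ ξ = ∑ i, c i * ξ (j i) := fun ξ => by simp [ℓ]
  have hne : LinearMap.ker ℓ ≠ ⊤ := by
    intro htop
    obtain ⟨i, hi⟩ := Function.ne_iff.1 hc0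
    have h1 : ℓ (Pi.single (j i) 1) = 0 := by
      rw [← LinearMap.mem_ker, htop]; trivial
    rw [hℓ, Finset.sum_eq_single i] at h1
    · exact hi (by simpa using h1)
    · intro b _ hb
      rw [Pi.single_eq_of_ne (fun h => hb (hj h)), mul_zero]
    · simp
  have h0 := Measure.addHaar_submodule (volume : Measure (Fin N → ℝ)) _ hne
  rw [combMeasure_eq]
  refine ae_restrict_of_ae (measure_mono_null ?_ h0)
  intro ξ hξ
  obtain ⟨h, hh⟩ := not_not.1 hξ
  change ℓ ξ = 0
  rw [hℓ, ← hc h]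
  exact Finset.sum_congr rfl fun i _ => by rw [hh]

theorem ae_range_eq (N : ℕ) : ∀ᵐ ξ ∂combMeasure N, ∀ n m : Fin 3 → Fin N,
    IsSupportedBy ξ n → IsSupportedBy ξ m → Set.range n = Set.range m := by
  have key : ∀ᵐ ξ ∂combMeasure N, ∀ j : {j : Fin 4 → Fin N // Function.Injective j},
      ¬ ∃ h : Fin 3 → ℝ, ∀ i, ξ (j.1 i) = hoopHeight h (toothAngle N (j.1 i)) :=
    ae_all_iff.2 fun j => ae_not_coplanar N j.2
  filter_upwards [key] with ξ hξ n m hn hm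
  obtain ⟨⟨g, hg, hgn⟩, hn0⟩ := hn
  obtain ⟨⟨h, hh, hhm⟩, hm0⟩ := hm
  obtain rfl := hoopHeight_eq_of_isSupportedBy hg hgn hn0 hh hhm hm0
  have hni := injective_of_mem_interior hn0
  have hsub : ∀ i, m i ∈ Set.range n := by
    intro i
    by_contra hi
    refine hξ ⟨Fin.cons (m i) n, Fin.cons_injective_iff.2 ⟨hi, hni⟩⟩ ⟨g, fun k => ?_⟩
    refine Fin.cases ?_ (fun k => ?_) k
    · simpa using hhm i
    · simpa using hgn k
  have hmi := injective_of_mem_interior hm0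
  refine (Set.eq_of_subset_of_ncard_le (Set.range_subset_iff.2 hsub) ?_).symm
  rw [← Set.image_univ, ← Set.image_univ, Set.ncard_image_of_injective _ hni,
    Set.ncard_image_of_injective _ hmi]

/-! ### Existence of a supporting triple -/

theorem sum_cos_sin_toothAngle {N : ℕ} (hN : 2 ≤ N) :
    ∑ j, (toothAngle N j).cos = 0 ∧ ∑ j, (toothAngle N j).sin = 0 := by
  have hN0 : N ≠ 0 := by omega
  set ζ : ℂ := Complex.exp (2 * Real.pi * Complex.I / N) with hζ
  have hprim : IsPrimitiveRoot ζ N := Complex.isPrimitiveRoot_exp N hN0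
  have hsum : ∑ j : Fin N, ζ ^ ((j : ℕ) + 1) = 0 := by
    rw [Fin.sum_univ_eq_sum_range (fun j => ζ ^ (j + 1)) N]
    simp only [pow_succ, ← Finset.sum_mul, hprim.geom_sum_eq_zero (by omega), zero_mul]
  have hpow : ∀ j : Fin N, ζ ^ ((j : ℕ) + 1) =
      Complex.exp (((2 * Real.pi * ((j : ℝ) + 1) / (N : ℝ) : ℝ) : ℂ) * Complex.I) := by
    intro j
    rw [hζ, ← Complex.exp_nat_mul]
    congr 1
    push_cast
    ring
  constructor
  · have := congrArg Complex.re hsum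
    rw [Complex.re_sum] at this
    simp only [hpow, Complex.exp_ofReal_mul_I_re, Complex.zero_re] at this
    exact this
  · have := congrArg Complex.im hsum
    rw [Complex.im_sum] at this
    simp only [hpow, Complex.exp_ofReal_mul_I_im, Complex.zero_im] at this
    exact this

/-- The height of a hoop at the centre is its mean height over the teeth. -/
theorem sum_hoopHeight {N : ℕ} (hN : 2 ≤ N) (h : Fin 3 → ℝ) :
    ∑ j, hoopHeight h (toothAngle N j) = N * h 0 := by
  obtain ⟨hc, hs⟩ := sum_cos_sin_toothAngle hN
  simp only [hoopHeight_eq, Finset.sum_add_distrib, ← Finset.mul_sum, hc, hs]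
  simp

/-- Among the hoops above the comb there is one with the lowest centre. -/
theorem exists_lowest_hoop {N : ℕ} (hN : 3 ≤ N) (ξ : Fin N → ℝ) :
    ∃ h : Fin 3 → ℝ, (∀ j, ξ j ≤ hoopHeight h (toothAngle N j)) ∧
      ∀ g : Fin 3 → ℝ, (∀ j, ξ j ≤ hoopHeight g (toothAngle N j)) → h 0 ≤ g 0 := by
  obtain ⟨B, hB⟩ : ∃ B, ∀ j, |ξ j| ≤ B :=
    ⟨∑ j, |ξ j|, fun j => Finset.single_le_sum (f := fun j => |ξ j|)
      (fun i _ => abs_nonneg _) (Finset.mem_univ j)⟩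
  set S : Set (Fin 3 → ℝ) := {h | (∀ j, ξ j ≤ hoopHeight h (toothAngle N j)) ∧ h 0 ≤ B} with hS
  have hcl : IsClosed S := by
    simp only [hS, Set.ofPred_and, Set.ofPred_forall, hoopHeight_eq]
    refine (isClosed_iInter fun j => isClosed_le ?_ ?_).inter (isClosed_le ?_ ?_) <;> fun_prop
  set φ : Fin 3 → Real.Angle :=
    fun i => toothAngle N ⟨i, lt_of_lt_of_le i.2 hN⟩ with hφ
  have hdet : (evalMatrix φ).det ≠ 0 := by
    have hN' : (3 : ℝ) ≤ N := by exact_mod_cast hN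
    set t : ℝ := 2 * Real.pi / N with ht
    have e : ∀ i : Fin 3, φ i = ((((i : ℝ) + 1) * t : ℝ) : Real.Angle) := fun i => by
      simp only [hφ, toothAngle, ht]
      congr 1
      ring
    have ht0 : 0 < t := by positivity
    have htpi : t < Real.pi := by
      rw [ht, div_lt_iff₀ (by linarith)]
      nlinarith [Real.pi_pos]
    have hs := Real.sin_pos_of_pos_of_lt_pi ht0 htpi
    have hc : Real.cos t < 1 := by
      rw [← Real.cos_zero]
      exact Real.cos_lt_cos_of_nonneg_of_le_pi le_rfl htpi.le ht0
    rw [det_evalMatrix, e, e, e]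
    simp only [← Real.Angle.coe_sub, Real.Angle.sin_coe, Fin.val_zero, Fin.val_one, Fin.val_two]
    push_cast
    rw [show ((2 : ℝ) + 1) * t - (1 + 1) * t = t by ring,
      show ((0 : ℝ) + 1) * t - (2 + 1) * t = -(2 * t) by ring,
      show ((1 : ℝ) + 1) * t - (0 + 1) * t = t by ring, Real.sin_neg, Real.sin_two_mul]
    nlinarith
  -- since the mean height is bounded, so are the heights over all teeth
  have hbdd : S ⊆ planeThrough φ '' Metric.closedBall 0 (N * (2 * B) + B) := by
    intro h hh
    have hheight : ∀ j, |hoopHeight h (toothAngle N j)| ≤ N * (2 * B) + B := by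
      intro j
      have hlow : ∀ j, 0 ≤ hoopHeight h (toothAngle N j) + B := fun j => by
        have := hh.1 j
        have := neg_abs_le (ξ j)
        have := hB j
        linarith
      have hle := Finset.single_le_sum (f := fun j => hoopHeight h (toothAngle N j) + B)
        (fun i _ => hlow i) (Finset.mem_univ j)
      rw [Finset.sum_add_distrib, sum_hoopHeight (by omega)] at hle
      simp only [Finset.sum_const, Finset.card_univ, Fintype.card_fin, nsmul_eq_mul] at hle
      have hB0 : 0 ≤ B := (abs_nonneg _).trans (hB j)
      have : (N : ℝ) * h 0 ≤ N * B := by gcongr; exact hh.2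
      have hNB : 0 ≤ N * B := by positivity
      rw [abs_le]
      constructor
      · have := hlow j; linarith
      · linarith
    refine ⟨fun i => hoopHeight h (φ i), ?_, (eq_planeThrough hdet fun i => rfl).symm⟩
    rw [mem_closedBall_zero_iff, pi_norm_le_iff_of_nonneg
      ((abs_nonneg _).trans (hheight ⟨0, by omega⟩))]
    exact fun i => hheight _
  have hcomp : IsCompact S := by
    refine ((isCompact_closedBall _ _).image ?_).of_isClosed_subset hcl hbdd
    unfold planeThrough
    fun_prop
  have hne : (![B, 0, 0] : Fin 3 → ℝ) ∈ S :=
    ⟨fun j => by simpa [hoopHeight_eq] using (le_abs_self _).trans (hB j), by simp⟩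
  obtain ⟨h, hh, hmin⟩ := hcomp.exists_isMinOn ⟨_, hne⟩ (continuous_apply 0).continuousOn
  refine ⟨h, hh.1, fun g hg => ?_⟩
  rcases le_total (g 0) B with hgB | hgB
  · exact hmin ⟨hg, hgB⟩
  · exact hh.2.trans hgB

/-- The teeth that touch the lowest hoop surround the centre: otherwise the hoop could be tilted
and lowered. -/
theorem zero_mem_convexHull_contact {N : ℕ} {ξ : Fin N → ℝ} {h : Fin 3 → ℝ}
    (hh : ∀ j, ξ j ≤ hoopHeight h (toothAngle N j))
    (hmin : ∀ g : Fin 3 → ℝ, (∀ j, ξ j ≤ hoopHeight g (toothAngle N j)) → h 0 ≤ g 0) :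
    (0 : ℝ × ℝ) ∈ convexHull ℝ ((fun j => circlePoint (toothAngle N j)) ''
      {j | ξ j = hoopHeight h (toothAngle N j)}) := by
  by_contra h0
  obtain ⟨ℓ, u, hu, hℓ⟩ := geometric_hahn_banach_point_closed (convex_convexHull ℝ _)
    (((Set.toFinite _).image _).isClosed_convexHull (𝕜 := ℝ)) h0
  rw [map_zero] at hu
  set d : Fin 3 → ℝ := ![-u, ℓ (1, 0), ℓ (0, 1)] with hd
  have hdα : ∀ α, hoopHeight d α = ℓ (circlePoint α) - u := by
    intro α
    have : circlePoint α = α.cos • ((1 : ℝ), (0 : ℝ)) + α.sin • ((0 : ℝ), (1 : ℝ)) := by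
      simp [circlePoint]
    rw [this, map_add, map_smul, map_smul]
    simp [hoopHeight_eq, hd]
    ring
  have hev : ∀ᶠ ε : ℝ in 𝓝[>] 0, ∀ j, ξ j ≤ hoopHeight (h + ε • d) (toothAngle N j) := by
    rw [eventually_all]
    intro j
    simp only [hoopHeight_add, hoopHeight_smul]
    rcases (hh j).eq_or_lt with heq | hlt
    · filter_upwards [self_mem_nhdsWithin] with ε hε
      have := hℓ _ (subset_convexHull ℝ _ ⟨j, heq, rfl⟩)
      have hp : 0 ≤ ε * hoopHeight d (toothAngle N j) :=
        mul_nonneg (le_of_lt hε) (by rw [hdα]; linarith)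
      linarith
    · have : Tendsto (fun ε : ℝ => hoopHeight h (toothAngle N j) +
          ε * hoopHeight d (toothAngle N j)) (𝓝[>] 0) (𝓝 (hoopHeight h (toothAngle N j))) := by
        have hc : Continuous (fun ε : ℝ => hoopHeight h (toothAngle N j) +
          ε * hoopHeight d (toothAngle N j)) := by fun_prop
        exact (hc.tendsto' 0 _ (by simp)).mono_left nhdsWithin_le_nhds
      exact (this.eventually_const_lt hlt).mono fun _ h => h.le
  obtain ⟨ε, hε, hε0⟩ := (hev.and self_mem_nhdsWithin).exists
  have hle := hmin _ hε
  simp only [Pi.add_apply, Pi.smul_apply, hd, smul_eq_mul, Matrix.cons_val_zero] at hle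
  have hε0 : 0 < ε := hε0
  nlinarith

theorem toothAngle_ne_add_pi {N : ℕ} (hN : Odd N) (j k : Fin N) :
    toothAngle N j ≠ toothAngle N k + (Real.pi : ℝ) := by
  intro h
  have hN0 : (N : ℝ) ≠ 0 := by exact_mod_cast hN.pos.ne'
  rw [toothAngle, toothAngle, ← Real.Angle.coe_add, Real.Angle.angle_eq_iff_two_pi_dvd_sub] at h
  obtain ⟨m, hm⟩ := h
  have hπ := Real.pi_pos.ne'
  field_simp at hm
  have : (2 * ((j : ℤ) + 1) : ℤ) = 2 * ((k : ℤ) + 1) + N + 2 * N * m := by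
    have : (2 * ((j : ℝ) + 1) : ℝ) = 2 * ((k : ℝ) + 1) + N + 2 * N * m := by linarith
    exact_mod_cast this
  obtain ⟨r, hr⟩ := hN
  have hr' : (N : ℤ) = 2 * r + 1 := by exact_mod_cast hr
  have h2 : (N : ℤ) = 2 * ((j : ℤ) + 1 - (k + 1) - N * m) := by linarith
  omega

theorem circlePoint_norm (α : Real.Angle) :
    (circlePoint α).1 ^ 2 + (circlePoint α).2 ^ 2 = 1 := Real.Angle.cos_sq_add_sin_sq α

theorem angle_ext {α β : Real.Angle} (hc : α.cos = β.cos) (hs : α.sin = β.sin) : α = β := by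
  induction α using Real.Angle.induction_on
  induction β using Real.Angle.induction_on
  exact Real.Angle.cos_sin_inj hc hs

theorem exists_isSupportedBy {N : ℕ} (hN : 3 ≤ N) (hodd : Odd N) (ξ : Fin N → ℝ) :
    ∃ n, IsSupportedBy ξ n := by
  obtain ⟨h, hh, hmin⟩ := exists_lowest_hoop hN ξ
  have h0 := zero_mem_convexHull_contact hh hmin
  obtain ⟨ι, _, z, w, hz, hind, hw, hw1, hwz⟩ := eq_pos_convex_span_of_mem_convexHull h0
  choose n' hn' hzn' using fun i => hz ⟨i, rfl⟩
  have hcard : Fintype.card ι ≤ 3 := by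
    refine hind.card_le_finrank_succ.trans ?_
    have := Submodule.finrank_le (vectorSpan ℝ (Set.range z))
    simp only [Module.finrank_prod, Module.finrank_self] at this
    omega
  obtain ⟨e⟩ : Nonempty (ι ≃ Fin (Fintype.card ι)) := ⟨Fintype.equivFin ι⟩
  have hw1' : ∑ k, w (e.symm k) = 1 := by rw [← hw1]; exact Equiv.sum_comp e.symm w
  have hwz' : ∑ k, w (e.symm k) • z (e.symm k) = 0 := by
    rw [← hwz]; exact Equiv.sum_comp e.symm fun i => w i • z i
  have hnorm : ∀ i, (z i).1 ^ 2 + (z i).2 ^ 2 = 1 := fun i => by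
    rw [← hzn' i]; exact circlePoint_norm _
  generalize hc : Fintype.card ι = c at *
  interval_cases c
  · simp at hw1'
  · simp only [Fin.sum_univ_one] at hw1' hwz'
    rw [hw1', one_smul] at hwz'
    have := hnorm (e.symm 0)
    rw [hwz'] at this
    simp at this
  · simp only [Fin.sum_univ_two] at hw1' hwz'
    have hp0 := hw (e.symm 0)
    have hp1 := hw (e.symm 1)
    have hn0 := hnorm (e.symm 0)
    have hn1 := hnorm (e.symm 1)
    have e1 := congrArg Prod.fst hwz'
    have e2 := congrArg Prod.snd hwz'
    simp only [Prod.fst_add, Prod.snd_add, Prod.smul_fst, Prod.smul_snd, smul_eq_mul,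
      Prod.fst_zero, Prod.snd_zero] at e1 e2
    have hww : w (e.symm 0) = w (e.symm 1) := by
      have : w (e.symm 0) ^ 2 = w (e.symm 1) ^ 2 := by
        calc w (e.symm 0) ^ 2 = (w (e.symm 0) * (z (e.symm 0)).1) ^ 2 +
              (w (e.symm 0) * (z (e.symm 0)).2) ^ 2 := by rw [mul_pow, mul_pow, ← mul_add, hn0,
                mul_one]
          _ = (w (e.symm 1) * (z (e.symm 1)).1) ^ 2 +
              (w (e.symm 1) * (z (e.symm 1)).2) ^ 2 := by
                rw [eq_neg_of_add_eq_zero_left e1, eq_neg_of_add_eq_zero_left e2]; ring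
          _ = w (e.symm 1) ^ 2 := by rw [mul_pow, mul_pow, ← mul_add, hn1, mul_one]
      exact (pow_left_inj₀ hp0.le hp1.le two_ne_zero).1 this
    rw [hww, ← mul_add] at e1 e2
    have e1 := eq_neg_of_add_eq_zero_left ((mul_eq_zero.1 e1).resolve_left hp1.ne')
    have e2 := eq_neg_of_add_eq_zero_left ((mul_eq_zero.1 e2).resolve_left hp1.ne')
    rw [← hzn', ← hzn'] at e1 e2
    refine absurd (angle_ext ?_ ?_)
      (toothAngle_ne_add_pi hodd (n' (e.symm 0)) (n' (e.symm 1)))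
    · rw [Real.Angle.cos_add_pi]; exact e1
    · rw [Real.Angle.sin_add_pi]; exact e2
  · have hspan : affineSpan ℝ (Set.range z) = ⊤ := by
      rw [hind.affineSpan_eq_top_iff_card_eq_finrank_add_one, hc]
      simp [Module.finrank_prod]
    let b : AffineBasis ι ℝ (ℝ × ℝ) := ⟨z, hind, hspan⟩
    refine ⟨fun i => n' (e.symm i), ⟨h, hh, fun i => hn' _⟩, ?_⟩
    have hr : Set.range (fun i => circlePoint (toothAngle N (n' (e.symm i)))) = Set.range b := by
      rw [← EquivLike.range_comp b e.symm]
      congr 1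
      ext1 i
      exact hzn' _
    rw [hr, b.interior_convexHull]
    intro i
    have hcomb : (0 : ℝ × ℝ) = Finset.univ.affineCombination ℝ b w := by
      rw [Finset.affineCombination_eq_linear_combination _ _ _ hw1]
      exact hwz.symm
    rw [hcomb, b.coord_apply_combination_of_mem (Finset.mem_univ i) hw1]
    exact hw i

/-! ### The probability of support as an integral over three heights -/

/-- Fubini's theorem for independent coordinates: condition on the coordinates `n k`, and bound
each of the others by a function of these. -/
theorem pi_setOf_forall_le {ι κ : Type*} [Fintype ι] [DecidableEq ι] [Fintype κ] (μ : Measure ℝ)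
    [SigmaFinite μ] {n : κ → ι} (hn : Function.Injective n) {F : (κ → ℝ) → ι → ℝ}
    (hF : ∀ j, Measurable fun y => F y j) :
    Measure.pi (fun _ : ι => μ) {ξ | ∀ j ∉ Finset.univ.image n, ξ j ≤ F (fun k => ξ (n k)) j} =
      ∫⁻ y, ∏ j ∈ (Finset.univ.image n)ᶜ, μ (Set.Iic (F y j)) ∂Measure.pi fun _ : κ => μ := by
  obtain ⟨p, hp⟩ : ∃ p : ι → Prop, ∀ j, j ∈ Finset.univ.image n ↔ p j := ⟨_, fun _ => Iff.rfl⟩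
  have : DecidablePred p := fun j => decidable_of_iff _ (hp j)
  let e : κ ≃ {j // p j} := Equiv.ofBijective (fun k => ⟨n k, (hp _).1 (by simp)⟩) <| by
    refine ⟨fun k l hkl => hn (congrArg Subtype.val hkl), fun ⟨j, hj⟩ => ?_⟩
    obtain ⟨k, -, hk⟩ := Finset.mem_image.1 ((hp j).2 hj)
    exact ⟨k, Subtype.ext hk⟩
  have h1 := measurePreserving_piEquivPiSubtypeProd (fun _ : ι => μ) p
  have h2 := (measurePreserving_piCongrLeft (fun _ : {j // p j} => μ) e).symm
  have he : ∀ (a : {j // p j} → ℝ),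
      (MeasurableEquiv.piCongrLeft (fun _ : {j // p j} => ℝ) e).symm a =
        fun k => a (e k) := fun a => rfl
  let A : Set (({j // p j} → ℝ) × ({j // ¬ p j} → ℝ)) :=
    {q | ∀ j, q.2 j ≤ F (fun k => q.1 (e k)) j}
  have hA : MeasurableSet A := by
    simp only [A, Set.ofPred_forall]
    refine MeasurableSet.iInter fun j => measurableSet_le (by fun_prop) ?_
    exact (hF j).comp (by fun_prop)
  have hset : {ξ : ι → ℝ | ∀ j ∉ Finset.univ.image n, ξ j ≤ F (fun k => ξ (n k)) j} =
      MeasurableEquiv.piEquivPiSubtypeProd (fun _ => ℝ) p ⁻¹' A := by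
    ext ξ
    exact ⟨fun h j => h j.1 (mt (hp _).1 j.2), fun h j hj => h ⟨j, mt (hp _).2 hj⟩⟩
  rw [hset, h1.measure_preimage hA.nullMeasurableSet, Measure.prod_apply hA,
    ← h2.lintegral_comp_emb (MeasurableEquiv.measurableEmbedding _)]
  refine lintegral_congr fun a => ?_
  rw [he, Finset.prod_subtype _ (p := fun j => ¬ p j)
    (fun j => by rw [Finset.mem_compl, hp]), ← Measure.pi_pi]
  congr 1
  ext b
  simp only [A, Set.mem_preimage, Set.mem_ofPred_eq, Set.mem_pi, Set.mem_univ, true_imp_iff,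
    Set.mem_Iic]

theorem restrict_Icc_Iic (t : ℝ) :
    ((volume : Measure ℝ).restrict (Set.Icc 0 1)) (Set.Iic t) = ENNReal.ofReal (min t 1) := by
  rw [Measure.restrict_apply measurableSet_Iic]
  have : Set.Iic t ∩ Set.Icc 0 1 = Set.Icc 0 (min t 1) := by
    ext x; simp only [Set.mem_inter_iff, Set.mem_Iic, Set.mem_Icc, le_min_iff]; tauto
  rw [this, Real.volume_Icc, sub_zero]

theorem combMeasure_isSupportedBy {N : ℕ} {n : Fin 3 → Fin N}
    (hn : (0 : ℝ × ℝ) ∈ interior (convexHull ℝ (Set.range fun i =>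
      circlePoint (toothAngle N (n i))))) :
    combMeasure N {ξ | IsSupportedBy ξ n} =
      ∫⁻ y in Set.univ.pi fun _ : Fin 3 => Set.Icc (0 : ℝ) 1,
        ∏ j ∈ (Finset.univ.image n)ᶜ, ENNReal.ofReal (min
          (hoopHeight (planeThrough (fun i => toothAngle N (n i)) y) (toothAngle N j)) 1) := by
  have hset : {ξ | IsSupportedBy ξ n} = {ξ : Fin N → ℝ | ∀ j ∉ Finset.univ.image n,
      ξ j ≤ hoopHeight (planeThrough (fun i => toothAngle N (n i)) fun i => ξ (n i))
        (toothAngle N j)} := by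
    ext ξ
    simp only [Set.mem_ofPred_eq, isSupportedBy_iff, hn, true_and]
    refine ⟨fun h j _ => h j, fun h j => ?_⟩
    by_cases hj : j ∈ Finset.univ.image n
    · obtain ⟨i, -, rfl⟩ := Finset.mem_image.1 hj
      exact (hoopHeight_planeThrough (det_evalMatrix_ne_zero hn) (fun i => ξ (n i)) i).ge
    · exact h j hj
  rw [hset, combMeasure, pi_setOf_forall_le _ (injective_of_mem_interior hn)
    (F := fun y j => hoopHeight (planeThrough (fun i => toothAngle N (n i)) y) (toothAngle N j))
    fun j => (continuous_hoopHeight_planeThrough _ _).measurable, ← Measure.restrict_pi_pi,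
    ← volume_pi]
  simp only [restrict_Icc_Iic]

theorem planeThrough_one {φ : Fin 3 → Real.Angle} (hφ : (evalMatrix φ).det ≠ 0) :
    planeThrough φ 1 = ![1, 0, 0] :=
  (eq_planeThrough hφ fun i => by simp [hoopHeight_eq]).symm

/-- Rescaling an integral over the gaps between the unit height and the heights `y`. -/
theorem lintegral_comp_one_sub_smul (H : (Fin 3 → ℝ) → ENNReal) {r : ℝ} (hr : 0 < r) :
    ∫⁻ x, H (1 - r⁻¹ • x) = ENNReal.ofReal (r ^ 3) * ∫⁻ y, H y := by
  have h1 := Measure.map_addHaar_smul (volume : Measure (Fin 3 → ℝ)) (inv_ne_zero hr.ne')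
  have h2 : ∫⁻ x, H (1 - r⁻¹ • x) =
      ∫⁻ z, H (1 - z) ∂(Measure.map (r⁻¹ • ·) (volume : Measure (Fin 3 → ℝ))) :=
    ((Homeomorph.smulOfNeZero r⁻¹ (inv_ne_zero hr.ne')).measurableEmbedding.lintegral_map
      (fun z => H (1 - z))).symm
  rw [h2, h1, lintegral_smul_measure, lintegral_sub_left_eq_self H 1]
  simp only [Module.finrank_fintype_fun_eq_card, Fintype.card_fin, inv_pow, inv_inv, smul_eq_mul]
  rw [abs_of_pos (by positivity)]

theorem pow_mul_combMeasure_isSupportedBy {N : ℕ} (hN : 0 < N) {n : Fin 3 → Fin N}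
    (hn : (0 : ℝ × ℝ) ∈ interior (convexHull ℝ (Set.range fun i =>
      circlePoint (toothAngle N (n i))))) :
    ENNReal.ofReal ((N : ℝ) ^ 3) * combMeasure N {ξ | IsSupportedBy ξ n} =
      ∫⁻ x in Set.univ.pi fun _ : Fin 3 => Set.Icc (0 : ℝ) N,
        ∏ j ∈ (Finset.univ.image n)ᶜ, ENNReal.ofReal (1 -
          max (hoopHeight (planeThrough (fun i => toothAngle N (n i)) x) (toothAngle N j)) 0
            / N) := by
  have hN' : (0 : ℝ) < N := by exact_mod_cast hN
  have hm : ∀ a : ℝ, MeasurableSet (Set.univ.pi fun _ : Fin 3 => Set.Icc (0 : ℝ) a) :=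
    fun a => MeasurableSet.univ_pi fun _ => measurableSet_Icc
  rw [combMeasure_isSupportedBy hn, ← lintegral_indicator (hm _), ← lintegral_indicator (hm _),
    ← lintegral_comp_one_sub_smul _ hN']
  refine lintegral_congr fun x => ?_
  have hmem : (1 - (N : ℝ)⁻¹ • x) ∈ (Set.univ.pi fun _ : Fin 3 => Set.Icc (0 : ℝ) 1) ↔
      x ∈ (Set.univ.pi fun _ : Fin 3 => Set.Icc (0 : ℝ) N) := by
    simp only [Set.mem_pi, Set.mem_univ, true_imp_iff, Set.mem_Icc, Pi.sub_apply, Pi.one_apply,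
      Pi.smul_apply, smul_eq_mul]
    refine forall_congr' fun i => ?_
    rw [sub_nonneg, sub_le_self_iff, inv_mul_le_one₀ hN', and_comm]
    simp [hN]
  classical
  simp only [Set.indicator_apply, hmem]
  split_ifs
  · refine Finset.prod_congr rfl fun j _ => ?_
    have : planeThrough (fun i => toothAngle N (n i)) (1 - (N : ℝ)⁻¹ • x) =
        ![1, 0, 0] - (N : ℝ)⁻¹ • planeThrough (fun i => toothAngle N (n i)) x := by
      rw [← planeThrough_one (det_evalMatrix_ne_zero hn)]
      simp [planeThrough, Matrix.mulVec_sub, Matrix.mulVec_smul]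
    rw [this, hoopHeight_sub, hoopHeight_smul]
    congr 1
    generalize hoopHeight (planeThrough (fun i => toothAngle N (n i)) x) (toothAngle N j) = t
    have h1 : hoopHeight ![1, 0, 0] (toothAngle N j) = 1 := by simp [hoopHeight_eq]
    rw [h1]
    rcases le_total t 0 with ht | ht
    · rw [max_eq_right ht, min_eq_right]
      · simp
      · have : (N : ℝ)⁻¹ * t ≤ 0 := mul_nonpos_of_nonneg_of_nonpos (by positivity) ht
        linarith
    · rw [max_eq_left ht, min_eq_left]
      · ring
      · have : 0 ≤ (N : ℝ)⁻¹ * t := by positivity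
        linarith
  · rfl

/-! ### Riemann sums over the teeth -/

/-- The mean over the circle of the positive part of a plane. -/
noncomputable def meanPosPart (h : Fin 3 → ℝ) : ℝ :=
  (2 * Real.pi)⁻¹ * ∫ t in (0 : ℝ)..2 * Real.pi, max (hoopHeight h (t : Real.Angle)) 0

theorem abs_riemannSum_sub_integral_le {g : ℝ → ℝ} {K : NNReal} (hg : LipschitzWith K g) {N : ℕ}
    (hN : 0 < N) :
    |(N : ℝ)⁻¹ * ∑ j : Fin N, g (2 * Real.pi * ((j : ℝ) + 1) / N) -
      (2 * Real.pi)⁻¹ * ∫ t in (0 : ℝ)..2 * Real.pi, g t| ≤ K * (2 * Real.pi) / N := by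
  have hN' : (0 : ℝ) < N := by exact_mod_cast hN
  have hπ := Real.pi_pos
  set a : ℕ → ℝ := fun j => 2 * Real.pi * j / N with ha
  have hstep : ∀ j, a (j + 1) - a j = 2 * Real.pi / N := fun j => by
    simp only [ha]; push_cast; ring
  have hint : ∀ x y, IntervalIntegrable g volume x y :=
    fun x y => hg.continuous.intervalIntegrable x y
  have hsum : ∫ t in (0 : ℝ)..2 * Real.pi, g t =
      ∑ j ∈ Finset.range N, ∫ t in a j..a (j + 1), g t := by
    rw [intervalIntegral.sum_integral_adjacent_intervals fun j _ => hint _ _]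
    simp [ha, hN'.ne']
  have hterm : ∀ j, |2 * Real.pi / N * g (a (j + 1)) - ∫ t in a j..a (j + 1), g t| ≤
      K * (2 * Real.pi / N) * (2 * Real.pi / N) := by
    intro j
    have h1 : 2 * Real.pi / N * g (a (j + 1)) = ∫ _ in a j..a (j + 1), g (a (j + 1)) := by
      rw [intervalIntegral.integral_const, hstep, smul_eq_mul]
    rw [h1, ← intervalIntegral.integral_sub (by simp) (hint _ _)]
    have hle : a j ≤ a (j + 1) := by
      have := hstep j
      have : 0 < 2 * Real.pi / N := by positivity
      linarith
    have := intervalIntegral.norm_integral_le_of_norm_le_const (a := a j) (b := a (j + 1))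
      (f := fun t => g (a (j + 1)) - g t) (C := K * (2 * Real.pi / N)) fun t ht => by
        rw [Set.uIoc_of_le hle] at ht
        rw [← dist_eq_norm]
        refine (hg.dist_le_mul _ _).trans ?_
        gcongr
        rw [Real.dist_eq, abs_of_nonneg (by linarith [ht.2]), ← hstep j]
        linarith [ht.1]
    rwa [hstep, Real.norm_eq_abs, abs_of_pos (show 0 < 2 * Real.pi / N by positivity)] at this
  have heq : (N : ℝ)⁻¹ * ∑ j : Fin N, g (2 * Real.pi * ((j : ℝ) + 1) / N) -
      (2 * Real.pi)⁻¹ * ∫ t in (0 : ℝ)..2 * Real.pi, g t = (2 * Real.pi)⁻¹ *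
      ∑ j ∈ Finset.range N, (2 * Real.pi / N * g (a (j + 1)) - ∫ t in a j..a (j + 1), g t) := by
    rw [Finset.sum_sub_distrib, hsum, Fin.sum_univ_eq_sum_range
      (fun j => g (2 * Real.pi * ((j : ℝ) + 1) / N)) N, mul_sub, ← Finset.mul_sum]
    congr 1
    rw [← mul_assoc]
    congr 1
    · field_simp
    · refine Finset.sum_congr rfl fun j _ => ?_
      simp [ha]
  rw [heq, abs_mul, abs_of_pos (by positivity : 0 < (2 * Real.pi)⁻¹)]
  calc (2 * Real.pi)⁻¹ * |∑ j ∈ Finset.range N,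
        (2 * Real.pi / N * g (a (j + 1)) - ∫ t in a j..a (j + 1), g t)|
      ≤ (2 * Real.pi)⁻¹ * ∑ j ∈ Finset.range N, K * (2 * Real.pi / N) * (2 * Real.pi / N) := by
        gcongr
        exact (Finset.abs_sum_le_sum_abs _ _).trans (Finset.sum_le_sum fun j _ => hterm j)
    _ = K * (2 * Real.pi) / N := by
        rw [Finset.sum_const, Finset.card_range, nsmul_eq_mul]
        field_simp

theorem abs_hoopHeight_le (h : Fin 3 → ℝ) (α : Real.Angle) :
    |hoopHeight h α| ≤ |h 0| + |h 1| + |h 2| := by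
  have hc : |α.cos| ≤ 1 := by
    induction α using Real.Angle.induction_on; exact Real.abs_cos_le_one _
  have hs : |α.sin| ≤ 1 := by
    induction α using Real.Angle.induction_on; exact Real.abs_sin_le_one _
  rw [hoopHeight_eq]
  refine (abs_add_three _ _ _).trans ?_
  rw [abs_mul, abs_mul]
  gcongr
  · exact mul_le_of_le_one_right (abs_nonneg _) hc
  · exact mul_le_of_le_one_right (abs_nonneg _) hs

theorem lipschitzWith_posPart_hoopHeight (h : Fin 3 → ℝ) :
    LipschitzWith (‖h 1‖₊ + ‖h 2‖₊) fun t : ℝ => max (hoopHeight h (t : Real.Angle)) 0 := by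
  refine LipschitzWith.of_dist_le_mul fun x y => ?_
  simp only [Real.dist_eq, hoopHeight_eq, Real.Angle.cos_coe, Real.Angle.sin_coe]
  refine (abs_max_sub_max_le_abs _ _ _).trans ?_
  have hc := Real.abs_cos_sub_cos_le x y
  have hs := Real.abs_sin_sub_sin_le x y
  have : h 0 + h 1 * Real.cos x + h 2 * Real.sin x - (h 0 + h 1 * Real.cos y + h 2 * Real.sin y) =
      h 1 * (Real.cos x - Real.cos y) + h 2 * (Real.sin x - Real.sin y) := by ring
  rw [this]
  refine (abs_add_le _ _).trans ?_
  rw [abs_mul, abs_mul]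
  push_cast
  rw [add_mul]
  simp only [Real.norm_eq_abs]
  gcongr

theorem tendsto_riemannSum {N : ℕ → ℕ} (hN : Tendsto N atTop atTop) {h : ℕ → Fin 3 → ℝ}
    {h' : Fin 3 → ℝ} (hh : Tendsto h atTop (𝓝 h')) :
    Tendsto (fun k => ∑ j, max (hoopHeight (h k) (toothAngle (N k) j)) 0 / N k) atTop
      (𝓝 (meanPosPart h')) := by
  have hNr : Tendsto (fun k => (N k : ℝ)) atTop atTop := tendsto_natCast_atTop_atTop.comp hN
  have hcoord := tendsto_pi_nhds.1 hh
  have hdiff : Tendsto (fun k => |(h k - h') 0| + |(h k - h') 1| + |(h k - h') 2|) atTop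
      (𝓝 0) := by
    have : ∀ i, Tendsto (fun k => |(h k - h') i|) atTop (𝓝 0) := fun i => by
      simpa using ((hcoord i).sub_const (h' i)).abs
    simpa using ((this 0).add (this 1)).add (this 2)
  have hK : Tendsto (fun k => ((‖h' 1‖₊ + ‖h' 2‖₊ : NNReal) : ℝ) * (2 * Real.pi) / N k) atTop
      (𝓝 0) := tendsto_const_nhds.div_atTop hNr
  rw [tendsto_iff_dist_tendsto_zero]
  refine squeeze_zero' (Eventually.of_forall fun _ => dist_nonneg) ?_
    (by simpa using hdiff.add hK)
  filter_upwards [hN.eventually_gt_atTop 0] with k hk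
  have hk' : (0 : ℝ) < N k := by exact_mod_cast hk
  refine (dist_triangle _ (∑ j, max (hoopHeight h' (toothAngle (N k) j)) 0 / N k) _).trans
    (add_le_add ?_ ?_)
  · rw [Real.dist_eq, ← Finset.sum_sub_distrib]
    refine (Finset.abs_sum_le_sum_abs _ _).trans ?_
    calc ∑ j, |max (hoopHeight (h k) (toothAngle (N k) j)) 0 / N k -
          max (hoopHeight h' (toothAngle (N k) j)) 0 / N k|
        ≤ ∑ _j : Fin (N k), (|(h k - h') 0| + |(h k - h') 1| + |(h k - h') 2|) / N k := by
          refine Finset.sum_le_sum fun j _ => ?_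
          rw [← sub_div, abs_div, abs_of_pos hk']
          gcongr
          refine (abs_max_sub_max_le_abs _ _ _).trans ?_
          rw [← hoopHeight_sub]
          exact abs_hoopHeight_le _ _
      _ = _ := by
          rw [Finset.sum_const, Finset.card_univ, Fintype.card_fin, nsmul_eq_mul]
          field_simp
          rfl
  · have := abs_riemannSum_sub_integral_le (lipschitzWith_posPart_hoopHeight h') hk
    rw [Real.dist_eq, ← Finset.sum_div, div_eq_inv_mul]
    exact this

/-! ### The limit of the probability of support -/

theorem tendsto_prod_one_sub {N : ℕ → ℕ} (hN : Tendsto N atTop atTop) {s : ∀ k, Finset (Fin (N k))}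
    {c : ∀ k, Fin (N k) → ℝ} {C S : ℝ} (h0 : ∀ k j, 0 ≤ c k j)
    (hC : ∀ᶠ k in atTop, ∀ j, c k j ≤ C / N k)
    (hS : Tendsto (fun k => ∑ j ∈ s k, c k j) atTop (𝓝 S)) :
    Tendsto (fun k => ∏ j ∈ s k, (1 - c k j)) atTop (𝓝 (Real.exp (-S))) := by
  have hNr : Tendsto (fun k => (N k : ℝ)) atTop atTop := tendsto_natCast_atTop_atTop.comp hN
  have hCN : Tendsto (fun k => C / N k) atTop (𝓝 0) := tendsto_const_nhds.div_atTop hNr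
  have hlow : Tendsto (fun k => Real.exp (-((∑ j ∈ s k, c k j) / (1 - C / N k)))) atTop
      (𝓝 (Real.exp (-S))) := by
    have := (hS.div ((tendsto_const_nhds (x := (1 : ℝ))).sub hCN) (by norm_num)).neg
    simp only [sub_zero, div_one] at this
    exact (Real.continuous_exp.tendsto _).comp this
  have hup : Tendsto (fun k => Real.exp (-(∑ j ∈ s k, c k j))) atTop (𝓝 (Real.exp (-S))) :=
    (Real.continuous_exp.tendsto _).comp hS.neg
  refine tendsto_of_tendsto_of_tendsto_of_le_of_le' hlow hup ?_ ?_
  · filter_upwards [hC, hCN.eventually_lt_const one_pos] with k hk hk1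
    rw [Finset.sum_div, ← Finset.sum_neg_distrib, Real.exp_sum]
    refine Finset.prod_le_prod (fun _ _ => (Real.exp_pos _).le) fun j _ => ?_
    have hj : 0 < 1 - c k j := by linarith [hk j]
    -- `1 / (1 - c) = 1 + c / (1 - c) ≤ exp (c / (1 - c))`
    have h1 : c k j / (1 - c k j) ≤ c k j / (1 - C / N k) :=
      div_le_div_of_nonneg_left (h0 k j) (by linarith) (by linarith [hk j])
    have h2 := Real.add_one_le_exp (c k j / (1 - c k j))
    have h3 : c k j / (1 - c k j) + 1 = (1 - c k j)⁻¹ := by field_simp; ring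
    calc Real.exp (-(c k j / (1 - C / N k))) ≤ Real.exp (-(c k j / (1 - c k j))) := by
          gcongr
      _ = (Real.exp (c k j / (1 - c k j)))⁻¹ := Real.exp_neg _
      _ ≤ ((1 - c k j)⁻¹)⁻¹ := by
          gcongr
          rw [← h3]; exact h2
      _ = 1 - c k j := inv_inv _
  · filter_upwards [hC, hCN.eventually_lt_const one_pos] with k hk hk1
    rw [← Finset.sum_neg_distrib, Real.exp_sum]
    refine Finset.prod_le_prod (fun j _ => by linarith [hk j]) fun j _ => ?_
    linarith [Real.add_one_le_exp (-c k j)]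

theorem continuous_evalMatrix : Continuous evalMatrix := by
  refine continuous_matrix fun i j => ?_
  have hc : Continuous fun φ : Fin 3 → Real.Angle => (φ i).cos :=
    Real.Angle.continuous_cos.comp (continuous_apply i)
  have hs : Continuous fun φ : Fin 3 → Real.Angle => (φ i).sin :=
    Real.Angle.continuous_sin.comp (continuous_apply i)
  fin_cases j
  · exact continuous_const
  · exact hc
  · exact hs

theorem tendsto_planeThrough {φ : ℕ → Fin 3 → Real.Angle} {φ' : Fin 3 → Real.Angle}
    (hφ : Tendsto φ atTop (𝓝 φ')) (hdet : (evalMatrix φ').det ≠ 0) (x : Fin 3 → ℝ) :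
    Tendsto (fun k => planeThrough (φ k) x) atTop (𝓝 (planeThrough φ' x)) := by
  have hM : Tendsto (fun k => evalMatrix (φ k)) atTop (𝓝 (evalMatrix φ')) :=
    (continuous_evalMatrix.tendsto _).comp hφ
  have hd : Tendsto (fun k => (evalMatrix (φ k)).det) atTop (𝓝 (evalMatrix φ').det) :=
    ((continuous_id.matrix_det).tendsto _).comp hM
  have ha : Tendsto (fun k => (evalMatrix (φ k)).adjugate) atTop (𝓝 (evalMatrix φ').adjugate) :=
    ((continuous_id.matrix_adjugate).tendsto _).comp hM
  have hinv : Tendsto (fun k => (evalMatrix (φ k))⁻¹) atTop (𝓝 (evalMatrix φ')⁻¹) := by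
    simp only [Matrix.inv_def, Ring.inverse_eq_inv']
    exact (hd.inv₀ hdet).smul ha
  have hc : Continuous fun M : Matrix (Fin 3) (Fin 3) ℝ => M.mulVec x := by fun_prop
  exact (hc.tendsto _).comp hinv

theorem lintegral_exp_neg_sum_lt_top {c : Fin 3 → ℝ} (hc : ∀ i, 0 < c i) (C : ℝ) :
    ∫⁻ x in Set.univ.pi fun _ : Fin 3 => Set.Ici (0 : ℝ),
      ENNReal.ofReal (Real.exp (C - ∑ i, c i * x i)) < ⊤ := by
  have h1 : ∀ i, Integrable (fun t : ℝ => Real.exp (-c i * t))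
      (volume.restrict (Set.Ici (0 : ℝ))) := fun i =>
    (integrableOn_Ici_iff_integrableOn_Ioi).2 (exp_neg_integrableOn_Ioi 0 (hc i))
  have h2 := (Integrable.fintype_prod h1).const_mul (Real.exp C)
  rw [← Measure.restrict_pi_pi, ← volume_pi] at h2
  refine lt_of_le_of_lt (lintegral_mono fun x => ?_) h2.lintegral_lt_top
  refine ENNReal.ofReal_le_ofReal (le_of_eq ?_)
  rw [← Real.exp_sum, ← Real.exp_add, sub_eq_add_neg, ← Finset.sum_neg_distrib]
  simp

/-- The factors of the supporting teeth that are missing in the product can be compensated for by a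
constant; by `sum_hoopHeight`, the rest decays exponentially in the height at the centre. -/
theorem prod_one_sub_le {N : ℕ} (hN : 2 ≤ N) {n : Fin 3 → Fin N}
    (hn : (evalMatrix fun i => toothAngle N (n i)).det ≠ 0) {x : Fin 3 → ℝ}
    (hx : ∀ i, x i ≤ N) :
    ∏ j ∈ (Finset.univ.image n)ᶜ, ENNReal.ofReal (1 -
          max (hoopHeight (planeThrough (fun i => toothAngle N (n i)) x) (toothAngle N j)) 0 / N) ≤
      ENNReal.ofReal (Real.exp (3 - planeThrough (fun i => toothAngle N (n i)) x 0)) := by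
  have hN' : (0 : ℝ) < N := by exact_mod_cast (by omega : 0 < N)
  set h := planeThrough (fun i => toothAngle N (n i)) x with hh
  set c : Fin N → ℝ := fun j => max (hoopHeight h (toothAngle N j)) 0 / N with hc
  have h1 : ∑ j ∈ Finset.univ.image n, c j ≤ 3 := by
    have : ∀ j ∈ Finset.univ.image n, c j ≤ 1 := by
      intro j hj
      obtain ⟨i, -, rfl⟩ := Finset.mem_image.1 hj
      simp only [hc, hh]
      rw [hoopHeight_planeThrough hn, div_le_one hN', max_le_iff]
      exact ⟨hx i, hN'.le⟩
    refine (Finset.sum_le_card_nsmul _ _ _ this).trans ?_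
    rw [nsmul_one]
    exact_mod_cast Finset.card_image_le.trans (by simp)
  have h2 : h 0 ≤ ∑ j, c j := by
    have : h 0 = ∑ j, hoopHeight h (toothAngle N j) / N := by
      rw [← Finset.sum_div, sum_hoopHeight hN, mul_div_cancel_left₀ _ hN'.ne']
    rw [this]
    refine Finset.sum_le_sum fun j _ => ?_
    simp only [hc]
    gcongr
    exact le_max_left _ _
  have h3 := Finset.sum_add_sum_compl (Finset.univ.image n) c
  calc ∏ j ∈ (Finset.univ.image n)ᶜ, ENNReal.ofReal (1 - c j)
      ≤ ∏ j ∈ (Finset.univ.image n)ᶜ, ENNReal.ofReal (Real.exp (-c j)) := by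
        refine Finset.prod_le_prod' fun j _ => ENNReal.ofReal_le_ofReal ?_
        linarith [Real.add_one_le_exp (-c j)]
    _ = ENNReal.ofReal (Real.exp (-∑ j ∈ (Finset.univ.image n)ᶜ, c j)) := by
        rw [← ENNReal.ofReal_prod_of_nonneg fun _ _ => (Real.exp_pos _).le, ← Real.exp_sum,
          Finset.sum_neg_distrib]
    _ ≤ _ := by
        gcongr
        linarith

theorem tendsto_prod_teeth {φ : Fin 3 → Real.Angle} (hφ : (evalMatrix φ).det ≠ 0)
    {N : ℕ → ℕ} {n : ∀ k, Fin 3 → Fin (N k)} (hN : Tendsto N atTop atTop)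
    (hn : ∀ i, Tendsto (fun k => toothAngle (N k) (n k i)) atTop (𝓝 (φ i))) (x : Fin 3 → ℝ) :
    Tendsto (fun k => ∏ j ∈ (Finset.univ.image (n k))ᶜ, ENNReal.ofReal (1 -
        max (hoopHeight (planeThrough (fun i => toothAngle (N k) (n k i)) x)
          (toothAngle (N k) j)) 0 / N k)) atTop
      (𝓝 (ENNReal.ofReal (Real.exp (-meanPosPart (planeThrough φ x))))) := by
  have hNr : Tendsto (fun k => (N k : ℝ)) atTop atTop := tendsto_natCast_atTop_atTop.comp hN
  set h : ℕ → Fin 3 → ℝ := fun k => planeThrough (fun i => toothAngle (N k) (n k i)) x with hh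
  have hlim : Tendsto h atTop (𝓝 (planeThrough φ x)) :=
    tendsto_planeThrough (tendsto_pi_nhds.2 hn) hφ x
  set c : ∀ k, Fin (N k) → ℝ :=
    fun k j => max (hoopHeight (h k) (toothAngle (N k) j)) 0 / N k with hc
  have hc0 : ∀ k j, 0 ≤ c k j := fun k j => by simp only [hc]; positivity
  obtain ⟨C, hC0, hC⟩ : ∃ C : ℝ, 0 ≤ C ∧ ∀ᶠ k in atTop, ∀ j, c k j ≤ C / N k := by
    have hcoord := tendsto_pi_nhds.1 hlim
    have hs := ((hcoord 0).abs.add (hcoord 1).abs).add (hcoord 2).abs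
    refine ⟨|planeThrough φ x 0| + |planeThrough φ x 1| + |planeThrough φ x 2| + 1, by positivity,
      (hs.eventually_lt_const (lt_add_one _)).mono fun k hk j => ?_⟩
    simp only [hc]
    gcongr
    refine max_le ?_ (by positivity)
    exact (le_abs_self _).trans ((abs_hoopHeight_le _ _).trans hk.le)
  have himage : Tendsto (fun k => ∑ j ∈ Finset.univ.image (n k), c k j) atTop (𝓝 0) := by
    have hlim0 : Tendsto (fun k => 3 * (C / N k)) atTop (𝓝 0) := by
      simpa using (tendsto_const_nhds.div_atTop hNr : Tendsto (fun k => C / N k) _ _).const_mul 3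
    refine squeeze_zero' (Eventually.of_forall fun k => Finset.sum_nonneg fun j _ => hc0 k j)
      ?_ hlim0
    filter_upwards [hC] with k hk
    refine (Finset.sum_le_card_nsmul _ _ _ fun j _ => hk j).trans ?_
    rw [nsmul_eq_mul]
    gcongr
    exact_mod_cast Finset.card_image_le.trans (by simp)
  have hS : Tendsto (fun k => ∑ j ∈ (Finset.univ.image (n k))ᶜ, c k j) atTop
      (𝓝 (meanPosPart (planeThrough φ x))) := by
    have := (tendsto_riemannSum hN hlim).sub himage
    rw [sub_zero] at this
    refine this.congr fun k => ?_
    rw [sub_eq_iff_eq_add', Finset.sum_add_sum_compl]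
  refine ((ENNReal.continuous_ofReal.tendsto _).comp
    (tendsto_prod_one_sub hN hc0 hC hS)).congr' ?_
  have hCN : Tendsto (fun k => C / N k) atTop (𝓝 0) := tendsto_const_nhds.div_atTop hNr
  filter_upwards [hC, hCN.eventually_lt_const one_pos] with k hk hk1
  exact ENNReal.ofReal_prod_of_nonneg fun j _ => by linarith [hk j]

/-- The limit of the rescaled probability of support. The variables of the integral are
the rescaled gaps between the unit height and the heights of the three teeth. -/
theorem tendsto_pow_mul_combMeasure {φ : Fin 3 → Real.Angle} {ϑ : ArcTriple} (hφ : HasArcs φ ϑ)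
    {N : ℕ → ℕ} {n : ∀ k, Fin 3 → Fin (N k)} (hN : Tendsto N atTop atTop)
    (hn : ∀ i, Tendsto (fun k => toothAngle (N k) (n k i)) atTop (𝓝 (φ i))) :
    Tendsto (fun k => ENNReal.ofReal ((N k : ℝ) ^ 3) *
        combMeasure (N k) {ξ | IsSupportedBy ξ (n k)}) atTop
      (𝓝 (∫⁻ x in Set.univ.pi fun _ : Fin 3 => Set.Ici (0 : ℝ),
        ENNReal.ofReal (Real.exp (-meanPosPart (planeThrough φ x))))) := by
  have hdet : (evalMatrix φ).det ≠ 0 := hφ.det_pos.ne'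
  have hNr : Tendsto (fun k => (N k : ℝ)) atTop atTop := tendsto_natCast_atTop_atTop.comp hN
  have hsin : ∀ i j, Tendsto (fun k => (toothAngle (N k) (n k i) - toothAngle (N k) (n k j)).sin)
      atTop (𝓝 (φ i - φ j).sin) := fun i j =>
    (Real.Angle.continuous_sin.tendsto _).comp ((hn i).sub (hn j))
  have hpos : ∀ᶠ k in atTop, ∀ i : Fin 3,
      0 < (toothAngle (N k) (n k (i + 1)) - toothAngle (N k) (n k i)).sin :=
    eventually_all.2 fun i => (hsin _ _).eventually_const_lt (hφ.sin_pos i)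
  have hm : ∀ s : Set ℝ, MeasurableSet s → MeasurableSet (Set.univ.pi fun _ : Fin 3 => s) :=
    fun s hs => MeasurableSet.univ_pi fun _ => hs
  -- half of the barycentric coordinates of the centre
  set lam : Fin 3 → ℝ := fun i => planeThrough φ (Pi.single i 1) 0 with hlam
  have hlin : ∀ (φ : Fin 3 → Real.Angle) x,
      planeThrough φ x 0 = ∑ i, planeThrough φ (Pi.single i 1) 0 * x i := by
    intro φ x
    simp [planeThrough, Matrix.mulVec, dotProduct, Fin.sum_univ_three]
  have hlam0 : ∀ i, 0 < lam i := by
    intro i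
    simp only [hlam]
    rw [planeThrough_zero]
    refine div_pos ?_ hφ.det_pos
    have h0 : 0 < (φ 2 - φ 1).sin := hφ.sin_pos 1
    have h1 : 0 < (φ 0 - φ 2).sin := hφ.sin_pos 2
    have h2 : 0 < (φ 1 - φ 0).sin := hφ.sin_pos 0
    fin_cases i <;> simpa
  have hlamk : ∀ᶠ k in atTop, ∀ i, lam i / 2 ≤
      planeThrough (fun i => toothAngle (N k) (n k i)) (Pi.single i 1) 0 :=
    eventually_all.2 fun i => by
      have := tendsto_pi_nhds.1
        (tendsto_planeThrough (tendsto_pi_nhds.2 hn) hdet (Pi.single i 1)) 0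
      exact (this.eventually_const_lt (half_lt_self (hlam0 i))).mono fun _ h => h.le
  rw [← lintegral_indicator (hm _ measurableSet_Ici)]
  have hmain : Tendsto (fun k => ∫⁻ x, (Set.univ.pi fun _ : Fin 3 => Set.Icc (0 : ℝ) (N k)).indicator
      (fun x => ∏ j ∈ (Finset.univ.image (n k))ᶜ, ENNReal.ofReal (1 -
        max (hoopHeight (planeThrough (fun i => toothAngle (N k) (n k i)) x)
          (toothAngle (N k) j)) 0 / N k)) x) atTop
      (𝓝 (∫⁻ x, (Set.univ.pi fun _ : Fin 3 => Set.Ici (0 : ℝ)).indicator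
        (fun x => ENNReal.ofReal (Real.exp (-meanPosPart (planeThrough φ x)))) x)) := by
    refine tendsto_lintegral_filter_of_dominated_convergence
      ((Set.univ.pi fun _ : Fin 3 => Set.Ici (0 : ℝ)).indicator fun x =>
        ENNReal.ofReal (Real.exp (3 - ∑ i, lam i / 2 * x i))) ?_ ?_ ?_ ?_
    · refine Eventually.of_forall fun k => Measurable.indicator ?_ (hm _ measurableSet_Icc)
      refine Finset.measurable_prod _ fun j _ => ENNReal.measurable_ofReal.comp ?_
      refine Continuous.measurable ?_
      have := continuous_hoopHeight_planeThrough (fun i => toothAngle (N k) (n k i))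
        (toothAngle (N k) j)
      fun_prop
    · filter_upwards [hpos, hlamk, hN.eventually_ge_atTop 2] with k hk hkl hk2
      refine Eventually.of_forall fun x => ?_
      by_cases hx : x ∈ Set.univ.pi fun _ : Fin 3 => Set.Icc (0 : ℝ) (N k)
      · have hx' : x ∈ Set.univ.pi fun _ : Fin 3 => Set.Ici (0 : ℝ) :=
          fun i hi => (hx i hi).1
        rw [Set.indicator_of_mem hx, Set.indicator_of_mem hx']
        refine (prod_one_sub_le hk2 (det_evalMatrix_ne_zero (mem_interior_of_sin_pos hk))
          fun i => (hx i trivial).2).trans ?_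
        gcongr
        rw [hlin]
        refine Finset.sum_le_sum fun i _ => ?_
        have : 0 ≤ x i := (hx i trivial).1
        gcongr
        exact hkl i
      · rw [Set.indicator_of_notMem hx]
        exact zero_le
    · rw [lintegral_indicator (hm _ measurableSet_Ici)]
      exact (lintegral_exp_neg_sum_lt_top (fun i => half_pos (hlam0 i)) 3).ne
    · refine Eventually.of_forall fun x => ?_
      by_cases hx : x ∈ Set.univ.pi fun _ : Fin 3 => Set.Ici (0 : ℝ)
      · rw [Set.indicator_of_mem hx]
        refine (tendsto_prod_teeth hdet hN hn x).congr' ?_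
        have : ∀ᶠ k in atTop, ∀ i, x i ≤ N k :=
          eventually_all.2 fun i => hNr.eventually_ge_atTop _
        filter_upwards [this] with k hk
        rw [Set.indicator_of_mem]
        exact fun i hi => ⟨hx i hi, hk i⟩
      · rw [Set.indicator_of_notMem hx]
        refine tendsto_const_nhds.congr fun k => ?_
        rw [Set.indicator_of_notMem]
        exact fun h => hx fun i hi => (h i hi).1
  refine hmain.congr' ?_
  filter_upwards [hpos, hN.eventually_gt_atTop 0] with k hk hk0
  rw [lintegral_indicator (hm _ measurableSet_Icc),
    pow_mul_combMeasure_isSupportedBy hk0 (mem_interior_of_sin_pos hk)]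

/-! ### The integral over planes in cylindrical coordinates -/

theorem lintegral_eq_mul_lintegral_comp_mul (F : ℝ → ENNReal) {r : ℝ} (hr : 0 < r) :
    ∫⁻ a, F a = ENNReal.ofReal r * ∫⁻ t, F (r * t) := by
  have h := Real.smul_map_volume_mul_left hr.ne'
  nth_rewrite 1 [← h]
  rw [lintegral_smul_measure, abs_of_pos hr, smul_eq_mul]
  congr 1
  exact (Homeomorph.mulLeft₀ r hr.ne').measurableEmbedding.lintegral_map F

/-- The space of planes in the coordinates `r > 0`, `β`, `t`, where the plane is
`r (t + cos (α - β))` over the point of the circle at the angle `α`. -/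
theorem lintegral_planes {H : (Fin 3 → ℝ) → ENNReal} (hH : Measurable H) :
    ∫⁻ h, H h = ∫⁻ t : ℝ, ∫⁻ β in Set.Ioo (-Real.pi) Real.pi, ∫⁻ r in Set.Ioi (0 : ℝ),
      ENNReal.ofReal (r ^ 2) * H (r • ![t, Real.cos β, Real.sin β]) := by
  have hv : Measurable fun x : ℝ × ℝ × ℝ => (![x.1, x.2.1, x.2.2] : Fin 3 → ℝ) :=
    measurable_pi_iff.2 fun i => by fin_cases i <;> simp <;> fun_prop
  have e1 : ∫⁻ h, H h = ∫⁻ q : ℝ × ℝ × ℝ, H ![q.1, q.2.1, q.2.2] := by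
    have hp := (volume_preserving_piFinSuccAbove (fun _ : Fin 3 => ℝ) 0)
    have hq := (MeasurePreserving.id (volume : Measure ℝ)).prod (volume_preserving_finTwoArrow ℝ)
    have hpq := hq.comp hp
    have := hpq.lintegral_comp (f := fun q : ℝ × ℝ × ℝ => H ![q.1, q.2.1, q.2.2])
      (hH.comp (hv))
    refine Eq.trans ?_ this
    refine lintegral_congr fun h => congrArg H ?_
    ext i
    fin_cases i <;> rfl
  have hm : Measurable fun q : ℝ × ℝ × ℝ => H ![q.1, q.2.1, q.2.2] := hH.comp (hv)
  rw [e1, Measure.volume_eq_prod, lintegral_prod_symm _ hm.aemeasurable,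
    ← lintegral_comp_polarCoord_symm]
  have hmeas : Measurable fun z : (ℝ × ℝ) × ℝ => ENNReal.ofReal (z.1.1 ^ 2) *
      H (z.1.1 • ![z.2, Real.cos z.1.2, Real.sin z.1.2]) := by
    refine (by fun_prop : Measurable fun z : (ℝ × ℝ) × ℝ => ENNReal.ofReal (z.1.1 ^ 2)).mul
      (hH.comp ?_)
    refine measurable_pi_iff.2 fun i => ?_
    fin_cases i <;> simp <;> fun_prop
  have e2 : ∫⁻ p in polarCoord.target, ENNReal.ofReal p.1 •
        ∫⁻ a, H ![a, (polarCoord.symm p).1, (polarCoord.symm p).2] =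
      ∫⁻ p in polarCoord.target, ∫⁻ t : ℝ, ENNReal.ofReal (p.1 ^ 2) *
        H (p.1 • ![t, Real.cos p.2, Real.sin p.2]) := by
    refine setLIntegral_congr_fun polarCoord.open_target.measurableSet fun p hp => ?_
    have hp1 : 0 < p.1 := hp.1
    rw [lintegral_eq_mul_lintegral_comp_mul _ hp1, smul_eq_mul, ← mul_assoc,
      ← ENNReal.ofReal_mul hp1.le, ← lintegral_const_mul' _ _ ENNReal.ofReal_ne_top]
    refine lintegral_congr fun t => ?_
    rw [sq]
    congr 2
    ext i
    fin_cases i <;> simp [polarCoord]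
  rw [e2, lintegral_lintegral_swap hmeas.aemeasurable]
  refine lintegral_congr fun t => ?_
  have htar : polarCoord.target = Set.Ioi (0 : ℝ) ×ˢ Set.Ioo (-Real.pi) Real.pi := rfl
  rw [htar, Measure.volume_eq_prod, ← Measure.prod_restrict, lintegral_prod_symm]
  exact (hmeas.comp (measurable_id.prodMk measurable_const)).aemeasurable

theorem meanPosPart_smul {r : ℝ} (hr : 0 ≤ r) (h : Fin 3 → ℝ) :
    meanPosPart (r • h) = r * meanPosPart h := by
  have : ∀ t : ℝ, max (hoopHeight (r • h) (t : Real.Angle)) 0 =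
      r * max (hoopHeight h (t : Real.Angle)) 0 := fun t => by
    rw [hoopHeight_smul, mul_max_of_nonneg _ _ hr, mul_zero]
  simp only [meanPosPart, this, intervalIntegral.integral_const_mul]
  ring

theorem continuous_meanPosPart : Continuous meanPosPart := by
  refine continuous_const.mul
    (intervalIntegral.continuous_parametric_intervalIntegral_of_continuous' ?_ _ _)
  simp only [Function.uncurry_def, hoopHeight_eq, Real.Angle.cos_coe, Real.Angle.sin_coe]
  fun_prop

theorem meanPosPart_rotate (t β : ℝ) :
    meanPosPart ![t, Real.cos β, Real.sin β] = meanPosPart ![t, 1, 0] := by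
  have h1 : ∀ s : ℝ, max (hoopHeight ![t, Real.cos β, Real.sin β] (s : Real.Angle)) 0 =
      max (hoopHeight ![t, 1, 0] ((s - β : ℝ) : Real.Angle)) 0 := fun s => by
    simp [hoopHeight_eq, Real.cos_sub, -Real.Angle.coe_sub]
    ring_nf
  simp only [meanPosPart, h1]
  congr 1
  rw [intervalIntegral.integral_comp_sub_right
    (fun s : ℝ => max (hoopHeight ![t, 1, 0] (s : Real.Angle)) 0)]
  have hper : Function.Periodic (fun s : ℝ => max (hoopHeight ![t, 1, 0] (s : Real.Angle)) 0)
      (2 * Real.pi) := fun s => by simp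
  have := hper.intervalIntegral_add_eq (0 - β) 0
  rw [show 0 - β + 2 * Real.pi = 2 * Real.pi - β by ring, zero_add] at this
  exact this

theorem meanPosPart_of_one_le {t : ℝ} (ht : 1 ≤ t) : meanPosPart ![t, 1, 0] = t := by
  have h1 : ∀ s : ℝ, max (hoopHeight ![t, 1, 0] (s : Real.Angle)) 0 = t + Real.cos s := fun s => by
    simp only [hoopHeight_eq, Real.Angle.cos_coe, Matrix.cons_val]
    rw [max_eq_left] <;> linarith [Real.neg_one_le_cos s]
  simp only [meanPosPart, h1]
  rw [intervalIntegral.integral_add (by simp) (Real.continuous_cos.intervalIntegrable _ _)]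
  simp
  field_simp

theorem meanPosPart_cos {ψ : ℝ} (h0 : 0 ≤ ψ) (h1 : ψ ≤ Real.pi) :
    meanPosPart ![Real.cos ψ, 1, 0] =
      ((Real.pi - ψ) * Real.cos ψ + Real.sin ψ) / Real.pi := by
  have hh : ∀ s : ℝ, hoopHeight ![Real.cos ψ, 1, 0] (s : Real.Angle) =
      Real.cos ψ + Real.cos s := fun s => by simp [hoopHeight_eq]
  have hpsi : -Real.cos ψ = Real.cos (Real.pi - ψ) := (Real.cos_pi_sub ψ).symm
  -- the plane is positive over an arc of length `2 (π - ψ)`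
  have hpos1 : ∀ s ∈ Set.uIcc 0 (Real.pi - ψ),
      max (hoopHeight ![Real.cos ψ, 1, 0] (s : Real.Angle)) 0 = Real.cos ψ + Real.cos s := by
    intro s hs
    rw [Set.uIcc_of_le (by linarith)] at hs
    rw [hh, max_eq_left]
    have := Real.cos_le_cos_of_nonneg_of_le_pi hs.1 (by linarith) hs.2
    linarith
  have hneg : ∀ s ∈ Set.uIcc (Real.pi - ψ) (Real.pi + ψ),
      max (hoopHeight ![Real.cos ψ, 1, 0] (s : Real.Angle)) 0 = 0 := by
    intro s hs
    rw [Set.uIcc_of_le (by linarith)] at hs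
    rw [hh, max_eq_right]
    have : Real.cos ψ ≤ Real.cos |s - Real.pi| :=
      Real.cos_le_cos_of_nonneg_of_le_pi (abs_nonneg _) h1 (abs_le.2 ⟨by linarith [hs.1],
        by linarith [hs.2]⟩)
    rw [Real.cos_abs, Real.cos_sub_pi] at this
    linarith
  have hpos2 : ∀ s ∈ Set.uIcc (Real.pi + ψ) (2 * Real.pi),
      max (hoopHeight ![Real.cos ψ, 1, 0] (s : Real.Angle)) 0 = Real.cos ψ + Real.cos s := by
    intro s hs
    rw [Set.uIcc_of_le (by linarith)] at hs
    rw [hh, max_eq_left]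
    have := Real.cos_le_cos_of_nonneg_of_le_pi (x := 2 * Real.pi - s) (y := Real.pi - ψ)
      (by linarith [hs.2]) (by linarith) (by linarith [hs.1])
    rw [Real.cos_two_pi_sub] at this
    linarith
  have hint : ∀ a b, IntervalIntegrable
      (fun s : ℝ => max (hoopHeight ![Real.cos ψ, 1, 0] (s : Real.Angle)) 0) volume a b := by
    intro a b
    refine Continuous.intervalIntegrable ?_ _ _
    simp only [hh]
    fun_prop
  have hcos : ∀ a b, IntervalIntegrable Real.cos volume a b :=
    fun a b => Real.continuous_cos.intervalIntegrable _ _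
  rw [meanPosPart, ← intervalIntegral.integral_add_adjacent_intervals (hint 0 (Real.pi + ψ))
    (hint _ _), ← intervalIntegral.integral_add_adjacent_intervals (hint 0 (Real.pi - ψ))
    (hint _ _), intervalIntegral.integral_congr hpos1, intervalIntegral.integral_congr hneg,
    intervalIntegral.integral_congr hpos2,
    intervalIntegral.integral_add (by simp) (hcos _ _),
    intervalIntegral.integral_add (by simp) (hcos _ _)]
  simp only [intervalIntegral.integral_const, integral_cos, smul_eq_mul, Real.sin_pi_sub,
    Real.sin_zero, Real.sin_two_pi, add_comm Real.pi ψ, Real.sin_add_pi, mul_zero]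
  field_simp
  ring

theorem lintegral_sq_mul_exp {G : ℝ} (hG : 0 < G) :
    ∫⁻ r in Set.Ioi (0 : ℝ), ENNReal.ofReal (r ^ 2) * ENNReal.ofReal (Real.exp (-(r * G))) =
      ENNReal.ofReal (2 / G ^ 3) := by
  have h1 := Real.integral_rpow_mul_exp_neg_mul_Ioi (a := 3) (by norm_num) hG
  have h2 : Real.Gamma 3 = 2 := by
    rw [show (3 : ℝ) = ((2 : ℕ) : ℝ) + 1 by norm_num, Real.Gamma_nat_eq_factorial]; norm_num
  have h3 : ∫ r in Set.Ioi (0 : ℝ), r ^ 2 * Real.exp (-(r * G)) = 2 / G ^ 3 := by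
    rw [h2, show (3 : ℝ) - 1 = ((2 : ℕ) : ℝ) by norm_num,
      show (3 : ℝ) = ((3 : ℕ) : ℝ) by norm_num] at h1
    simp only [Real.rpow_natCast] at h1
    rw [div_pow, one_pow] at h1
    simp only [mul_comm _ G]
    rw [h1]
    ring
  have hpos : 0 < 2 / G ^ 3 := by positivity
  have hi : Integrable (fun r => r ^ 2 * Real.exp (-(r * G))) (volume.restrict (Set.Ioi 0)) := by
    by_contra hc
    rw [integral_undef hc] at h3
    exact hpos.ne h3
  rw [← h3, ofReal_integral_eq_lintegral_ofReal hi (Eventually.of_forall fun r => by positivity)]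
  refine lintegral_congr fun r => ?_
  rw [ENNReal.ofReal_mul (by positivity)]

/-- The directions `β` of the slope such that the plane `t + cos (α - β)` is nonnegative at the
three points of the circle at the angles `φ`. -/
def admissible (φ : Fin 3 → Real.Angle) (t : ℝ) : Set ℝ :=
  {β | ∀ i, 0 ≤ t + (φ i - (β : Real.Angle)).cos}

theorem mem_admissible_iff {φ : Fin 3 → Real.Angle} {t β : ℝ} :
    β ∈ admissible φ t ↔ ∀ i, 0 ≤ hoopHeight ![t, Real.cos β, Real.sin β] (φ i) := by
  simp only [admissible, Set.mem_ofPred_eq, hoopHeight_eq, Matrix.cons_val, sub_eq_add_neg,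
    Real.Angle.cos_add, Real.Angle.cos_neg, Real.Angle.sin_neg, Real.Angle.cos_coe,
    Real.Angle.sin_coe]
  refine forall_congr' fun i => ?_
  ring_nf

theorem measurableSet_admissible (φ : Fin 3 → Real.Angle) (t : ℝ) :
    MeasurableSet (admissible φ t) := by
  have : admissible φ t = ⋂ i, {β | 0 ≤ hoopHeight ![t, Real.cos β, Real.sin β] (φ i)} := by
    ext β
    rw [mem_admissible_iff, Set.mem_iInter]
    rfl
  rw [this]
  simp only [hoopHeight_eq, Matrix.cons_val]
  refine MeasurableSet.iInter fun i => (isClosed_le continuous_const ?_).measurableSet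
  fun_prop

/-- The integral in the limit of the probability of support, in terms of the set of admissible
directions of the slope. -/
theorem lintegral_planes_admissible {φ : Fin 3 → Real.Angle} {ϑ : ArcTriple} (hφ : HasArcs φ ϑ) :
    ∫⁻ x in Set.univ.pi fun _ : Fin 3 => Set.Ici (0 : ℝ),
        ENNReal.ofReal (Real.exp (-meanPosPart (planeThrough φ x))) =
      ENNReal.ofReal (evalMatrix φ).det * ∫⁻ t in Set.Ioi (0 : ℝ),
        volume (admissible φ t ∩ Set.Ioo (-Real.pi) Real.pi) *
          ENNReal.ofReal (2 / meanPosPart ![t, 1, 0] ^ 3) := by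
  have hdet := hφ.det_pos
  have hint := mem_interior_of_sin_pos hφ.sin_pos
  set A : Set (Fin 3 → ℝ) := {h | ∀ i, 0 ≤ hoopHeight h (φ i)} with hA
  have hAm : MeasurableSet A := by
    simp only [hA, Set.ofPred_forall, hoopHeight_eq]
    exact MeasurableSet.iInter fun i => (isClosed_le continuous_const (by fun_prop)).measurableSet
  set H : (Fin 3 → ℝ) → ENNReal :=
    A.indicator fun h => ENNReal.ofReal (Real.exp (-meanPosPart h)) with hH
  have hHm : Measurable H := by
    refine Measurable.indicator ?_ hAm
    have := continuous_meanPosPart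
    exact (by fun_prop : Measurable fun h => ENNReal.ofReal (Real.exp (-meanPosPart h)))
  have hinv : ((evalMatrix φ)⁻¹).det = (evalMatrix φ).det⁻¹ := by
    rw [Matrix.det_nonsing_inv, Ring.inverse_eq_inv']
  have e1 : ∫⁻ x in Set.univ.pi fun _ : Fin 3 => Set.Ici (0 : ℝ),
        ENNReal.ofReal (Real.exp (-meanPosPart (planeThrough φ x))) =
      ∫⁻ x, H (planeThrough φ x) := by
    rw [← lintegral_indicator (MeasurableSet.univ_pi fun _ => measurableSet_Ici)]
    refine lintegral_congr fun x => ?_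
    have hiff : x ∈ (Set.univ.pi fun _ : Fin 3 => Set.Ici (0 : ℝ)) ↔ planeThrough φ x ∈ A := by
      simp only [hA, Set.mem_ofPred_eq, hoopHeight_planeThrough hdet.ne', Set.mem_pi,
        Set.mem_univ, true_imp_iff, Set.mem_Ici]
    by_cases hx : x ∈ (Set.univ.pi fun _ : Fin 3 => Set.Ici (0 : ℝ))
    · rw [Set.indicator_of_mem hx, hH, Set.indicator_of_mem (hiff.1 hx)]
    · rw [Set.indicator_of_notMem hx, hH, Set.indicator_of_notMem (mt hiff.2 hx)]
  have e2 : ∫⁻ x, H (planeThrough φ x) = ENNReal.ofReal (evalMatrix φ).det * ∫⁻ h, H h := by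
    have hmap := Real.map_matrix_volume_pi_eq_smul_volume_pi (M := (evalMatrix φ)⁻¹)
      (by rw [hinv]; exact inv_ne_zero hdet.ne')
    rw [hinv, inv_inv, abs_of_pos hdet] at hmap
    have hmeas : Measurable (Matrix.toLin' (evalMatrix φ)⁻¹) :=
      (LinearMap.continuous_on_pi _).measurable
    have := lintegral_map (μ := volume) hHm hmeas
    rw [hmap, lintegral_smul_measure, smul_eq_mul] at this
    exact this.symm
  rw [e1, e2, lintegral_planes hHm]
  congr 1
  have hpt : ∀ t, ∫⁻ β in Set.Ioo (-Real.pi) Real.pi, ∫⁻ r in Set.Ioi (0 : ℝ),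
        ENNReal.ofReal (r ^ 2) * H (r • ![t, Real.cos β, Real.sin β]) =
      (Set.Ioi (0 : ℝ)).indicator (fun t =>
        volume (admissible φ t ∩ Set.Ioo (-Real.pi) Real.pi) *
          ENNReal.ofReal (2 / meanPosPart ![t, 1, 0] ^ 3)) t := by
    intro t
    have hmemA : ∀ {r β : ℝ}, r ∈ Set.Ioi (0 : ℝ) →
        (r • ![t, Real.cos β, Real.sin β] ∈ A ↔ β ∈ admissible φ t) := by
      intro r β hr
      rw [mem_admissible_iff]
      refine forall_congr' fun i => ?_
      rw [hoopHeight_smul, mul_nonneg_iff_of_pos_left hr]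
    have hinner : ∀ β, ∫⁻ r in Set.Ioi (0 : ℝ),
        ENNReal.ofReal (r ^ 2) * H (r • ![t, Real.cos β, Real.sin β]) =
        (admissible φ t).indicator (fun _ => ∫⁻ r in Set.Ioi (0 : ℝ), ENNReal.ofReal (r ^ 2) *
          ENNReal.ofReal (Real.exp (-(r * meanPosPart ![t, 1, 0])))) β := by
      intro β
      by_cases hβ : β ∈ admissible φ t
      · rw [Set.indicator_of_mem hβ]
        refine setLIntegral_congr_fun measurableSet_Ioi fun r hr => ?_
        rw [hH, Set.indicator_of_mem ((hmemA hr).2 hβ), meanPosPart_smul (le_of_lt hr),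
          meanPosPart_rotate]
      · rw [Set.indicator_of_notMem hβ]
        refine setLIntegral_eq_zero measurableSet_Ioi fun r hr => ?_
        rw [hH, Set.indicator_of_notMem (mt (hmemA hr).1 hβ), mul_zero]
        rfl
    simp only [hinner]
    rw [lintegral_indicator_const (measurableSet_admissible φ t),
      Measure.restrict_apply (measurableSet_admissible φ t)]
    by_cases ht : 0 < t
    · have hG : 0 < meanPosPart ![t, 1, 0] := by
        rcases le_total 1 t with h1 | h1
        · rw [meanPosPart_of_one_le h1]; exact ht
        · rw [← Real.cos_arccos (by linarith) h1, meanPosPart_cos (Real.arccos_nonneg _)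
            (Real.arccos_le_pi _), Real.cos_arccos (by linarith) h1]
          have hlt : Real.arccos t < Real.pi := by
            linarith [Real.arccos_lt_pi_div_two.2 ht, Real.pi_pos]
          have := Real.sin_nonneg_of_nonneg_of_le_pi (Real.arccos_nonneg t) hlt.le
          have : 0 < (Real.pi - Real.arccos t) * t := mul_pos (by linarith) ht
          have := Real.pi_pos
          positivity
      rw [Set.indicator_of_mem (Set.mem_Ioi.2 ht), lintegral_sq_mul_exp hG, mul_comm]
    · -- a plane that is not positive over the centre is negative at one of the three points
      have hempty : admissible φ t = ∅ := by
        refine Set.eq_empty_of_forall_notMem fun β hβ => ?_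
        have h0 := eq_zero_of_hoopHeight_nonneg hint (d := ![t, Real.cos β, Real.sin β])
          (not_lt.1 ht) (mem_admissible_iff.1 hβ)
        have h1 : Real.cos β = 0 := congrFun h0 1
        have h2 : Real.sin β = 0 := congrFun h0 2
        have := Real.sin_sq_add_cos_sq β
        rw [h1, h2] at this
        norm_num at this
      rw [Set.indicator_of_notMem (by simpa using ht), hempty, Set.empty_inter, measure_empty,
        mul_zero]
  simp only [hpt]
  rw [lintegral_indicator measurableSet_Ioi]

/-! ### Evaluation of the limit -/

theorem le_of_cos_le_cos {x ψ : ℝ} (hψ : ψ ≤ Real.pi) (hx : 0 ≤ x)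
    (h : Real.cos x ≤ Real.cos ψ) : ψ ≤ x := by
  by_contra! hlt
  exact absurd h (not_le.2 (Real.cos_lt_cos_of_nonneg_of_le_pi hx hψ hlt))

theorem cos_le_cos_of_mem_Icc {x ψ : ℝ} (hψ : 0 ≤ ψ) (h1 : ψ ≤ x) (h2 : x ≤ 2 * Real.pi - ψ) :
    Real.cos x ≤ Real.cos ψ := by
  rcases le_total x Real.pi with h | h
  · exact Real.cos_le_cos_of_nonneg_of_le_pi hψ h h1
  · rw [← Real.cos_two_pi_sub x]
    exact Real.cos_le_cos_of_nonneg_of_le_pi hψ (by linarith) (by linarith)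

/-- The points of the circle at distance at least `ψ` from the points `0`, `a`, `b`. -/
theorem setOf_cos_sub_le {a b ψ : ℝ} (ha0 : 0 < a) (hab : a < b) (hb : b < 2 * Real.pi)
    (h0 : 0 < ψ) (hψ : ψ ≤ Real.pi) :
    {s | Real.cos s ≤ Real.cos ψ ∧ Real.cos (s - a) ≤ Real.cos ψ ∧ Real.cos (s - b) ≤ Real.cos ψ} ∩
      Set.Ioc 0 (2 * Real.pi) =
    Set.Icc ψ (a - ψ) ∪ (Set.Icc (a + ψ) (b - ψ) ∪ Set.Icc (b + ψ) (2 * Real.pi - ψ)) := by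
  ext s
  simp only [Set.mem_inter_iff, Set.mem_ofPred_eq, Set.mem_Ioc, Set.mem_union, Set.mem_Icc]
  constructor
  · rintro ⟨⟨h1, h2, h3⟩, hs0, hs1⟩
    rcases le_total s a with hsa | hsa
    · refine Or.inl ⟨le_of_cos_le_cos hψ hs0.le h1, ?_⟩
      rw [← Real.cos_neg] at h2
      have := le_of_cos_le_cos hψ (by linarith) h2
      linarith
    have h2' := le_of_cos_le_cos hψ (by linarith) h2
    rcases le_total s b with hsb | hsb
    · refine Or.inr (Or.inl ⟨by linarith, ?_⟩)
      rw [← Real.cos_neg] at h3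
      have := le_of_cos_le_cos hψ (by linarith) h3
      linarith
    · have h3' := le_of_cos_le_cos hψ (by linarith) h3
      refine Or.inr (Or.inr ⟨by linarith, ?_⟩)
      rw [← Real.cos_two_pi_sub] at h1
      have := le_of_cos_le_cos hψ (by linarith) h1
      linarith
  · have hsym : ∀ x, -(2 * Real.pi - ψ) ≤ x → x ≤ -ψ → Real.cos x ≤ Real.cos ψ := by
      intro x hx1 hx2
      rw [← Real.cos_neg]
      exact cos_le_cos_of_mem_Icc h0.le (by linarith) (by linarith)
    rintro (⟨h1, h2⟩ | ⟨h1, h2⟩ | ⟨h1, h2⟩)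
    · exact ⟨⟨cos_le_cos_of_mem_Icc h0.le (by linarith) (by linarith),
        hsym _ (by linarith) (by linarith), hsym _ (by linarith) (by linarith)⟩,
        by linarith, by linarith⟩
    · exact ⟨⟨cos_le_cos_of_mem_Icc h0.le (by linarith) (by linarith),
        cos_le_cos_of_mem_Icc h0.le (by linarith) (by linarith),
        hsym _ (by linarith) (by linarith)⟩, by linarith, by linarith⟩
    · exact ⟨⟨cos_le_cos_of_mem_Icc h0.le (by linarith) (by linarith),
        cos_le_cos_of_mem_Icc h0.le (by linarith) (by linarith),
        cos_le_cos_of_mem_Icc h0.le (by linarith) (by linarith)⟩, by linarith, by linarith⟩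

/-- The arc of length `2 ψ` where the plane is negative has to fit into one of the arcs `ϑ i`. -/
theorem volume_admissible {φ : Fin 3 → Real.Angle} {ϑ : ArcTriple} (hφ : HasArcs φ ϑ) {ψ : ℝ}
    (h0 : 0 < ψ) (hψ : ψ ≤ Real.pi) :
    volume (admissible φ (Real.cos ψ) ∩ Set.Ioo (-Real.pi) Real.pi) =
      ∑ i, ENNReal.ofReal (ϑ.1 i - 2 * ψ) := by
  have hπ := Real.pi_pos
  have hm := measurableSet_admissible φ (Real.cos ψ)
  set u : ℝ := (φ 0).toReal with hu
  have e0 : φ 0 = (u : Real.Angle) := (Real.Angle.coe_toReal _).symm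
  obtain ⟨s0, s1, s2⟩ := hφ.sub_eq
  have e1 : φ 1 = ((u + ϑ.1 2 : ℝ) : Real.Angle) := by
    rw [Real.Angle.coe_add, ← s2, ← e0]; abel
  have e2 : φ 2 = ((u + (ϑ.1 2 + ϑ.1 0) : ℝ) : Real.Angle) := by
    rw [← add_assoc, Real.Angle.coe_add, ← s0, ← e1]; abel
  have hper : ∀ g : AddSubgroup.zmultiples (2 * Real.pi),
      (fun x => g +ᵥ x) ⁻¹' admissible φ (Real.cos ψ) = admissible φ (Real.cos ψ) := by
    rintro ⟨g, hg⟩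
    obtain ⟨m, rfl⟩ := AddSubgroup.mem_zmultiples_iff.1 hg
    ext x
    have : ((m • (2 * Real.pi) + x : ℝ) : Real.Angle) = x := by simp
    change (∀ i, _ ≤ _ + (φ i - ((m • (2 * Real.pi) + x : ℝ) : Real.Angle)).cos) ↔ _
    rw [this]
    rfl
  have hae : (admissible φ (Real.cos ψ) ∩ Set.Ioo (-Real.pi) Real.pi : Set ℝ) =ᵐ[volume]
      (admissible φ (Real.cos ψ) ∩ Set.Ioc (-Real.pi) (-Real.pi + 2 * Real.pi) : Set ℝ) := by
    refine Filter.EventuallyEq.inter (ae_eq_refl _) ?_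
    rw [show -Real.pi + 2 * Real.pi = Real.pi by ring]
    exact Ioo_ae_eq_Ioc
  have htp : 0 < 2 * Real.pi := by positivity
  rw [measure_congr hae, (isAddFundamentalDomain_Ioc htp (-Real.pi) volume).measure_set_eq
    (isAddFundamentalDomain_Ioc htp (u + Real.pi) volume) hm hper,
    ← measure_preimage_add volume (u + Real.pi)]
  have hset : (fun s => u + Real.pi + s) ⁻¹' (admissible φ (Real.cos ψ) ∩
      Set.Ioc (u + Real.pi) (u + Real.pi + 2 * Real.pi)) =
      {s | Real.cos s ≤ Real.cos ψ ∧ Real.cos (s - ϑ.1 2) ≤ Real.cos ψ ∧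
        Real.cos (s - (ϑ.1 2 + ϑ.1 0)) ≤ Real.cos ψ} ∩ Set.Ioc 0 (2 * Real.pi) := by
    have hcos : ∀ b s : ℝ, Real.cos (u + b - (u + Real.pi + s)) = -Real.cos (s - b) := by
      intro b s
      rw [← Real.cos_neg, show -(u + b - (u + Real.pi + s)) = s - b + Real.pi by ring,
        Real.cos_add_pi]
    ext s
    simp only [Set.mem_preimage, Set.mem_inter_iff, admissible, Set.mem_ofPred_eq,
      Fin.forall_fin_succ, Fin.succ_zero_eq_one, Fin.succ_one_eq_two, IsEmpty.forall_iff, and_true,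
      e0, e1, e2, ← Real.Angle.coe_sub, Real.Angle.cos_coe, hcos, Set.mem_Ioc]
    rw [show u - (u + Real.pi + s) = u + 0 - (u + Real.pi + s) by ring, hcos, sub_zero]
    simp only [← sub_eq_add_neg, sub_nonneg]
    simp
  have p0 := ϑ.2.1 0
  have p1 := ϑ.2.1 1
  have p2 := ϑ.2.1 2
  have hs := ϑ.2.2
  rw [hset, setOf_cos_sub_le p2.1 (by linarith) (by linarith) h0 hψ, measure_union _
    (measurableSet_Icc.union measurableSet_Icc), measure_union _ measurableSet_Icc]
  · simp only [Real.volume_Icc, Fin.sum_univ_three]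
    rw [show ϑ.1 2 - ψ - ψ = ϑ.1 2 - 2 * ψ by ring,
      show ϑ.1 2 + ϑ.1 0 - ψ - (ϑ.1 2 + ψ) = ϑ.1 0 - 2 * ψ by ring,
      show 2 * Real.pi - ψ - (ϑ.1 2 + ϑ.1 0 + ψ) = ϑ.1 1 - 2 * ψ by linarith]
    abel
  · exact Set.disjoint_left.2 fun s h1 h2 => by linarith [h1.2, h2.1]
  · refine Set.disjoint_left.2 fun s h1 h2 => ?_
    rcases h2 with h2 | h2 <;> linarith [h1.2, h2.1]

theorem denominator_pos {ψ : ℝ} (h0 : 0 ≤ ψ) (h1 : ψ ≤ Real.pi / 2) :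
    0 < (Real.pi - ψ) * Real.cos ψ + Real.sin ψ := by
  have hπ := Real.pi_pos
  have hc := Real.cos_nonneg_of_mem_Icc ⟨by linarith, h1⟩
  have hs := Real.sin_nonneg_of_nonneg_of_le_pi h0 (by linarith)
  have hsc := Real.sin_sq_add_cos_sq ψ
  have : 0 < Real.pi - ψ := by linarith
  rcases hs.eq_or_lt with h | h
  · have : 0 < Real.cos ψ := by
      rcases hc.eq_or_lt with h' | h'
      · rw [← h, ← h'] at hsc; norm_num at hsc
      · exact h'
    positivity
  · positivity

theorem lintegral_eq_f {x : ℝ} (h0 : 0 < x) (h1 : x < Real.pi) :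
    ∫⁻ ψ in Set.Ioo 0 (Real.pi / 2), ENNReal.ofReal (Real.sin ψ) * (ENNReal.ofReal (x - 2 * ψ) *
      ENNReal.ofReal (2 / (((Real.pi - ψ) * Real.cos ψ + Real.sin ψ) / Real.pi) ^ 3)) =
    ENNReal.ofReal (2 * Real.pi ^ 3 * f x) := by
  have hπ := Real.pi_pos
  have hcont : ContinuousOn (fun ψ => (x - 2 * ψ) * Real.sin ψ /
      ((Real.pi - ψ) * Real.cos ψ + Real.sin ψ) ^ 3) (Set.uIcc 0 (x / 2)) := by
    rw [Set.uIcc_of_le (by linarith)]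
    refine ContinuousOn.div (by fun_prop) (by fun_prop) fun ψ hψ => ?_
    exact (pow_pos (denominator_pos hψ.1 (by linarith [hψ.2])) 3).ne'
  have hint := (hcont.intervalIntegrable (μ := volume)).const_mul (2 * Real.pi ^ 3)
  rw [f, ← intervalIntegral.integral_const_mul, intervalIntegral.integral_of_le (by linarith),
    ofReal_integral_eq_lintegral_ofReal, ← lintegral_indicator measurableSet_Ioo,
    ← lintegral_indicator measurableSet_Ioc]
  · refine lintegral_congr fun ψ => ?_
    by_cases hψ : ψ ∈ Set.Ioc 0 (x / 2)
    · have hd := denominator_pos hψ.1.le (by linarith [hψ.2])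
      have hs := Real.sin_nonneg_of_nonneg_of_le_pi hψ.1.le (by linarith [hψ.2])
      rw [Set.indicator_of_mem hψ, Set.indicator_of_mem
          (show ψ ∈ Set.Ioo 0 (Real.pi / 2) from ⟨hψ.1, by linarith [hψ.2]⟩),
        ← ENNReal.ofReal_mul (by linarith [hψ.2]), ← ENNReal.ofReal_mul hs]
      congr 1
      field_simp
    · rw [Set.indicator_of_notMem hψ]
      by_cases hψ' : ψ ∈ Set.Ioo 0 (Real.pi / 2)
      · rw [Set.indicator_of_mem hψ']
        have : ENNReal.ofReal (x - 2 * ψ) = 0 := by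
          rw [ENNReal.ofReal_eq_zero]
          by_contra! hc
          exact hψ ⟨hψ'.1, by linarith⟩
        rw [this, zero_mul, mul_zero]
      · rw [Set.indicator_of_notMem hψ']
  · rw [intervalIntegrable_iff_integrableOn_Ioc_of_le (by linarith)] at hint
    exact hint
  · refine (ae_restrict_iff' measurableSet_Ioc).2 (Eventually.of_forall fun ψ hψ => ?_)
    have hd := denominator_pos hψ.1.le (by linarith [hψ.2])
    have hs := Real.sin_nonneg_of_nonneg_of_le_pi hψ.1.le (by linarith [hψ.2])
    have : 0 ≤ x - 2 * ψ := by linarith [hψ.2]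
    simp only [Pi.zero_apply]
    positivity

theorem f_nonneg {x : ℝ} (h0 : 0 ≤ x) (h1 : x ≤ Real.pi) : 0 ≤ f x := by
  refine intervalIntegral.integral_nonneg (by linarith) fun ψ hψ => ?_
  have hd := denominator_pos hψ.1 (by linarith [hψ.2])
  have hs := Real.sin_nonneg_of_nonneg_of_le_pi hψ.1 (by linarith [hψ.2, Real.pi_pos])
  have : 0 ≤ x - 2 * ψ := by linarith [hψ.2]
  positivity

theorem arcDensity_nonneg (ϑ : ArcTriple) : 0 ≤ arcDensity ϑ := by
  have h1 := prod_sin_pos ϑ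
  have h2 : 0 ≤ ∑ i, f (ϑ.1 i) :=
    Finset.sum_nonneg fun i _ => f_nonneg (ϑ.2.1 i).1.le (ϑ.2.1 i).2.le
  have := Real.pi_pos
  unfold arcDensity
  positivity

theorem lintegral_two_div_cube :
    ∫⁻ t in Set.Ioi (1 : ℝ), ENNReal.ofReal (2 / t ^ 3) = 1 := by
  have hi : IntegrableOn (fun t : ℝ => t ^ (-3 : ℝ)) (Set.Ioi 1) :=
    integrableOn_Ioi_rpow_of_lt (by norm_num) one_pos
  have h := integral_Ioi_rpow_of_lt (a := -3) (by norm_num) one_pos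
  have hrw : ∀ t ∈ Set.Ioi (1 : ℝ), 2 / t ^ 3 = 2 * t ^ (-3 : ℝ) := fun t ht => by
    rw [Real.rpow_neg (zero_le_one.trans (le_of_lt ht)), div_eq_mul_inv]
    norm_cast
  rw [setLIntegral_congr_fun measurableSet_Ioi fun t ht => by rw [hrw t ht],
    ← ofReal_integral_eq_lintegral_ofReal (hi.const_mul 2), integral_const_mul, h]
  · norm_num
  · refine (ae_restrict_iff' measurableSet_Ioi).2 (Eventually.of_forall fun t ht => ?_)
    have : (0 : ℝ) < t := one_pos.trans ht
    simp only [Pi.zero_apply]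
    positivity

theorem lintegral_admissible {φ : Fin 3 → Real.Angle} {ϑ : ArcTriple} (hφ : HasArcs φ ϑ) :
    ∫⁻ t in Set.Ioi (0 : ℝ), volume (admissible φ t ∩ Set.Ioo (-Real.pi) Real.pi) *
        ENNReal.ofReal (2 / meanPosPart ![t, 1, 0] ^ 3) =
      ENNReal.ofReal (2 * Real.pi + 2 * Real.pi ^ 3 * ∑ i, f (ϑ.1 i)) := by
  have hπ := Real.pi_pos
  have hsplit : Set.Ioi (0 : ℝ) = Set.Ioc 0 1 ∪ Set.Ioi 1 :=
    (Set.Ioc_union_Ioi_eq_Ioi zero_le_one).symm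
  have hf0 : ∀ i, 0 ≤ f (ϑ.1 i) := fun i => f_nonneg (ϑ.2.1 i).1.le (ϑ.2.1 i).2.le
  rw [hsplit, lintegral_union measurableSet_Ioi (Set.Ioc_disjoint_Ioi le_rfl), add_comm,
    ENNReal.ofReal_add (by positivity)
      (mul_nonneg (by positivity) (Finset.sum_nonneg fun i _ => hf0 i))]
  congr 1
  · -- the plane is nonnegative everywhere
    have : ∀ t ∈ Set.Ioi (1 : ℝ), volume (admissible φ t ∩ Set.Ioo (-Real.pi) Real.pi) *
        ENNReal.ofReal (2 / meanPosPart ![t, 1, 0] ^ 3) =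
        ENNReal.ofReal (2 * Real.pi) * ENNReal.ofReal (2 / t ^ 3) := by
      intro t ht
      have hadm : admissible φ t = Set.univ := by
        refine Set.eq_univ_of_forall fun β i => ?_
        generalize φ i - (β : Real.Angle) = γ
        induction γ using Real.Angle.induction_on
        rw [Real.Angle.cos_coe]
        linarith [Real.neg_one_le_cos (by assumption), Set.mem_Ioi.1 ht]
      rw [hadm, Set.univ_inter, Real.volume_Ioo, meanPosPart_of_one_le (le_of_lt ht)]
      congr 2
      ring
    rw [setLIntegral_congr_fun measurableSet_Ioi this,
      lintegral_const_mul' _ _ ENNReal.ofReal_ne_top, lintegral_two_div_cube, mul_one]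
  · have himage : Real.cos '' Set.Ioo 0 (Real.pi / 2) = Set.Ioo 0 1 := by
      ext t
      constructor
      · rintro ⟨ψ, hψ, rfl⟩
        refine ⟨Real.cos_pos_of_mem_Ioo ⟨by linarith [hψ.1], hψ.2⟩, ?_⟩
        rw [← Real.cos_zero]
        exact Real.cos_lt_cos_of_nonneg_of_le_pi_div_two le_rfl hψ.2.le hψ.1
      · intro ht
        exact ⟨Real.arccos t, ⟨Real.arccos_pos.2 ht.2, Real.arccos_lt_pi_div_two.2 ht.1⟩,
          Real.cos_arccos (by linarith [ht.1]) ht.2.le⟩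
    have hinj : Set.InjOn Real.cos (Set.Ioo 0 (Real.pi / 2)) :=
      Real.injOn_cos.mono (Set.Ioo_subset_Icc_self.trans (Set.Icc_subset_Icc_right (by linarith)))
    have hIoc : Set.Ioc (0 : ℝ) 1 =ᵐ[volume] Set.Ioo 0 1 := Ioo_ae_eq_Ioc.symm
    rw [setLIntegral_congr hIoc, ← himage,
      lintegral_image_eq_lintegral_abs_deriv_mul measurableSet_Ioo
        (fun ψ _ => (Real.hasDerivAt_cos ψ).hasDerivWithinAt) hinj]
    have : ∀ ψ ∈ Set.Ioo 0 (Real.pi / 2), ENNReal.ofReal |-Real.sin ψ| *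
        (volume (admissible φ (Real.cos ψ) ∩ Set.Ioo (-Real.pi) Real.pi) *
          ENNReal.ofReal (2 / meanPosPart ![Real.cos ψ, 1, 0] ^ 3)) =
        ∑ i, ENNReal.ofReal (Real.sin ψ) * (ENNReal.ofReal (ϑ.1 i - 2 * ψ) *
        ENNReal.ofReal (2 / (((Real.pi - ψ) * Real.cos ψ + Real.sin ψ) / Real.pi) ^ 3)) := by
      intro ψ hψ
      rw [abs_neg, abs_of_nonneg (Real.sin_nonneg_of_nonneg_of_le_pi hψ.1.le
        (by linarith [hψ.2])), volume_admissible hφ hψ.1 (by linarith [hψ.2]),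
        meanPosPart_cos hψ.1.le (by linarith [hψ.2]), Finset.sum_mul, Finset.mul_sum]
    rw [setLIntegral_congr_fun measurableSet_Ioo this, lintegral_finsetSum' _ fun i _ => by
      fun_prop]
    simp only [lintegral_eq_f (ϑ.2.1 _).1 (ϑ.2.1 _).2]
    rw [Finset.mul_sum, ENNReal.ofReal_sum_of_nonneg fun i _ => by have := hf0 i; positivity]

/-- The limit density of the support triple. -/
theorem tendsto_density {φ : Fin 3 → Real.Angle} {ϑ : ArcTriple} (hφ : HasArcs φ ϑ)
    {N : ℕ → ℕ} {n : ∀ k, Fin 3 → Fin (N k)} (hN : Tendsto N atTop atTop)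
    (hn : ∀ i, Tendsto (fun k => toothAngle (N k) (n k i)) atTop (𝓝 (φ i))) :
    Tendsto (fun k => ((N k : ℝ) / (2 * Real.pi)) ^ 3 *
      (combMeasure (N k)).real {ξ | IsSupportedBy ξ (n k)}) atTop
      (𝓝 (density ⟦ϑ⟧ / (2 * Real.pi))) := by
  have hπ := Real.pi_pos
  have h := tendsto_pow_mul_combMeasure hφ hN hn
  rw [lintegral_planes_admissible hφ, lintegral_admissible hφ,
    ← ENNReal.ofReal_mul hφ.det_pos.le] at h
  have h2 := ((ENNReal.tendsto_toReal ENNReal.ofReal_ne_top).comp h).mul_const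
    ((2 * Real.pi)⁻¹ ^ 3)
  have hf0 : ∀ i, 0 ≤ f (ϑ.1 i) := fun i => f_nonneg (ϑ.2.1 i).1.le (ϑ.2.1 i).2.le
  have hs0 : 0 ≤ ∑ i, f (ϑ.1 i) := Finset.sum_nonneg fun i _ => hf0 i
  have hlim : (ENNReal.ofReal ((evalMatrix φ).det *
      (2 * Real.pi + 2 * Real.pi ^ 3 * ∑ i, f (ϑ.1 i)))).toReal * (2 * Real.pi)⁻¹ ^ 3 =
      density ⟦ϑ⟧ / (2 * Real.pi) := by
    rw [ENNReal.toReal_ofReal (mul_nonneg hφ.det_pos.le (by positivity)), hφ.det_eq]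
    change _ = arcDensity ϑ / (2 * Real.pi)
    rw [arcDensity]
    field_simp
    ring
  rw [hlim] at h2
  refine h2.congr fun k => ?_
  simp only [Function.comp_apply, ENNReal.toReal_mul]
  rw [ENNReal.toReal_ofReal (by positivity), div_pow, div_eq_mul_inv, inv_pow]
  simp only [Measure.real]
  ring

/-! ### The function `f` and its integral -/

/-- The kernel in the integral that defines `f`. -/
noncomputable def kernel (ψ : ℝ) : ℝ :=
  Real.sin ψ / ((Real.pi - ψ) * Real.cos ψ + Real.sin ψ) ^ 3

theorem continuousAt_kernel {ψ : ℝ} (h0 : 0 ≤ ψ) (h1 : ψ ≤ Real.pi / 2) :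
    ContinuousAt kernel ψ := by
  unfold kernel
  exact ContinuousAt.div (by fun_prop) (by fun_prop) (pow_pos (denominator_pos h0 h1) 3).ne'

theorem measurable_kernel : Measurable kernel := by
  unfold kernel
  fun_prop

theorem intervalIntegrable_mul_kernel {g : ℝ → ℝ} (hg : Continuous g) {y : ℝ} (h0 : 0 ≤ y)
    (h1 : y ≤ Real.pi / 2) : IntervalIntegrable (fun ψ => g ψ * kernel ψ) volume 0 y := by
  refine ContinuousOn.intervalIntegrable fun ψ hψ => ContinuousAt.continuousWithinAt ?_
  rw [Set.uIcc_of_le h0] at hψ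
  exact hg.continuousAt.mul (continuousAt_kernel hψ.1 (hψ.2.trans h1))

theorem hasDerivAt_integral_mul_kernel {g : ℝ → ℝ} (hg : Continuous g) {y : ℝ} (h0 : 0 ≤ y)
    (h1 : y ≤ Real.pi / 2) :
    HasDerivAt (fun y => ∫ ψ in (0 : ℝ)..y, g ψ * kernel ψ) (g y * kernel y) y :=
  intervalIntegral.integral_hasDerivAt_right (intervalIntegrable_mul_kernel hg h0 h1)
    ((hg.measurable.mul measurable_kernel).stronglyMeasurable.stronglyMeasurableAtFilter)
    (hg.continuousAt.mul (continuousAt_kernel h0 h1))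

theorem f_eq {x : ℝ} (h0 : 0 ≤ x) (h1 : x ≤ Real.pi) :
    f x = x * (∫ ψ in (0 : ℝ)..x / 2, 1 * kernel ψ) -
      2 * ∫ ψ in (0 : ℝ)..x / 2, ψ * kernel ψ := by
  rw [← intervalIntegral.integral_const_mul, ← intervalIntegral.integral_const_mul,
    ← intervalIntegral.integral_sub
      ((intervalIntegrable_mul_kernel (g := fun _ => 1) continuous_const (by linarith)
        (by linarith)).const_mul x)
      ((intervalIntegrable_mul_kernel (g := fun ψ => ψ) continuous_id (by linarith)
        (by linarith)).const_mul 2), f]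
  refine intervalIntegral.integral_congr fun ψ _ => ?_
  simp only [kernel]
  ring

theorem hasDerivAt_f {x : ℝ} (h0 : 0 < x) (h1 : x < Real.pi) :
    HasDerivAt f (∫ ψ in (0 : ℝ)..x / 2, 1 * kernel ψ) x := by
  have hx : HasDerivAt (fun x : ℝ => x / 2) (1 / 2) x := (hasDerivAt_id x).div_const 2
  have d0 := (hasDerivAt_integral_mul_kernel (g := fun _ => 1) continuous_const
    (y := x / 2) (by linarith) (by linarith)).comp x hx
  have d1 := (hasDerivAt_integral_mul_kernel (g := id) continuous_id
    (y := x / 2) (by linarith) (by linarith)).comp x hx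
  have d := ((hasDerivAt_id x).mul d0).sub (d1.const_mul 2)
  have heq : f =ᶠ[𝓝 x] (fun x => x * (∫ ψ in (0 : ℝ)..x / 2, 1 * kernel ψ) -
      2 * ∫ ψ in (0 : ℝ)..x / 2, ψ * kernel ψ) := by
    filter_upwards [Ioo_mem_nhds h0 h1] with y hy
    exact f_eq hy.1.le hy.2.le
  refine HasDerivAt.congr_of_eventuallyEq ?_ heq
  convert! d using 1
  simp only [Function.comp_apply, id]
  ring

theorem continuousOn_integral_mul_kernel {g : ℝ → ℝ} (hg : Continuous g) :
    ContinuousOn (fun x => ∫ ψ in (0 : ℝ)..x / 2, g ψ * kernel ψ) (Set.Icc 0 Real.pi) := by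
  intro x hx
  have h := (hasDerivAt_integral_mul_kernel hg (y := x / 2) (by linarith [hx.1])
    (by linarith [hx.2])).continuousAt
  exact (ContinuousAt.comp (f := fun x : ℝ => x / 2) (g := fun y => ∫ ψ in (0 : ℝ)..y, g ψ * kernel ψ)
    h (by fun_prop)).continuousWithinAt

theorem continuousOn_f : ContinuousOn f (Set.Icc 0 Real.pi) := by
  refine ContinuousOn.congr ?_ fun x hx => f_eq hx.1 hx.2
  exact (continuousOn_id.mul (continuousOn_integral_mul_kernel (g := fun _ => 1)
    continuous_const)).sub
    (continuousOn_const.mul (continuousOn_integral_mul_kernel (g := id) continuous_id))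

/-- The integral of `∏ i, sin (ϑ i / 2)` over the triples of arcs with `ϑ 0 = x`. -/
noncomputable def weight (x : ℝ) : ℝ :=
  Real.sin (x / 2) * (Real.sin (x / 2) + x / 2 * Real.cos (x / 2))

theorem hasDerivAt_sin_half (x : ℝ) :
    HasDerivAt (fun x : ℝ => Real.sin (x / 2)) (Real.cos (x / 2) * (1 / 2)) x :=
  (Real.hasDerivAt_sin _).comp x ((hasDerivAt_id x).div_const 2)

theorem hasDerivAt_cos_half (x : ℝ) :
    HasDerivAt (fun x : ℝ => Real.cos (x / 2)) (-Real.sin (x / 2) * (1 / 2)) x :=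
  (Real.hasDerivAt_cos _).comp x ((hasDerivAt_id x).div_const 2)

/-- The antiderivative of `weight` that vanishes at `π`. -/
noncomputable def weightInt (x : ℝ) : ℝ :=
  x / 2 * Real.sin (x / 2) ^ 2 + x / 4 - Real.sin (x / 2) * Real.cos (x / 2) / 2 -
    3 * Real.pi / 4

/-- The second antiderivative of `weight` that vanishes to the second order at `π`. -/
noncomputable def weightInt2 (x : ℝ) : ℝ :=
  (Real.pi / 2 - x / 2) * (Real.pi - x / 2) - x / 2 * Real.sin (x / 2) * Real.cos (x / 2)

theorem hasDerivAt_weightInt (x : ℝ) : HasDerivAt weightInt (weight x) x := by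
  have hs := hasDerivAt_sin_half x
  have hc := hasDerivAt_cos_half x
  have hx : HasDerivAt (fun x : ℝ => x / 2) (1 / 2) x := (hasDerivAt_id x).div_const 2
  have hx4 : HasDerivAt (fun x : ℝ => x / 4) (1 / 4) x := (hasDerivAt_id x).div_const 4
  have h := (((hx.mul (hs.pow 2)).add hx4).sub ((hs.mul hc).div_const 2)).sub_const
    (3 * Real.pi / 4)
  convert! h using 1
  have := Real.sin_sq_add_cos_sq (x / 2)
  simp only [weight, Pi.pow_apply]
  push_cast
  linear_combination (1 / 4 : ℝ) * this

theorem hasDerivAt_weightInt2 (x : ℝ) : HasDerivAt weightInt2 (weightInt x) x := by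
  have hs := hasDerivAt_sin_half x
  have hc := hasDerivAt_cos_half x
  have hx : HasDerivAt (fun x : ℝ => x / 2) (1 / 2) x := (hasDerivAt_id x).div_const 2
  have h := ((hx.const_sub (Real.pi / 2)).mul (hx.const_sub Real.pi)).sub ((hx.mul hs).mul hc)
  convert! h using 1
  have := Real.sin_sq_add_cos_sq (x / 2)
  simp only [weightInt, Pi.mul_apply]
  linear_combination (x / 4 : ℝ) * this

/-- An antiderivative of `weightInt2 (2 * ψ) * kernel ψ`. -/
noncomputable def kernelInt (ψ : ℝ) : ℝ :=
  ((Real.pi - ψ + Real.sin ψ * Real.cos ψ) / 2 + Real.pi / 2 * (1 / 2 - Real.sin ψ ^ 2)) /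
      ((Real.pi - ψ) * Real.cos ψ + Real.sin ψ) ^ 2 -
    Real.cos ψ / ((Real.pi - ψ) * Real.cos ψ + Real.sin ψ)

theorem hasDerivAt_kernelInt {ψ : ℝ} (h0 : 0 ≤ ψ) (h1 : ψ ≤ Real.pi / 2) :
    HasDerivAt kernelInt (weightInt2 (2 * ψ) * kernel ψ) ψ := by
  have hd := denominator_pos h0 h1
  have hs := Real.hasDerivAt_sin ψ
  have hc := Real.hasDerivAt_cos ψ
  have hu := (hasDerivAt_id ψ).const_sub Real.pi
  have hg := (hu.mul hc).add hs
  have h := (((((hu.add (hs.mul hc)).div_const 2).add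
    (((hs.pow 2).const_sub (1 / 2)).const_mul (Real.pi / 2))).div (hg.pow 2)
      (pow_pos hd 2).ne').sub (hc.div hg hd.ne'))
  convert! h using 1
  have hsc := Real.sin_sq_add_cos_sq ψ
  simp only [weightInt2, kernel, id, Pi.add_apply, Pi.mul_apply, Pi.pow_apply,
    mul_div_cancel_left₀ ψ (two_ne_zero' ℝ)]
  generalize Real.sin ψ = s at *
  have hc2 : Real.cos ψ ^ 2 = 1 - s ^ 2 := by linarith
  generalize Real.cos ψ = c at *
  push_cast
  field_simp
  clear h hg hs hc hu hd
  grind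

theorem integral_weight : ∫ x in (0 : ℝ)..Real.pi, weight x = 3 * Real.pi / 4 := by
  rw [intervalIntegral.integral_eq_sub_of_hasDerivAt (fun x _ => hasDerivAt_weightInt x)]
  · simp [weightInt]
    ring
  · refine Continuous.intervalIntegrable ?_ _ _
    unfold weight
    fun_prop

/-- Integration by parts, twice: since `f'' x = kernel (x / 2) / 2`, this reduces to the integral
of `kernel` times the second antiderivative of `weight`. -/
theorem integral_f_mul_weight :
    ∫ x in (0 : ℝ)..Real.pi, f x * weight x = 1 / (4 * Real.pi) := by
  have hπ := Real.pi_pos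
  have hw : Continuous weight := by unfold weight; fun_prop
  have hwi : Continuous weightInt := by unfold weightInt; fun_prop
  have hwi2 : Continuous weightInt2 := by unfold weightInt2; fun_prop
  have hk := continuousOn_integral_mul_kernel (g := fun _ => 1) continuous_const
  have hki : ContinuousOn (fun x => kernelInt (x / 2)) (Set.Icc 0 Real.pi) := fun x hx =>
    (ContinuousAt.comp (f := fun x : ℝ => x / 2) (g := kernelInt)
      (hasDerivAt_kernelInt (by linarith [hx.1]) (by linarith [hx.2])).continuousAt
      (by fun_prop)).continuousWithinAt
  rw [intervalIntegral.integral_eq_sub_of_hasDerivAt_of_le hπ.le (f := fun x =>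
    f x * weightInt x - (∫ ψ in (0 : ℝ)..x / 2, 1 * kernel ψ) * weightInt2 x + kernelInt (x / 2))
    (((continuousOn_f.mul hwi.continuousOn).sub (hk.mul hwi2.continuousOn)).add hki)]
  · have hf0 : f 0 = 0 := by simp [f]
    have h1 : weightInt Real.pi = 0 := by simp [weightInt]; ring
    have h2 : weightInt2 Real.pi = 0 := by simp [weightInt2]
    have h3 : kernelInt (Real.pi / 2) = 0 := by simp [kernelInt]; ring
    have h4 : kernelInt (0 / 2) = -(1 / (4 * Real.pi)) := by
      simp [kernelInt]; field_simp; ring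
    rw [hf0, h1, h2, h3, h4]
    simp
  · intro x hx
    have hx2 : HasDerivAt (fun x : ℝ => x / 2) (1 / 2) x := (hasDerivAt_id x).div_const 2
    have d0 := (hasDerivAt_integral_mul_kernel (g := fun _ => 1) continuous_const
      (y := x / 2) (by linarith [hx.1]) (by linarith [hx.2])).comp x hx2
    have d1 := (hasDerivAt_kernelInt (ψ := x / 2) (by linarith [hx.1])
      (by linarith [hx.2])).comp x hx2
    have d := (((hasDerivAt_f hx.1 hx.2).mul (hasDerivAt_weightInt x)).sub
      (d0.mul (hasDerivAt_weightInt2 x))).add d1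
    convert! d using 1
    simp only [Function.comp_apply, mul_div_cancel₀ x (two_ne_zero' ℝ)]
    ring_nf
  · exact (ContinuousOn.mul continuousOn_f hw.continuousOn).intervalIntegrable_of_Icc hπ.le

/-! ### The area on the space of triples of arcs -/

/-- The triangle of the first two components of the triples of arcs. -/
def arcTriangle : Set (ℝ × ℝ) :=
  {q | (0 < q.1 ∧ q.1 < Real.pi) ∧ (0 < q.2 ∧ q.2 < Real.pi) ∧ Real.pi < q.1 + q.2}

theorem isOpen_arcTriangle : IsOpen arcTriangle :=
  ((isOpen_lt continuous_const continuous_fst).inter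
    (isOpen_lt continuous_fst continuous_const)).inter
    (((isOpen_lt continuous_const continuous_snd).inter
    (isOpen_lt continuous_snd continuous_const)).inter
    (isOpen_lt continuous_const (continuous_fst.add continuous_snd)))

/-- The triple of arcs with given first two components. -/
noncomputable def arcsOf (q : arcTriangle) : ArcTriple :=
  ⟨![q.1.1, q.1.2, 2 * Real.pi - q.1.1 - q.1.2], by
    obtain ⟨⟨x, y⟩, h1, h2, h3⟩ := q
    simp only at h1 h2 h3
    refine ⟨fun i => ?_, by simp⟩
    fin_cases i
    · exact h1
    · exact h2
    · simp only [Fin.reduceFinMk, Matrix.cons_val]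
      constructor <;> linarith⟩

/-- The first two components of a triple of arcs. -/
def arcCoord (ϑ : ArcTriple) : ℝ × ℝ := (ϑ.1 0, ϑ.1 1)

theorem arcCoord_mem (ϑ : ArcTriple) : arcCoord ϑ ∈ arcTriangle := by
  have h2 := ϑ.2.1 2
  have := ϑ.2.2
  exact ⟨ϑ.2.1 0, ϑ.2.1 1, by simp only [arcCoord]; linarith⟩

theorem arcsOf_arcCoord (ϑ : ArcTriple) : arcsOf ⟨arcCoord ϑ, arcCoord_mem ϑ⟩ = ϑ := by
  have := ϑ.2.2
  ext i
  fin_cases i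
  · rfl
  · rfl
  · simp [arcsOf, arcCoord]
    linarith

theorem continuous_arcsOf : Continuous arcsOf := by
  refine Continuous.subtype_mk (continuous_pi fun i => ?_) _
  fin_cases i <;> simp <;> fun_prop

theorem continuous_arc (i : Fin 3) : Continuous fun ϑ : ArcTriple => ϑ.1 i :=
  (continuous_apply i).comp continuous_subtype_val

theorem continuous_arcCoord : Continuous arcCoord :=
  (continuous_arc 0).prodMk (continuous_arc 1)

theorem range_arcCoord : Set.range arcCoord = arcTriangle := by
  refine Set.Subset.antisymm (Set.range_subset_iff.2 arcCoord_mem) fun q hq => ?_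
  exact ⟨arcsOf ⟨q, hq⟩, rfl⟩

theorem measurableEmbedding_arcCoord : MeasurableEmbedding arcCoord := by
  refine MeasurableEmbedding.of_measurable_inverse_on_range (g := fun q : Set.range arcCoord =>
    arcsOf ⟨q.1, range_arcCoord ▸ q.2⟩) continuous_arcCoord.measurable
    (range_arcCoord ▸ isOpen_arcTriangle.measurableSet) ?_ fun ϑ => arcsOf_arcCoord ϑ
  exact (continuous_arcsOf.comp (by fun_prop)).measurable

theorem map_arcCoord : Measure.map arcCoord arcArea = volume.restrict arcTriangle := by
  rw [← range_arcCoord]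
  exact measurableEmbedding_arcCoord.map_comap _

theorem lintegral_arcArea (F : ℝ × ℝ → ENNReal) :
    ∫⁻ ϑ, F (arcCoord ϑ) ∂arcArea = ∫⁻ q in arcTriangle, F q := by
  rw [← map_arcCoord, measurableEmbedding_arcCoord.lintegral_map]

/-- The cyclic shift of the triples of arcs. -/
def shiftArcs (ϑ : ArcTriple) : ArcTriple :=
  ⟨fun i => ϑ.1 (i + 1), fun i => ϑ.2.1 (i + 1), by
    have := ϑ.2.2
    change ϑ.1 1 + ϑ.1 2 + ϑ.1 0 = _
    linarith⟩

theorem measurePreserving_shift :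
    MeasurePreserving (fun q : ℝ × ℝ => (q.2, 2 * Real.pi - q.1 - q.2)) := by
  have h1 : MeasurePreserving (Prod.swap : ℝ × ℝ → ℝ × ℝ) (volume.prod volume)
    (volume.prod volume) := Measure.measurePreserving_swap
  have h2 : MeasurePreserving (fun q : ℝ × ℝ => (id q.1, (2 * Real.pi - q.1) - q.2))
      (volume.prod volume) (volume.prod volume) :=
    (MeasurePreserving.id volume).skew_product (g := fun y x => (2 * Real.pi - y) - x)
      (by fun_prop) (Eventually.of_forall fun y =>
        (Measure.measurePreserving_sub_left volume (2 * Real.pi - y)).map_eq)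
  rw [Measure.volume_eq_prod]
  convert! h2.comp h1 using 1
  ext q
  · rfl
  · simp only [Function.comp_apply, Prod.fst_swap, Prod.snd_swap]
    ring

theorem lintegral_shiftArcs {F : ArcTriple → ENNReal} :
    ∫⁻ ϑ, F (shiftArcs ϑ) ∂arcArea = ∫⁻ ϑ, F ϑ ∂arcArea := by
  classical
  set G : ℝ × ℝ → ENNReal := fun q => if h : q ∈ arcTriangle then F (arcsOf ⟨q, h⟩) else 0 with hG
  have hGF : ∀ ϑ, G (arcCoord ϑ) = F ϑ := fun ϑ => by
    simp only [hG, arcCoord_mem, dif_pos, arcsOf_arcCoord]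
  have hshift : ∀ ϑ, arcCoord (shiftArcs ϑ) =
      (fun q : ℝ × ℝ => (q.2, 2 * Real.pi - q.1 - q.2)) (arcCoord ϑ) := fun ϑ => by
    have := ϑ.2.2
    simp only [arcCoord, shiftArcs, Prod.mk.injEq]
    exact ⟨rfl, by change ϑ.1 2 = _; linarith⟩
  simp only [← hGF, hshift]
  rw [lintegral_arcArea (fun q => G (q.2, 2 * Real.pi - q.1 - q.2)), lintegral_arcArea,
    ← lintegral_indicator isOpen_arcTriangle.measurableSet,
    ← lintegral_indicator isOpen_arcTriangle.measurableSet]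
  have hemb : MeasurableEmbedding (fun q : ℝ × ℝ => (q.2, 2 * Real.pi - q.1 - q.2)) := by
    refine Continuous.measurableEmbedding (by fun_prop) fun p q h => ?_
    simp only [Prod.mk.injEq] at h
    ext <;> linarith [h.1, h.2]
  rw [← measurePreserving_shift.lintegral_comp_emb hemb (arcTriangle.indicator G)]
  refine lintegral_congr fun q => ?_
  have hiff : q ∈ arcTriangle ↔ ((q.2, 2 * Real.pi - q.1 - q.2) : ℝ × ℝ) ∈ arcTriangle := by
    simp only [arcTriangle, Set.mem_ofPred_eq]
    constructor <;> rintro ⟨h1, h2, h3⟩ <;> refine ⟨⟨?_, ?_⟩, ⟨?_, ?_⟩, ?_⟩ <;> linarith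
  by_cases h : q ∈ arcTriangle
  · rw [Set.indicator_of_mem h, Set.indicator_of_mem (hiff.1 h)]
  · rw [Set.indicator_of_notMem h, Set.indicator_of_notMem (mt hiff.2 h)]

/-- By cyclic symmetry, all three arcs play the same role in an integral. -/
theorem lintegral_apply_arc (F : ArcTriple → ℝ → ENNReal)
    (hF : ∀ ϑ x, F (shiftArcs ϑ) x = F ϑ x) (i : Fin 3) :
    ∫⁻ ϑ, F ϑ (ϑ.1 i) ∂arcArea = ∫⁻ ϑ, F ϑ (ϑ.1 0) ∂arcArea := by
  have key : ∀ i : Fin 3, ∫⁻ ϑ, F ϑ (ϑ.1 (i + 1)) ∂arcArea = ∫⁻ ϑ, F ϑ (ϑ.1 i) ∂arcArea := by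
    intro i
    rw [← lintegral_shiftArcs (F := fun ϑ => F ϑ (ϑ.1 i))]
    simp only [hF]
    rfl
  fin_cases i
  · rfl
  · exact key 0
  · exact (key 1).trans (key 0)

theorem shiftArcs_equiv (ϑ : ArcTriple) : ϑ ≈ shiftArcs ϑ := ⟨1, fun _ => rfl⟩

theorem continuous_arcDensity : Continuous arcDensity := by
  unfold arcDensity
  refine (continuous_const.mul (continuous_finsetProd _ fun i _ => ?_)).mul
    (continuous_const.add (continuous_finsetSum _ fun i _ => ?_))
  · exact Real.continuous_sin.comp ((continuous_arc i).div_const 2)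
  · exact continuousOn_f.comp_continuous (continuous_arc i) fun ϑ =>
      ⟨(ϑ.2.1 i).1.le, (ϑ.2.1 i).2.le⟩

theorem integral_sin_mul_sin {x : ℝ} :
    ∫ y in (Real.pi - x)..Real.pi, Real.sin (y / 2) * Real.sin ((2 * Real.pi - x - y) / 2) =
      Real.sin (x / 2) + x / 2 * Real.cos (x / 2) := by
  have h : ∀ y ∈ Set.uIcc (Real.pi - x) Real.pi, HasDerivAt
      (fun y => y / 2 * Real.cos (x / 2) - Real.sin (y + x / 2) / 2)
      (Real.sin (y / 2) * Real.sin ((2 * Real.pi - x - y) / 2)) y := by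
    intro y _
    have h1 : HasDerivAt (fun y : ℝ => y / 2 * Real.cos (x / 2)) (1 / 2 * Real.cos (x / 2)) y :=
      ((hasDerivAt_id y).div_const 2).mul_const _
    have h2 : HasDerivAt (fun y : ℝ => Real.sin (y + x / 2) / 2)
        (Real.cos (y + x / 2) * 1 / 2) y :=
      ((Real.hasDerivAt_sin _).comp y ((hasDerivAt_id y).add_const _)).div_const 2
    convert! h1.sub h2 using 1
    rw [show (2 * Real.pi - x - y) / 2 = Real.pi - (x / 2 + y / 2) by ring, Real.sin_pi_sub,
      show y + x / 2 = y / 2 + (x / 2 + y / 2) by ring, Real.cos_add (y / 2)]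
    have h3 : Real.cos (x / 2) = Real.cos (x / 2 + y / 2) * Real.cos (y / 2) +
        Real.sin (x / 2 + y / 2) * Real.sin (y / 2) := by
      rw [← Real.cos_sub, add_sub_cancel_right]
    rw [h3]
    ring
  rw [intervalIntegral.integral_eq_sub_of_hasDerivAt h]
  · rw [show Real.pi - x + x / 2 = Real.pi - x / 2 by ring, Real.sin_pi_sub, add_comm Real.pi,
      Real.sin_add_pi]
    ring
  · refine Continuous.intervalIntegrable ?_ _ _
    fun_prop

theorem lintegral_arcDensity : ∫⁻ ϑ, ENNReal.ofReal (arcDensity ϑ) ∂arcArea = 3 := by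
  have hπ := Real.pi_pos
  set F : ArcTriple → ℝ → ENNReal := fun ϑ x =>
    ENNReal.ofReal (∏ i, Real.sin (ϑ.1 i / 2)) *
      ENNReal.ofReal (2 * Real.pi * (1 / (3 * Real.pi ^ 2) + f x)) with hF
  have hf0 : ∀ (ϑ : ArcTriple) i, 0 ≤ f (ϑ.1 i) :=
    fun ϑ i => f_nonneg (ϑ.2.1 i).1.le (ϑ.2.1 i).2.le
  have hsum : ∀ ϑ, ENNReal.ofReal (arcDensity ϑ) = ∑ i, F ϑ (ϑ.1 i) := by
    intro ϑ
    simp only [hF]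
    rw [← Finset.mul_sum, ← ENNReal.ofReal_sum_of_nonneg fun i _ => by
      have := hf0 ϑ i; positivity, ← ENNReal.ofReal_mul (prod_sin_pos ϑ).le]
    congr 1
    rw [arcDensity, ← Finset.mul_sum, Finset.sum_add_distrib, Finset.sum_const]
    simp only [Finset.card_univ, Fintype.card_fin, nsmul_eq_mul]
    field_simp
    push_cast
    ring
  have hFs : ∀ ϑ x, F (shiftArcs ϑ) x = F ϑ x := by
    intro ϑ x
    simp only [hF]
    congr 2
    exact Equiv.prod_comp (Equiv.addRight (1 : Fin 3)) fun i => Real.sin (ϑ.1 i / 2)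
  have hmeas : ∀ i, Measurable fun ϑ : ArcTriple => F ϑ (ϑ.1 i) := by
    intro i
    have : Continuous fun ϑ : ArcTriple => f (ϑ.1 i) :=
      continuousOn_f.comp_continuous (continuous_arc i) fun ϑ =>
        ⟨(ϑ.2.1 i).1.le, (ϑ.2.1 i).2.le⟩
    exact (ENNReal.continuous_ofReal.comp
      (continuous_finsetProd _ fun i _ =>
        Real.continuous_sin.comp ((continuous_arc i).div_const 2))).measurable.mul
      (ENNReal.continuous_ofReal.comp (by fun_prop : Continuous fun ϑ : ArcTriple =>
        2 * Real.pi * (1 / (3 * Real.pi ^ 2) + f (ϑ.1 i)))).measurable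
  simp only [hsum]
  rw [lintegral_finsetSum _ fun i _ => hmeas i]
  simp only [lintegral_apply_arc F hFs]
  rw [Finset.sum_const, Finset.card_univ, Fintype.card_fin, nsmul_eq_mul]
  suffices h : ∫⁻ ϑ, F ϑ (ϑ.1 0) ∂arcArea = 1 by rw [h]; norm_num
  let G : ℝ × ℝ → ENNReal := fun q => ENNReal.ofReal (2 * Real.pi * (1 / (3 * Real.pi ^ 2) + f q.1))
    * ENNReal.ofReal (Real.sin (q.1 / 2) *
      (Real.sin (q.2 / 2) * Real.sin ((2 * Real.pi - q.1 - q.2) / 2)))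
  have hFG : ∀ ϑ, F ϑ (ϑ.1 0) = G (arcCoord ϑ) := by
    intro ϑ
    simp only [hF, G, arcCoord]
    have : ϑ.1 2 = 2 * Real.pi - ϑ.1 0 - ϑ.1 1 := by linarith [ϑ.2.2]
    rw [mul_comm, Fin.prod_univ_three, this, mul_assoc (Real.sin _)]
  have hGm : AEMeasurable (arcTriangle.indicator G) (volume.prod volume) := by
    rw [aemeasurable_indicator_iff isOpen_arcTriangle.measurableSet]
    have h1 : ContinuousOn (fun q : ℝ × ℝ => f q.1) arcTriangle :=
      continuousOn_f.comp continuousOn_fst fun q hq => ⟨hq.1.1.le, hq.1.2.le⟩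
    have h2 : ContinuousOn (fun q : ℝ × ℝ => 2 * Real.pi * (1 / (3 * Real.pi ^ 2) + f q.1))
        arcTriangle := by fun_prop
    have h3 : Continuous fun q : ℝ × ℝ => Real.sin (q.1 / 2) *
      (Real.sin (q.2 / 2) * Real.sin ((2 * Real.pi - q.1 - q.2) / 2)) := by fun_prop
    exact ((ENNReal.continuous_ofReal.comp_continuousOn h2).aemeasurable
      isOpen_arcTriangle.measurableSet).mul (ENNReal.continuous_ofReal.comp h3).aemeasurable
  have hinner : ∀ x : ℝ, ∫⁻ y, arcTriangle.indicator G (x, y) = (Set.Ioo 0 Real.pi).indicator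
      (fun x => ENNReal.ofReal (2 * Real.pi * (1 / (3 * Real.pi ^ 2) + f x) * weight x)) x := by
    intro x
    by_cases hx : x ∈ Set.Ioo 0 Real.pi
    · have hs : 0 ≤ Real.sin (x / 2) :=
        Real.sin_nonneg_of_nonneg_of_le_pi (by linarith [hx.1]) (by linarith [hx.2])
      have hfx := f_nonneg hx.1.le hx.2.le
      have hind : ∀ y, arcTriangle.indicator G (x, y) =
          (Set.Ioo (Real.pi - x) Real.pi).indicator (fun y => G (x, y)) y := by
        intro y
        have : (x, y) ∈ arcTriangle ↔ y ∈ Set.Ioo (Real.pi - x) Real.pi := by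
          simp only [arcTriangle, Set.mem_ofPred_eq, Set.mem_Ioo]
          constructor
          · rintro ⟨h1, h2, h3⟩
            exact ⟨by linarith, h2.2⟩
          · rintro ⟨h1, h2⟩
            exact ⟨hx, ⟨by linarith [hx.2], h2⟩, by linarith⟩
        by_cases h : (x, y) ∈ arcTriangle
        · rw [Set.indicator_of_mem h, Set.indicator_of_mem (this.1 h)]
        · rw [Set.indicator_of_notMem h, Set.indicator_of_notMem (mt this.2 h)]
      simp only [hind]
      have hcont : Continuous fun y =>
          Real.sin (y / 2) * Real.sin ((2 * Real.pi - x - y) / 2) := by fun_prop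
      rw [lintegral_indicator measurableSet_Ioo, Set.indicator_of_mem hx, weight]
      simp only [G]
      rw [lintegral_const_mul' _ _ ENNReal.ofReal_ne_top,
        ENNReal.ofReal_mul (p := 2 * Real.pi * _) (by positivity)]
      congr 1
      simp only [ENNReal.ofReal_mul hs]
      rw [lintegral_const_mul' _ _ ENNReal.ofReal_ne_top, ← integral_sin_mul_sin,
        intervalIntegral.integral_of_le (by linarith [hx.1]), setLIntegral_congr Ioo_ae_eq_Ioc,
        ofReal_integral_eq_lintegral_ofReal]
      · exact (hcont.intervalIntegrable (Real.pi - x) Real.pi).1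
      · refine (ae_restrict_iff' measurableSet_Ioc).2 (Eventually.of_forall fun y hy => ?_)
        exact mul_nonneg
          (Real.sin_nonneg_of_nonneg_of_le_pi (by linarith [hx.2, hy.1]) (by linarith [hy.2]))
          (Real.sin_nonneg_of_nonneg_of_le_pi (by linarith [hx.2, hy.2]) (by linarith [hy.1]))
    · rw [Set.indicator_of_notMem hx]
      have : ∀ y, arcTriangle.indicator G (x, y) = 0 :=
        fun y => Set.indicator_of_notMem (fun h => hx h.1) _
      simp [this]
  have hw : Continuous weight := by unfold weight; fun_prop
  have hi1 : IntervalIntegrable weight volume 0 Real.pi := hw.intervalIntegrable _ _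
  have hi2 : IntervalIntegrable (fun x => f x * weight x) volume 0 Real.pi :=
    (ContinuousOn.mul continuousOn_f hw.continuousOn).intervalIntegrable_of_Icc hπ.le
  have hi : IntervalIntegrable (fun x => 2 * Real.pi * (1 / (3 * Real.pi ^ 2) + f x) * weight x)
      volume 0 Real.pi := by
    refine ((hi1.const_mul (2 * Real.pi * (1 / (3 * Real.pi ^ 2)))).add
      (hi2.const_mul (2 * Real.pi))).congr fun x _ => ?_
    ring
  have hval : ∫ x in (0 : ℝ)..Real.pi, 2 * Real.pi * (1 / (3 * Real.pi ^ 2) + f x) * weight x =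
      1 := by
    have : ∀ x, 2 * Real.pi * (1 / (3 * Real.pi ^ 2) + f x) * weight x =
        2 * Real.pi * (1 / (3 * Real.pi ^ 2)) * weight x + 2 * Real.pi * (f x * weight x) :=
      fun x => by ring
    simp only [this]
    rw [intervalIntegral.integral_add (hi1.const_mul _) (hi2.const_mul _),
      intervalIntegral.integral_const_mul, intervalIntegral.integral_const_mul, integral_weight,
      integral_f_mul_weight]
    field_simp
    norm_num
  simp only [hFG]
  rw [lintegral_arcArea, ← lintegral_indicator isOpen_arcTriangle.measurableSet,
    Measure.volume_eq_prod, lintegral_prod _ hGm]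
  simp only [hinner]
  rw [lintegral_indicator measurableSet_Ioo, setLIntegral_congr Ioo_ae_eq_Ioc,
    ← ofReal_integral_eq_lintegral_ofReal, ← intervalIntegral.integral_of_le hπ.le, hval,
    ENNReal.ofReal_one]
  · exact (intervalIntegrable_iff_integrableOn_Ioc_of_le hπ.le).1 hi
  · refine (ae_restrict_iff' measurableSet_Ioc).2 (Eventually.of_forall fun x hx => ?_)
    have hs : 0 ≤ Real.sin (x / 2) :=
      Real.sin_nonneg_of_nonneg_of_le_pi (by linarith [hx.1]) (by linarith [hx.2])
    have hc : 0 ≤ Real.cos (x / 2) :=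
      Real.cos_nonneg_of_mem_Icc ⟨by linarith [hx.1], by linarith [hx.2]⟩
    have hfx := f_nonneg hx.1.le hx.2
    have hx0 := hx.1.le
    simp only [Pi.zero_apply, weight]
    positivity

/-! ### The density on the classes of triples of arcs -/

theorem measurable_mk : Measurable fun ϑ : ArcTriple => (⟦ϑ⟧ : ArcClass) :=
  measurable_quotient_mk'

theorem density_nonneg (q : ArcClass) : 0 ≤ density q := by
  induction q using Quotient.inductionOn
  exact arcDensity_nonneg _

theorem measurable_density : Measurable density :=
  measurable_from_quotient.2 continuous_arcDensity.measurable

theorem setLIntegral_density {B : Set ArcClass} (hB : MeasurableSet B) :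
    ∫⁻ q in B, ENNReal.ofReal (density q) ∂classArea =
      3⁻¹ * ∫⁻ ϑ in {ϑ : ArcTriple | (⟦ϑ⟧ : ArcClass) ∈ B}, ENNReal.ofReal (arcDensity ϑ)
        ∂arcArea := by
  have h : Measurable fun q => ENNReal.ofReal (density q) :=
    ENNReal.measurable_ofReal.comp measurable_density
  rw [classArea, Measure.restrict_smul, lintegral_smul_measure,
    setLIntegral_map hB h measurable_mk, ENNReal.smul_def, smul_eq_mul]
  congr 1
  simp

theorem lintegral_density : ∫⁻ q, ENNReal.ofReal (density q) ∂classArea = 1 := by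
  rw [← setLIntegral_univ, setLIntegral_density MeasurableSet.univ]
  simp only [Set.mem_univ, Set.ofPred_true, setLIntegral_univ, lintegral_arcDensity]
  exact ENNReal.inv_mul_cancel (by norm_num) (by norm_num)

theorem integrable_density : Integrable density classArea := by
  refine ⟨measurable_density.aestronglyMeasurable, ?_⟩
  rw [hasFiniteIntegral_iff_ofReal (Eventually.of_forall density_nonneg), lintegral_density]
  exact ENNReal.one_lt_top

theorem setIntegral_density (B : Set ArcClass) :
    ∫ q in B, density q ∂classArea =
      (∫⁻ q in B, ENNReal.ofReal (density q) ∂classArea).toReal :=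
  integral_eq_lintegral_of_nonneg_ae (Eventually.of_forall density_nonneg)
    measurable_density.aestronglyMeasurable

theorem integral_density : ∫ q, density q ∂classArea = 1 := by
  rw [← setIntegral_univ, setIntegral_density, setLIntegral_univ, lintegral_density,
    ENNReal.toReal_one]

/-- The mean of the three arcs is `2 π / 3`. -/
theorem lintegral_mul_arc {F : ArcTriple → ENNReal} (hF : ∀ ϑ, F (shiftArcs ϑ) = F ϑ)
    (hFm : Measurable F) :
    3 * ∫⁻ ϑ, F ϑ * ENNReal.ofReal (ϑ.1 1) ∂arcArea =
      ENNReal.ofReal (2 * Real.pi) * ∫⁻ ϑ, F ϑ ∂arcArea := by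
  have hF' : ∀ ϑ x, F (shiftArcs ϑ) * ENNReal.ofReal x = F ϑ * ENNReal.ofReal x :=
    fun ϑ x => by rw [hF]
  have hm : ∀ i, Measurable fun ϑ : ArcTriple => F ϑ * ENNReal.ofReal (ϑ.1 i) := fun i =>
    hFm.mul (ENNReal.measurable_ofReal.comp (continuous_arc i).measurable)
  have hsum : ∀ ϑ : ArcTriple, ENNReal.ofReal (2 * Real.pi) * F ϑ =
      ∑ i, F ϑ * ENNReal.ofReal (ϑ.1 i) := fun ϑ => by
    rw [← Finset.mul_sum, ← ENNReal.ofReal_sum_of_nonneg fun i _ => (ϑ.2.1 i).1.le,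
      Fin.sum_univ_three, ϑ.2.2, mul_comm]
  rw [← lintegral_const_mul' _ _ ENNReal.ofReal_ne_top]
  simp only [hsum]
  rw [lintegral_finsetSum _ fun i _ => hm i]
  simp only [lintegral_apply_arc (fun ϑ x => F ϑ * ENNReal.ofReal x) hF']
  rw [Finset.sum_const, Finset.card_univ, Fintype.card_fin, nsmul_eq_mul]
  rfl

/-! ### Ordered triples of angles -/

/-- The first two arcs between the angles `u 0 < u 1 < u 2 < u 0 + 2 π`. -/
noncomputable def gaps (u : Fin 3 → ℝ) : ℝ × ℝ := (u 2 - u 1, 2 * Real.pi - u 2 + u 0)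

theorem continuous_gaps : Continuous gaps := by
  unfold gaps
  fun_prop

theorem hasArcs_of_gaps {u : Fin 3 → ℝ} {ϑ : ArcTriple} (h : arcCoord ϑ = gaps u) :
    HasArcs (fun i => (u i : Real.Angle)) ϑ := by
  have h0 : ϑ.1 0 = u 2 - u 1 := congrArg Prod.fst h
  have h1 : ϑ.1 1 = 2 * Real.pi - u 2 + u 0 := congrArg Prod.snd h
  have h2 : ϑ.1 2 = u 1 - u 0 := by linarith [ϑ.2.2]
  intro i
  fin_cases i
  · change (u 1 : Real.Angle) - u 0 = (ϑ.1 2 : ℝ)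
    rw [h2, Real.Angle.coe_sub]
  · change (u 2 : Real.Angle) - u 1 = (ϑ.1 0 : ℝ)
    rw [h0, Real.Angle.coe_sub]
  · change (u 0 : Real.Angle) - u 2 = (ϑ.1 1 : ℝ)
    rw [h1, Real.Angle.coe_add, Real.Angle.coe_sub, Real.Angle.coe_two_pi]
    abel

theorem measurePreserving_gaps :
    MeasurePreserving (fun u : Fin 3 → ℝ => (u 2, gaps u)) := by
  have hp := volume_preserving_piFinSuccAbove (fun _ : Fin 3 => ℝ) 2
  have hq := (MeasurePreserving.id (volume : Measure ℝ)).prod (volume_preserving_finTwoArrow ℝ)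
  have h1 : ∀ z : ℝ, MeasurePreserving (fun p : ℝ × ℝ => (z - p.2, 2 * Real.pi - z + p.1))
      (volume.prod volume) (volume.prod volume) := fun z =>
    ((Measure.measurePreserving_sub_left volume z).prod
      (measurePreserving_add_left volume (2 * Real.pi - z))).comp Measure.measurePreserving_swap
  have h2 : MeasurePreserving (fun p : ℝ × ℝ × ℝ =>
      (id p.1, (p.1 - p.2.2, 2 * Real.pi - p.1 + p.2.1)))
      (volume.prod (volume.prod volume)) (volume.prod (volume.prod volume)) :=
    (MeasurePreserving.id volume).skew_product
      (g := fun z (p : ℝ × ℝ) => (z - p.2, 2 * Real.pi - z + p.1)) (by fun_prop)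
      (Eventually.of_forall fun z => (h1 z).map_eq)
  exact h2.comp (hq.comp hp)

theorem lintegral_gaps {K : ℝ × ℝ → ENNReal} (hK : Measurable K) :
    ∫⁻ u : Fin 3 → ℝ, {u : Fin 3 → ℝ | 0 < u 0 ∧ u 2 < 2 * Real.pi}.indicator
      (fun u => K (gaps u)) u = ∫⁻ q, K q * ENNReal.ofReal q.2 := by
  set A : Set (ℝ × ℝ × ℝ) := {p | 2 * Real.pi - p.2.2 < p.1 ∧ p.1 < 2 * Real.pi} with hA
  have hAm : MeasurableSet A :=
    MeasurableSet.inter (s₁ := {p : ℝ × ℝ × ℝ | 2 * Real.pi - p.2.2 < p.1})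
      (s₂ := {p : ℝ × ℝ × ℝ | p.1 < 2 * Real.pi})
      (measurableSet_lt (by fun_prop) (by fun_prop)) (measurableSet_lt (by fun_prop) (by fun_prop))
  have hm : Measurable (A.indicator fun p : ℝ × ℝ × ℝ => K p.2) :=
    (hK.comp measurable_snd).indicator hAm
  have h1 := measurePreserving_gaps.lintegral_comp hm
  have h2 : ∀ u : Fin 3 → ℝ, {u : Fin 3 → ℝ | 0 < u 0 ∧ u 2 < 2 * Real.pi}.indicator
      (fun u => K (gaps u)) u = A.indicator (fun p : ℝ × ℝ × ℝ => K p.2) (u 2, gaps u) := by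
    intro u
    have : u ∈ {u : Fin 3 → ℝ | 0 < u 0 ∧ u 2 < 2 * Real.pi} ↔ (u 2, gaps u) ∈ A := by
      simp only [hA, gaps, Set.mem_ofPred_eq]
      constructor <;> rintro ⟨h, h'⟩ <;> constructor <;> linarith
    by_cases h : u ∈ {u : Fin 3 → ℝ | 0 < u 0 ∧ u 2 < 2 * Real.pi}
    · rw [Set.indicator_of_mem h, Set.indicator_of_mem (this.1 h)]
    · rw [Set.indicator_of_notMem h, Set.indicator_of_notMem (mt this.2 h)]
  simp only [h2]
  rw [h1, Measure.volume_eq_prod, lintegral_prod_symm _ hm.aemeasurable]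
  refine lintegral_congr fun q => ?_
  have h3 : ∀ z : ℝ, A.indicator (fun p : ℝ × ℝ × ℝ => K p.2) (z, q) =
      (Set.Ioo (2 * Real.pi - q.2) (2 * Real.pi)).indicator (fun _ => K q) z := fun z => rfl
  simp only [h3]
  rw [lintegral_indicator_const measurableSet_Ioo, Real.volume_Ioo, sub_sub_cancel]

/-- Integration over ordered triples of angles reduces to integration over triples of arcs: the
triples of angles in `(0, 2 π)` with given arcs form an interval of length `ϑ 1`. -/
theorem lintegral_extend_gaps {F : ArcTriple → ENNReal} (hF : ∀ ϑ, F (shiftArcs ϑ) = F ϑ)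
    (hFm : Measurable F) :
    3 * ∫⁻ u : Fin 3 → ℝ, {u : Fin 3 → ℝ | 0 < u 0 ∧ u 2 < 2 * Real.pi}.indicator
      (fun u => Function.extend arcCoord F 0 (gaps u)) u =
    ENNReal.ofReal (2 * Real.pi) * ∫⁻ ϑ, F ϑ ∂arcArea := by
  have hinj := measurableEmbedding_arcCoord.injective
  have hext : Measurable (Function.extend arcCoord F 0) :=
    measurableEmbedding_arcCoord.measurable_extend hFm measurable_const
  rw [lintegral_gaps hext, ← lintegral_mul_arc hF hFm]
  congr 1
  have h1 : ∀ ϑ : ArcTriple, F ϑ * ENNReal.ofReal (ϑ.1 1) =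
      (fun q : ℝ × ℝ => Function.extend arcCoord F 0 q * ENNReal.ofReal q.2) (arcCoord ϑ) := by
    intro ϑ
    simp only [hinj.extend_apply]
    rfl
  simp only [h1]
  rw [lintegral_arcArea (fun q : ℝ × ℝ => Function.extend arcCoord F 0 q * ENNReal.ofReal q.2),
    ← lintegral_indicator isOpen_arcTriangle.measurableSet]
  refine lintegral_congr fun q => ?_
  by_cases hq : q ∈ arcTriangle
  · rw [Set.indicator_of_mem hq]
  · rw [Set.indicator_of_notMem hq, Function.extend_apply' _ _ _ (by
      rintro ⟨ϑ, rfl⟩; exact hq (arcCoord_mem ϑ)), Pi.zero_apply, zero_mul]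

/-- The class of the triple of arcs is determined by the set of the three points. -/
theorem arcClass_eq_of_range_subset {φ φ' : Fin 3 → Real.Angle} {ϑ ϑ' : ArcTriple}
    (h : HasArcs φ ϑ) (h' : HasArcs φ' ϑ') (hr : Set.range φ' ⊆ Set.range φ) :
    (⟦ϑ⟧ : ArcClass) = ⟦ϑ'⟧ := by
  choose σ hσ using fun i => hr ⟨i, rfl⟩
  have key : ∀ σ : Fin 3 → Fin 3, (∃ k, ∀ i, σ i = i + k) ∨
      ∃ i, σ (i + 1) = σ i ∨ σ (i + 1) = σ i - 1 := by decide
  rcases key σ with ⟨k, hk⟩ | ⟨i, hi | hi⟩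
  · refine Quotient.sound ⟨k, fun i => ?_⟩
    have e1 := h' (i + 1)
    have e2 := h (i + 1 + k)
    rw [← hσ, ← hσ, hk, hk, add_right_comm (i + 1) 1 k, e2,
      add_sub_cancel_right, add_right_comm i 1 k, add_sub_cancel_right] at e1
    have a1 := ϑ.2.1 (i + k)
    have a2 := ϑ'.2.1 i
    have e3 := congrArg Real.Angle.toReal e1
    rw [Real.Angle.toReal_coe_eq_self_iff.2 ⟨by linarith, a1.2.le⟩,
      Real.Angle.toReal_coe_eq_self_iff.2 ⟨by linarith, a2.2.le⟩] at e3
    exact e3.symm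
  · have := h'.sin_pos i
    rw [← hσ, ← hσ, hi, sub_self, Real.Angle.sin_zero] at this
    exact absurd this (lt_irrefl _)
  · have h1 := h'.sin_pos i
    have h2 := h.sin_pos (σ i - 1)
    rw [← hσ, ← hσ, hi, ← neg_sub, Real.Angle.sin_neg] at h1
    rw [sub_add_cancel] at h2
    linarith

/-! ### Convergence of the law of the class of arcs -/

/-- The teeth `n` have arcs whose class belongs to `B`. -/
def ArcsIn (B : Set ArcClass) {N : ℕ} (n : Fin 3 → Fin N) : Prop :=
  ∃ ϑ : ArcTriple, HasArcs (fun i => toothAngle N (n i)) ϑ ∧ (⟦ϑ⟧ : ArcClass) ∈ B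

/-- The event that the hoop is supported by teeth whose class of arcs belongs to `B`. -/
def supportEvent (N : ℕ) (B : Set ArcClass) : Set (Fin N → ℝ) :=
  {ξ | ∃ n : Fin 3 → Fin N, IsSupportedBy ξ n ∧ ArcsIn B n}

theorem supportEvent_eq (N : ℕ) (B : Set ArcClass) :
    supportEvent N B = {ξ | ∃ (n : Fin 3 → Fin N) (ϑ : ArcTriple), IsSupportedBy ξ n ∧
      HasArcs (fun i => toothAngle N (n i)) ϑ ∧ (⟦ϑ⟧ : ArcClass) ∈ B} := by
  ext ξ
  exact ⟨fun ⟨n, h, ϑ, h'⟩ => ⟨n, ϑ, h, h'⟩, fun ⟨n, ϑ, h, h'⟩ => ⟨n, h, ϑ, h'⟩⟩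

theorem measurableSet_supportEvent (N : ℕ) (B : Set ArcClass) :
    MeasurableSet (supportEvent N B) := by
  have : supportEvent N B =
      ⋃ n ∈ {n : Fin 3 → Fin N | ArcsIn B n}, {ξ | IsSupportedBy ξ n} := by
    ext ξ
    simp only [supportEvent, Set.mem_ofPred_eq, Set.mem_iUnion, exists_prop]
    exact exists_congr fun n => and_comm
  rw [this]
  exact MeasurableSet.biUnion (Set.to_countable _) fun n _ => measurableSet_isSupportedBy n

theorem supportEvent_add_compl_le_one (N : ℕ) (B : Set ArcClass) :
    combMeasure N (supportEvent N B) + combMeasure N (supportEvent N Bᶜ) ≤ 1 := by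
  have hdisj : AEDisjoint (combMeasure N) (supportEvent N B) (supportEvent N Bᶜ) := by
    have h := ae_range_eq N
    rw [ae_iff] at h
    refine measure_mono_null (fun ξ hξ => ?_) h
    obtain ⟨⟨n, hn, ϑ, hϑ, hB⟩, ⟨m, hm, ϑ', hϑ', hB'⟩⟩ := hξ
    intro hall
    refine hB' ?_
    rw [← arcClass_eq_of_range_subset hϑ hϑ' ?_]
    · exact hB
    · have hr := hall n m hn hm
      rintro _ ⟨i, rfl⟩
      obtain ⟨k, hk⟩ : m i ∈ Set.range n := hr ▸ ⟨i, rfl⟩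
      exact ⟨k, by simp only [hk]⟩
  rw [← measure_union₀ (measurableSet_supportEvent N Bᶜ).nullMeasurableSet hdisj]
  exact prob_le_one

open scoped Classical in
/-- The increasing triples of teeth with class of arcs in `B`: one representative of each unordered
triple. -/
noncomputable def increasingTriples (N : ℕ) (B : Set ArcClass) : Finset (Fin 3 → Fin N) :=
  Finset.univ.filter fun n => StrictMono n ∧ ArcsIn B n

theorem sum_increasingTriples_le (N : ℕ) (B : Set ArcClass) :
    ∑ n ∈ increasingTriples N B, combMeasure N {ξ | IsSupportedBy ξ n} ≤
      combMeasure N (supportEvent N B) := by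
  rw [← measure_biUnion_finset₀]
  · refine measure_mono fun ξ hξ => ?_
    simp only [Set.mem_iUnion, increasingTriples, Finset.mem_filter, Finset.mem_univ,
      true_and] at hξ
    obtain ⟨n, ⟨-, hn⟩, hξ⟩ := hξ
    exact ⟨n, hξ, hn⟩
  · intro n hn m hm hne
    have h := ae_range_eq N
    rw [ae_iff] at h
    refine measure_mono_null (fun ξ hξ => ?_) h
    intro hall
    simp only [increasingTriples, Finset.coe_filter, Finset.mem_univ, true_and] at hn hm
    exact hne ((StrictMono.range_inj hn.1 hm.1).1 (hall n m hξ.1 hξ.2))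
  · exact fun n _ => (measurableSet_isSupportedBy n).nullMeasurableSet

/-- The cube of triples of angles that are rounded up to the angles of the teeth `n`. -/
def cell {N : ℕ} (n : Fin 3 → Fin N) : Set (Fin 3 → ℝ) :=
  Set.univ.pi fun i => Set.Ioc (2 * Real.pi * (n i : ℝ) / N) (2 * Real.pi * ((n i : ℝ) + 1) / N)

theorem measurableSet_cell {N : ℕ} (n : Fin 3 → Fin N) : MeasurableSet (cell n) :=
  MeasurableSet.univ_pi fun _ => measurableSet_Ioc

theorem volume_cell {N : ℕ} (n : Fin 3 → Fin N) :
    volume (cell n) = ENNReal.ofReal ((2 * Real.pi / N) ^ 3) := by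
  have hπ := Real.pi_pos
  rw [cell, volume_pi_pi, Fin.prod_univ_three]
  simp only [Real.volume_Ioc]
  rw [← ENNReal.ofReal_mul, ← ENNReal.ofReal_mul]
  · congr 1
    ring
  all_goals
    ring_nf
    positivity

theorem exists_mem_cell {N : ℕ} (hN : 0 < N) {u : Fin 3 → ℝ}
    (hu : ∀ i, 0 < u i ∧ u i ≤ 2 * Real.pi) : ∃ n : Fin 3 → Fin N, u ∈ cell n := by
  have hπ := Real.pi_pos
  have hN' : (0 : ℝ) < N := by exact_mod_cast hN
  have h : ∀ i, ∃ k : Fin N, u i ∈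
      Set.Ioc (2 * Real.pi * (k : ℝ) / N) (2 * Real.pi * ((k : ℝ) + 1) / N) := by
    intro i
    set c : ℕ := ⌈N * u i / (2 * Real.pi)⌉₊ with hc
    have hpos : 0 < N * u i / (2 * Real.pi) := by have := (hu i).1; positivity
    have hc0 : 0 < c := Nat.ceil_pos.2 hpos
    have hcN : c ≤ N := by
      refine Nat.ceil_le.2 ?_
      rw [div_le_iff₀ (by positivity)]
      exact mul_le_mul_of_nonneg_left (hu i).2 hN'.le
    have h1 : N * u i / (2 * Real.pi) ≤ c := Nat.le_ceil _
    have h2 : (c : ℝ) < N * u i / (2 * Real.pi) + 1 := Nat.ceil_lt_add_one hpos.le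
    have hcast : ((c - 1 : ℕ) : ℝ) = c - 1 := by
      rw [Nat.cast_sub hc0, Nat.cast_one]
    refine ⟨⟨c - 1, by omega⟩, ?_, ?_⟩
    · simp only [hcast]
      rw [div_lt_iff₀ hN']
      have : (c : ℝ) - 1 < N * u i / (2 * Real.pi) := by linarith
      rw [lt_div_iff₀ (by positivity)] at this
      linarith
    · simp only [hcast]
      rw [le_div_iff₀ hN']
      rw [div_le_iff₀ (by positivity)] at h1
      linarith
  choose n hn using h
  exact ⟨n, fun i _ => hn i⟩

/-- The density of the increasing support triple with class of arcs in `B`, where each tooth is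
spread uniformly over an interval. -/
noncomputable def cellDensity (N : ℕ) (B : Set ArcClass) (u : Fin 3 → ℝ) : ENNReal :=
  ∑ n ∈ increasingTriples N B, (cell n).indicator (fun _ =>
    ENNReal.ofReal (((N : ℝ) / (2 * Real.pi)) ^ 3) * combMeasure N {ξ | IsSupportedBy ξ n}) u

theorem measurable_cellDensity (N : ℕ) (B : Set ArcClass) : Measurable (cellDensity N B) :=
  Finset.measurable_fun_sum _ fun n _ => measurable_const.indicator (measurableSet_cell n)

theorem lintegral_cellDensity_le {N : ℕ} (hN : 0 < N) (B : Set ArcClass) :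
    ∫⁻ u, cellDensity N B u ≤ combMeasure N (supportEvent N B) := by
  have hπ := Real.pi_pos
  have hN' : (0 : ℝ) < N := by exact_mod_cast hN
  refine le_of_eq_of_le ?_ (sum_increasingTriples_le N B)
  simp only [cellDensity]
  rw [lintegral_finsetSum _ fun n _ => measurable_const.indicator (measurableSet_cell n)]
  refine Finset.sum_congr rfl fun n _ => ?_
  rw [lintegral_indicator_const (measurableSet_cell n), volume_cell, mul_right_comm,
    ← ENNReal.ofReal_mul (by positivity), ← mul_pow]
  rw [show (N : ℝ) / (2 * Real.pi) * (2 * Real.pi / N) = 1 by field_simp]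
  simp

/-- The limit density on ordered triples of angles, as a lower bound of the densities of the
support triples. The set of classes is open, so that it contains the classes of all triples of teeth
close to the given one. -/
theorem le_liminf_cellDensity {B U : Set ArcClass} (hU : IsOpen U) (hUB : U ⊆ B) {u : Fin 3 → ℝ}
    (h0 : 0 < u 0) (h2 : u 2 < 2 * Real.pi) {ϑ : ArcTriple} (hu : arcCoord ϑ = gaps u)
    (hϑ : (⟦ϑ⟧ : ArcClass) ∈ U) :
    ENNReal.ofReal (arcDensity ϑ / (2 * Real.pi)) ≤
      liminf (fun k => cellDensity (k + 1) B u) atTop := by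
  have hπ := Real.pi_pos
  have e0 : ϑ.1 0 = u 2 - u 1 := congrArg Prod.fst hu
  have e1 : ϑ.1 1 = 2 * Real.pi - u 2 + u 0 := congrArg Prod.snd hu
  have h01 : u 0 < u 1 := by linarith [ϑ.2.2, (ϑ.2.1 2).1]
  have h12 : u 1 < u 2 := by linarith [(ϑ.2.1 0).1]
  have hu' : ∀ i, 0 < u i ∧ u i ≤ 2 * Real.pi := by
    intro i
    fin_cases i <;> simp <;> constructor <;> linarith
  choose n hn using fun k : ℕ => exists_mem_cell (Nat.succ_pos k) hu'
  -- the angles of the teeth as real numbers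
  set v : ℕ → Fin 3 → ℝ := fun k i => 2 * Real.pi * ((n k i : ℝ) + 1) / ((k + 1 : ℕ) : ℝ) with hv
  have hvlim : Tendsto v atTop (𝓝 u) := by
    refine tendsto_pi_nhds.2 fun i => ?_
    have hz : Tendsto (fun k : ℕ => u i + 2 * Real.pi / ((k + 1 : ℕ) : ℝ)) atTop (𝓝 (u i)) := by
      have : Tendsto (fun k : ℕ => 2 * Real.pi / ((k + 1 : ℕ) : ℝ)) atTop (𝓝 0) :=
        tendsto_const_nhds.div_atTop
          (tendsto_natCast_atTop_atTop.comp (tendsto_add_atTop_nat 1))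
      simpa using this.const_add (u i)
    refine tendsto_of_tendsto_of_tendsto_of_le_of_le tendsto_const_nhds hz ?_ ?_
    · exact fun k => (hn k i trivial).2
    · intro k
      have := (hn k i trivial).1
      simp only [hv]
      have hsplit : 2 * Real.pi * ((n k i : ℝ) + 1) / ((k + 1 : ℕ) : ℝ) =
          2 * Real.pi * (n k i : ℝ) / ((k + 1 : ℕ) : ℝ) + 2 * Real.pi / ((k + 1 : ℕ) : ℝ) := by
        ring
      rw [hsplit]
      simp only [Nat.succ_eq_add_one] at this
      linarith
  have hangle : ∀ i, Tendsto (fun k => toothAngle (k + 1) (n k i)) atTop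
      (𝓝 (u i : Real.Angle)) := fun i =>
    (Real.Angle.continuous_coe.tendsto _).comp (tendsto_pi_nhds.1 hvlim i)
  have hlim := tendsto_density (hasArcs_of_gaps hu) (N := fun k => k + 1)
    (tendsto_add_atTop_nat 1) hangle
  have hlim' := (ENNReal.continuous_ofReal.tendsto _).comp hlim
  have hdens : density ⟦ϑ⟧ = arcDensity ϑ := rfl
  rw [hdens] at hlim'
  rw [← hlim'.liminf_eq]
  refine liminf_le_liminf ?_
  have hopen : IsOpen (arcCoord '' {ϑ : ArcTriple | (⟦ϑ⟧ : ArcClass) ∈ U}) := by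
    have hpre : IsOpen (arcsOf ⁻¹' {ϑ : ArcTriple | (⟦ϑ⟧ : ArcClass) ∈ U}) :=
      (hU.preimage continuous_quotient_mk').preimage continuous_arcsOf
    have himage : arcCoord '' {ϑ : ArcTriple | (⟦ϑ⟧ : ArcClass) ∈ U} =
        Subtype.val '' (arcsOf ⁻¹' {ϑ : ArcTriple | (⟦ϑ⟧ : ArcClass) ∈ U}) := by
      ext q
      constructor
      · rintro ⟨ϑ, hϑ, rfl⟩
        refine ⟨⟨_, arcCoord_mem ϑ⟩, ?_, rfl⟩
        rw [Set.mem_preimage, arcsOf_arcCoord]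
        exact hϑ
      · rintro ⟨q, hq, rfl⟩
        exact ⟨arcsOf q, hq, rfl⟩
    rw [himage]
    exact isOpen_arcTriangle.isOpenMap_subtype_val _ hpre
  have hev1 : ∀ᶠ k in atTop, gaps (v k) ∈ arcCoord '' {ϑ : ArcTriple | (⟦ϑ⟧ : ArcClass) ∈ U} :=
    ((continuous_gaps.tendsto u).comp hvlim).eventually
      (hopen.mem_nhds ⟨ϑ, hϑ, hu⟩)
  have hev2 : ∀ᶠ k in atTop, v k 0 < v k 1 :=
    (tendsto_pi_nhds.1 hvlim 0).eventually_lt (tendsto_pi_nhds.1 hvlim 1) h01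
  have hev3 : ∀ᶠ k in atTop, v k 1 < v k 2 :=
    (tendsto_pi_nhds.1 hvlim 1).eventually_lt (tendsto_pi_nhds.1 hvlim 2) h12
  filter_upwards [hev1, hev2, hev3] with k hk1 hk2 hk3
  have hmono : ∀ i j, v k i < v k j → n k i < n k j := by
    intro i j hij
    by_contra! hle
    refine absurd hij (not_lt.2 ?_)
    simp only [hv]
    gcongr
    exact_mod_cast hle
  have hmem : n k ∈ increasingTriples (k + 1) B := by
    simp only [increasingTriples, Finset.mem_filter, Finset.mem_univ, true_and]
    refine ⟨Fin.strictMono_iff_lt_succ.2 fun i => ?_, ?_⟩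
    · fin_cases i
      · exact hmono 0 1 hk2
      · exact hmono 1 2 hk3
    · obtain ⟨ϑ', hϑ', hc⟩ := hk1
      exact ⟨ϑ', hasArcs_of_gaps hc, hUB hϑ'⟩
  simp only [Function.comp_apply, cellDensity]
  refine le_trans (le_of_eq ?_) (Finset.single_le_sum (f := fun n => (cell n).indicator (fun _ =>
    ENNReal.ofReal ((((k + 1 : ℕ) : ℝ) / (2 * Real.pi)) ^ 3) *
      combMeasure (k + 1) {ξ | IsSupportedBy ξ n}) u) (fun _ _ => zero_le) hmem)
  rw [Set.indicator_of_mem (hn k), ENNReal.ofReal_mul (by positivity), ofReal_measureReal]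

/-- The lower bound of the limit from Fatou's lemma; as the boundary of `B` is null, the interior
of `B` carries the whole integral. -/
theorem lintegral_density_le_liminf {B : Set ArcClass}
    (hfr : classArea (frontier B) = 0) :
    ∫⁻ q in B, ENNReal.ofReal (density q) ∂classArea ≤
      liminf (fun k => combMeasure (k + 1) (supportEvent (k + 1) B)) atTop := by
  have hπ := Real.pi_pos
  set V : Set ArcTriple := {ϑ | (⟦ϑ⟧ : ArcClass) ∈ interior B} with hV
  have hVo : IsOpen V := isOpen_interior.preimage continuous_quotient_mk'
  set F : ArcTriple → ENNReal :=
    V.indicator fun ϑ => ENNReal.ofReal (arcDensity ϑ / (2 * Real.pi)) with hF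
  have hFm : Measurable F := (ENNReal.continuous_ofReal.comp
    (continuous_arcDensity.div_const _)).measurable.indicator hVo.measurableSet
  have hFs : ∀ ϑ, F (shiftArcs ϑ) = F ϑ := by
    intro ϑ
    have hiff : shiftArcs ϑ ∈ V ↔ ϑ ∈ V := by
      simp only [hV, Set.mem_ofPred_eq, Quotient.sound (shiftArcs_equiv ϑ)]
    by_cases h : ϑ ∈ V
    · rw [hF, Set.indicator_of_mem h, Set.indicator_of_mem (hiff.2 h),
        arcDensity_eq (shiftArcs_equiv ϑ)]
    · rw [hF, Set.indicator_of_notMem h, Set.indicator_of_notMem (mt hiff.1 h)]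
  have hae : (B : Set ArcClass) =ᵐ[classArea] interior B := by
    refine (Filter.EventuallyEq.symm ?_)
    exact interior_ae_eq_of_null_frontier hfr
  have hint : ∫⁻ q in B, ENNReal.ofReal (density q) ∂classArea =
      ∫⁻ u : Fin 3 → ℝ, {u : Fin 3 → ℝ | 0 < u 0 ∧ u 2 < 2 * Real.pi}.indicator
        (fun u => Function.extend arcCoord F 0 (gaps u)) u := by
    have hm : MeasurableSet (interior B) := by
      exact measurableSet_quotient.2 hVo.measurableSet
    have h1 := lintegral_extend_gaps hFs hFm
    have h2 : ENNReal.ofReal (2 * Real.pi) * ∫⁻ ϑ, F ϑ ∂arcArea =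
        ∫⁻ ϑ in V, ENNReal.ofReal (arcDensity ϑ) ∂arcArea := by
      rw [hF, lintegral_indicator hVo.measurableSet,
        ← lintegral_const_mul' _ _ ENNReal.ofReal_ne_top]
      refine lintegral_congr fun ϑ => ?_
      rw [← ENNReal.ofReal_mul (by positivity), mul_div_cancel₀ _ (by positivity)]
    rw [setLIntegral_congr hae, setLIntegral_density hm, ← h2, ← h1, ← mul_assoc,
      ENNReal.inv_mul_cancel (by norm_num) (by norm_num), one_mul]
  rw [hint]
  calc _ ≤ ∫⁻ u, liminf (fun k => cellDensity (k + 1) B u) atTop := by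
        refine lintegral_mono fun u => ?_
        by_cases hu : u ∈ {u : Fin 3 → ℝ | 0 < u 0 ∧ u 2 < 2 * Real.pi}
        · rw [Set.indicator_of_mem hu]
          by_cases hr : ∃ ϑ, arcCoord ϑ = gaps u
          · obtain ⟨ϑ, hϑ⟩ := hr
            rw [← hϑ, measurableEmbedding_arcCoord.injective.extend_apply]
            by_cases hϑV : ϑ ∈ V
            · rw [hF, Set.indicator_of_mem hϑV]
              exact le_liminf_cellDensity isOpen_interior interior_subset hu.1 hu.2 hϑ hϑV
            · rw [hF, Set.indicator_of_notMem hϑV]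
              exact zero_le
          · rw [Function.extend_apply' _ _ _ hr]
            exact zero_le
        · rw [Set.indicator_of_notMem hu]
          exact zero_le
    _ ≤ liminf (fun k => ∫⁻ u, cellDensity (k + 1) B u) atTop :=
        lintegral_liminf_le fun k => measurable_cellDensity _ _
    _ ≤ _ := liminf_le_liminf (Eventually.of_forall fun k =>
        lintegral_cellDensity_le (Nat.succ_pos k) B)

theorem eventually_lt_measureReal {B : Set ArcClass}
    (hfr : classArea (frontier B) = 0) {c : ℝ} (hc : c < ∫ q in B, density q ∂classArea) :
    ∀ᶠ k in atTop, c < (combMeasure (k + 1)).real (supportEvent (k + 1) B) := by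
  rcases lt_or_ge c 0 with h | h
  · exact Eventually.of_forall fun k => h.trans_le measureReal_nonneg
  rw [setIntegral_density] at hc
  have h1 : ENNReal.ofReal c < ∫⁻ q in B, ENNReal.ofReal (density q) ∂classArea :=
    (ENNReal.ofReal_lt_iff_lt_toReal h (ne_top_of_le_ne_top ENNReal.one_ne_top
      (lintegral_density ▸ setLIntegral_le_lintegral _ _))).2 hc
  filter_upwards [eventually_lt_of_lt_liminf (h1.trans_le (lintegral_density_le_liminf hfr))]
    with k hk
  exact (ENNReal.ofReal_lt_iff_lt_toReal h (measure_ne_top _ _)).1 hk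

/-- Weak convergence. Fatou's lemma gives the lower bound for `B` and for its complement, and
the upper bound for `B` follows from the latter because the limit has mass one. -/
theorem tendsto_supportEvent {B : Set ArcClass} (hB : MeasurableSet B)
    (hfr : classArea (frontier B) = 0) :
    Tendsto (fun N : ℕ => (combMeasure N).real (supportEvent N B)) atTop
      (𝓝 (∫ q in B, density q ∂classArea)) := by
  rw [← tendsto_add_atTop_iff_nat 1]
  have hadd := integral_add_compl hB integrable_density
  rw [integral_density] at hadd
  refine tendsto_order.2 ⟨fun c hc => eventually_lt_measureReal hfr hc, fun c hc => ?_⟩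
  have hc' : 1 - c < ∫ q in Bᶜ, density q ∂classArea := by linarith
  filter_upwards [eventually_lt_measureReal (by rwa [frontier_compl]) hc'] with k hk
  have h1 := ENNReal.toReal_mono ENNReal.one_ne_top (supportEvent_add_compl_le_one (k + 1) B)
  rw [ENNReal.toReal_add (measure_ne_top _ _) (measure_ne_top _ _), ENNReal.toReal_one] at h1
  simp only [Measure.real] at hk ⊢
  linarith

end CircularComb

theorem theorem2 :
    -- almost surely at most one unordered triple of teeth supports the hoop,
    (∀ N : ℕ, ∀ᵐ ξ ∂(CircularComb.combMeasure N), ∀ n m : Fin 3 → Fin N,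
      CircularComb.IsSupportedBy ξ n → CircularComb.IsSupportedBy ξ m →
        Set.range n = Set.range m) ∧
    -- and exactly one if no two teeth are opposite to each other
    (∀ N : ℕ, 3 ≤ N → Odd N → ∀ᵐ ξ ∂(CircularComb.combMeasure N),
      ∃ n : Fin 3 → Fin N, CircularComb.IsSupportedBy ξ n) ∧
    -- the limit density of the support triple `φ` is rotation invariant, and it is the density in
    -- terms of the arcs divided by `2π`, the length of the orbits of the group of rotations
    (∀ (φ : Fin 3 → Real.Angle) (ϑ : CircularComb.ArcTriple), CircularComb.HasArcs φ ϑ →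
      ∀ (N : ℕ → ℕ) (n : ∀ k, Fin 3 → Fin (N k)), Tendsto N atTop atTop →
        (∀ i, Tendsto (fun k => CircularComb.toothAngle (N k) (n k i)) atTop (𝓝 (φ i))) →
        Tendsto (fun k => ((N k : ℝ) / (2 * Real.pi)) ^ 3 *
            (CircularComb.combMeasure (N k)).real
              {ξ | CircularComb.IsSupportedBy ξ (n k)}) atTop
          (𝓝 (CircularComb.density ⟦ϑ⟧ / (2 * Real.pi)))) ∧
    -- `density` is a probability density, and the laws of the reduced support triple converge
    -- weakly to the law with this density
    (∀ q, 0 ≤ CircularComb.density q) ∧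
    Integrable CircularComb.density CircularComb.classArea ∧
    ∫ q, CircularComb.density q ∂CircularComb.classArea = 1 ∧
    ∀ B : Set CircularComb.ArcClass, MeasurableSet B →
      CircularComb.classArea (frontier B) = 0 →
      Tendsto (fun N : ℕ => (CircularComb.combMeasure N).real
          {ξ | ∃ (n : Fin 3 → Fin N) (ϑ : CircularComb.ArcTriple),
            CircularComb.IsSupportedBy ξ n ∧
            CircularComb.HasArcs (fun i => CircularComb.toothAngle N (n i)) ϑ ∧ ⟦ϑ⟧ ∈ B})
        atTop (𝓝 (∫ q in B, CircularComb.density q ∂CircularComb.classArea)) := by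
  refine ⟨CircularComb.ae_range_eq, fun N hN hodd => Eventually.of_forall fun ξ =>
    CircularComb.exists_isSupportedBy hN hodd ξ,
    fun φ ϑ hφ N n hN hn => CircularComb.tendsto_density hφ hN hn, CircularComb.density_nonneg,
    CircularComb.integrable_density, CircularComb.integral_density, fun B hB hfr => ?_⟩
  simp only [← CircularComb.supportEvent_eq]
  exact CircularComb.tendsto_supportEvent hB hfr
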